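/- Let $C$ be a nonsingular projective curve over $\mathbb{C}$ of genus $g(C)$, let $a_1$ be a meromorphic section of the canonical sheaf $K_C$ and $a_2$ a meromorphic section of $K_C^{\otimes 2}$. Let $\overline{T^*C}=\mathbb{P}(K_C\oplus\mathcal{O}_C)\to C$ be the compactified cotangent bundle, with tautological $1$-form $\eta$, and let the spectral curve $\Sigma\subset\overline{T^*C}$ be the divisor of zeros of $\eta^2+\pi^*(a_1)\eta+\pi^*(a_2)$, with projection $\pi:\Sigma\to C$ of degree $2$. Assume that $\Sigma$ is irreducible and reduced. Let $$\Delta=\Big(\tfrac14 a_1^2-a_2\Big)=\sum_{i=1}^{m} m_iq_i-\sum_{j=1}^{n} n_jp_j,\qquad m_i,n_j>0,$$ (with the $q_i,p_j\in C$ distinct) be the discriminant divisor, i.e. the divisor of the nonzero meromorphic section $\tfrac14a_1^2-a_2$ of $K_C^{\otimes2}$, and put $$\delta=|\{i\mid m_i\text{ is odd}\}|+|\{j\mid n_j\text{ is odd}\}|.$$ Call a closed point $P$ of $\Sigma$ a cusp if either $\Sigma$ is, near $P$, analytically isomorphic to $t^2-s^{2m+1}=0$ for some $m\ge 1$, i.e.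 $\widehat{\mathcal{O}}_{\Sigma,P}\cong\mathbb{C}[[s,t]]/(t^2-s^{2m+1})$ as $\mathbb{C}$-algebras, or $P$ is a nonsingular point of $\Sigma$ at which $\pi$ is ramified (a cusp with $m=0$). Then $\Sigma$ has only finitely many cusps, and $\delta$ equals the number of cusps of $\Sigma$. Consequently the geometric genus of $\Sigma$ (the genus of its normalization) is $$p_g(\Sigma)=2g(C)-1+\tfrac12\,(\text{the number of cusps of }\Sigma).$$ -/

import Mathlib

noncomputable section

open AlgebraicGeometry CategoryTheory Polynomial TensorProduct

/-! ### Places of a field over `ℂ`, Riemann–Roch spaces and the genus -/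

/-- A place of a field `F` over `ℂ`: a discrete valuation ring of `F` that contains the constants.
If `F` is the function field of a curve, its places are the closed points of the (unique)
nonsingular projective curve with function field `F`. -/
structure Place (F : Type) [Field F] [Algebra ℂ F] where
  ring : ValuationSubring F
  isDVR : IsDiscreteValuationRing ring
  algebraMap_mem : ∀ c : ℂ, algebraMap ℂ F c ∈ ring

namespace Place

variable {F : Type} [Field F] [Algebra ℂ F]

/-- The normalised valuation `f ↦ exp (- ord f)`, with `0 ↦ 0`. -/
def val (P : Place F) : Valuation F (WithZero (Multiplicative ℤ)) :=
  haveI := P.isDVR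
  (IsDiscreteValuationRing.maximalIdeal P.ring).valuation F

/-- The order of vanishing of `f` at a place (only meaningful for `f ≠ 0`; here `ord 0 = 0`). -/
def ord (P : Place F) (f : F) : ℤ := -WithZero.log (P.val f)

theorem val_algebraMap_le (P : Place F) (c : ℂ) : P.val (algebraMap ℂ F c) ≤ 1 := by
  have := P.isDVR
  exact (IsDiscreteValuationRing.maximalIdeal P.ring).valuation_le_one
    (K := F) ⟨algebraMap ℂ F c, P.algebraMap_mem c⟩

/-- The Riemann–Roch space
`L(D) = {f | f = 0 or ord_i f + D i ≥ 0 for all i}` of the divisor `D = ∑ D i · P i`. -/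
def rrSpace {ι : Type} (P : ι → Place F) (D : ι →₀ ℤ) : Submodule ℂ F where
  carrier := {f | ∀ i, (P i).val f ≤ WithZero.exp (D i)}
  add_mem' hf hg i := (Valuation.map_add _ _ _).trans (max_le (hf i) (hg i))
  zero_mem' i := by simp
  smul_mem' c f hf i := by
    rw [Algebra.smul_def, map_mul]
    exact (mul_le_mul' ((P i).val_algebraMap_le c) (hf i)).trans (one_mul _).le

/-- The genus of the nonsingular projective curve over `ℂ` with function field `F` whose closed
points are the `P i`: the supremum over all divisors `D` of `deg D + 1 - dim L(D)`. (For `D = 0`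
this number is `0`. All points have degree one, as `ℂ` is algebraically closed.) -/
def genus {ι : Type} (P : ι → Place F) : ℕ∞ :=
  ⨆ D : ι →₀ ℤ, (((D.sum fun _ n => n) + 1 - (Module.finrank ℂ (rrSpace P D) : ℤ)).toNat : ℕ∞)

end Place

/-! ### Nonsingular projective curves over `ℂ` -/

/-- A nonsingular projective curve over `ℂ`: an integral scheme, proper over `ℂ`, whose local rings
at closed points are discrete valuation rings, i.e. regular of dimension one. -/
structure NonsingularCurve where
  scheme : Scheme.{0}
  str : scheme ⟶ Spec (CommRingCat.of ℂ)
  isIntegral : IsIntegral scheme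
  isProper : IsProper str
  isDVR : ∀ x : scheme, IsClosed ({x} : Set scheme) →
    IsDiscreteValuationRing (scheme.presheaf.stalk x)

namespace NonsingularCurve

instance (C : NonsingularCurve) : IsIntegral C.scheme := C.isIntegral

/-- The closed points of `C`. -/
abbrev Pt (C : NonsingularCurve) : Type := {x : C.scheme // IsClosed ({x} : Set C.scheme)}

/-- The function field of `C`. -/
abbrev K (C : NonsingularCurve) : Type := C.scheme.functionField

/-- The local ring of `C` at a closed point. -/
abbrev O (C : NonsingularCurve) (x : C.Pt) : Type := C.scheme.presheaf.stalk x.1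

/-- The germs of constant functions. -/
def const (C : NonsingularCurve) (x : C.scheme) : ℂ →+* C.scheme.presheaf.stalk x :=
  ((Scheme.ΓSpecIso (CommRingCat.of ℂ)).inv ≫ C.str.appTop ≫
    C.scheme.presheaf.germ ⊤ x (TopologicalSpace.Opens.mem_top x)).hom

instance (C : NonsingularCurve) (x : C.scheme) : Algebra ℂ (C.scheme.presheaf.stalk x) :=
  (C.const x).toAlgebra

instance (C : NonsingularCurve) : Algebra ℂ C.scheme.functionField :=
  inferInstanceAs (Algebra ℂ (C.scheme.presheaf.stalk (genericPoint C.scheme)))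

instance (C : NonsingularCurve) (x : C.Pt) : IsDiscreteValuationRing (C.scheme.presheaf.stalk x.1) :=
  C.isDVR x.1 x.2

instance (C : NonsingularCurve) (x : C.scheme) :
    IsScalarTower ℂ (C.scheme.presheaf.stalk x) C.scheme.functionField := by
  apply IsScalarTower.of_algebraMap_eq'
  change (C.const (genericPoint C.scheme)) = RingHom.comp
    (C.scheme.presheaf.stalkSpecializes ((genericPoint_spec C.scheme).specializes trivial)).hom (C.const x)
  rw [const, const, ← CommRingCat.hom_comp, Category.assoc, Category.assoc,
    TopCat.Presheaf.germ_stalkSpecializes]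

variable (C : NonsingularCurve)

/-- The place of the function field given by a closed point `x`: the local ring of `C` at `x`,
viewed inside the function field. -/
def place (x : C.Pt) : Place C.K where
  ring := (ValuationRing.valuation (C.O x) C.K).valuationSubring
  isDVR := IsDiscreteValuationRing.RingEquivClass.isDiscreteValuationRing
    (B := (ValuationRing.valuation (C.O x) C.K).integer) (ValuationRing.equivInteger (C.O x) C.K)
  algebraMap_mem c := (ValuationRing.mem_integer_iff (C.O x) C.K _).2
    ⟨algebraMap ℂ (C.O x) c, (IsScalarTower.algebraMap_apply ℂ (C.O x) C.K c).symm⟩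

/-- The genus `g(C)`. -/
def genus : ℕ∞ := Place.genus C.place

/-- Meromorphic sections of the canonical sheaf `K_C`. -/
abbrev Mero1 : Type := Ω[C.K⁄ℂ]

/-- Meromorphic sections of `K_C ^ 2`. -/
abbrev Mero2 : Type := Ω[C.K⁄ℂ] ⊗[C.K] Ω[C.K⁄ℂ]

variable {C}

/-- The meromorphic function `f = a / ω` with `a = f ω` (for `ω ≠ 0`). -/
def coeff1 (ω a : C.Mero1) : C.K := Classical.epsilon fun f => a = f • ω

/-- The meromorphic function `f = s / ω ^ 2` with `s = f ω ^ 2` (for `ω ≠ 0`). -/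
def coeff2 (ω : C.Mero1) (s : C.Mero2) : C.K := Classical.epsilon fun f => s = f • (ω ⊗ₜ[C.K] ω)

/-- The polynomial `Y ^ 2 + α₁ Y + α₂`, where `a₁ = α₁ ω`, `a₂ = α₂ ω ^ 2`. It expresses the
section `η ^ 2 + a₁ η + a₂` in the fibre coordinate `Y` of `T^*C` with `η = Y ω`:
`η ^ 2 + a₁ η + a₂ = (Y ^ 2 + α₁ Y + α₂) ω ^ 2`. -/
def charPoly (ω : C.Mero1) (a₁ : C.Mero1) (a₂ : C.Mero2) : C.K[X] :=
  X ^ 2 + Polynomial.C (coeff1 ω a₁) * X + Polynomial.C (coeff2 ω a₂)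

variable (C)

/-- A local parameter of `C` at `x`. -/
def param (x : C.Pt) : C.O x := (IsDiscreteValuationRing.exists_irreducible (C.O x)).choose

/-- The differential `dt` of the local parameter `t` at `x`, a generator of `K_C` near `x`. -/
def dt (x : C.Pt) : C.Mero1 := KaehlerDifferential.D ℂ C.K (algebraMap (C.O x) C.K (C.param x))

/-- Some nonzero meromorphic differential form on `C`. -/
def frame : C.Mero1 := Classical.epsilon fun ω => ω ≠ 0

variable {C}

/-! ### The discriminant divisor -/

/-- The order at `x` of a meromorphic section of `K_C ^ 2`. -/
def ord2 (s : C.Mero2) (x : C.Pt) : ℤ := (C.place x).ord (coeff2 (C.dt x) s)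

/-- The discriminant `a₁ ^ 2 / 4 - a₂`. -/
def discr (a₁ : C.Mero1) (a₂ : C.Mero2) : C.Mero2 :=
  (1 / 4 : C.K) • (a₁ ⊗ₜ[C.K] a₁) - a₂

/-- The discriminant divisor `Δ`, as the function `x ↦` (coefficient of `x` in `Δ`). -/
def discrDiv (a₁ : C.Mero1) (a₂ : C.Mero2) (x : C.Pt) : ℤ := ord2 (discr a₁ a₂) x

/-- `δ`: the number of zeros of odd order plus the number of poles of odd order of the
discriminant. -/
def delta (a₁ : C.Mero1) (a₂ : C.Mero2) : ℕ :=
  {x : C.Pt | 0 < discrDiv a₁ a₂ x ∧ Odd (discrDiv a₁ a₂ x)}.ncard +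
  {x : C.Pt | 0 < -discrDiv a₁ a₂ x ∧ Odd (-discrDiv a₁ a₂ x)}.ncard

/-! ### The spectral curve

The fibre over `x` of the compactified cotangent bundle `ℙ(K_C ⊕ 𝒪_C)` is a projective line,
with affine coordinate `Y` (where `η = Y dt`) and `Z = 1 / Y` near infinity. The divisor of zeros of
`η ^ 2 + a₁ η + a₂` is given near this fibre by `q(Y) = 0` and by `Z ^ 2 q(1 / Z) = 0`, where
`q = A Y ^ 2 + B Y + C` is obtained from `Y ^ 2 + α₁ Y + α₂` by clearing denominators so that the
coefficients of `q` are in `𝒪_{C,x}` without common zero at `x`. -/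

theorem exists_primitive (x : C.Pt) (p : C.K[X]) (hp : p ≠ 0) :
    ∃ q : (C.O x)[X], q.IsPrimitive ∧
      ∃ c : C.K, c ≠ 0 ∧ q.map (algebraMap (C.O x) C.K) = Polynomial.C c * p := by
  classical
  let _ : StrongNormalizationMonoid (C.O x) :=
    UniqueFactorizationMonoid.strongNormalizationMonoid
  let _ : NormalizedGCDMonoid (C.O x) := UniqueFactorizationMonoid.toNormalizedGCDMonoid (C.O x)
  obtain ⟨b, hbm, hb⟩ := IsLocalization.integerNormalization_spec (nonZeroDivisors (C.O x)) p
  set r := IsLocalization.integerNormalization (nonZeroDivisors (C.O x)) p with hr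
  have hb0 : algebraMap (C.O x) C.K b ≠ 0 :=
    IsFractionRing.to_map_ne_zero_of_mem_nonZeroDivisors hbm
  have hb' : r.map (algebraMap (C.O x) C.K) =
      Polynomial.C (algebraMap (C.O x) C.K b) * p := by
    rw [hb, Algebra.smul_def]
    rfl
  have hr0 : r ≠ 0 := by
    intro h
    rw [h, Polynomial.map_zero, eq_comm, mul_eq_zero, Polynomial.C_eq_zero] at hb'
    exact hb'.elim hb0 hp
  have hc0 : algebraMap (C.O x) C.K r.content ≠ 0 := by
    simpa [Polynomial.content_eq_zero_iff] using hr0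
  refine ⟨r.primPart, r.isPrimitive_primPart,
    algebraMap (C.O x) C.K b / algebraMap (C.O x) C.K r.content, div_ne_zero hb0 hc0, ?_⟩
  have h := congrArg (Polynomial.map (algebraMap (C.O x) C.K)) r.eq_C_content_mul_primPart
  rw [hb', Polynomial.map_mul, Polynomial.map_C] at h
  apply mul_left_cancel₀ (Polynomial.C_ne_zero.2 hc0)
  rw [← h, ← mul_assoc, ← Polynomial.C_mul, mul_div_cancel₀ _ hc0]

theorem charPoly_ne_zero (ω : C.Mero1) (a₁ : C.Mero1) (a₂ : C.Mero2) : charPoly ω a₁ a₂ ≠ 0 := by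
  intro h
  have := congrArg (Polynomial.coeff · 2) h
  simp [charPoly] at this

/-- The primitive polynomial `q` (unique up to units) that is a nonzero multiple of
`Y ^ 2 + α₁ Y + α₂`. -/
def fibreEq (a₁ : C.Mero1) (a₂ : C.Mero2) (x : C.Pt) : (C.O x)[X] :=
  (exists_primitive x (charPoly (C.dt x) a₁ a₂) (charPoly_ne_zero _ _ _)).choose

variable (C) in
/-- The residue field of `C` at `x` (it is `ℂ`). -/
abbrev kappa (x : C.Pt) : Type := IsLocalRing.ResidueField (C.O x)

/-- The equation of the spectral curve near a point of the fibre over `x`: `q(Y)` near the point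
with affine coordinate `Y = y`, and `Z ^ 2 q(1 / Z)` near the point at infinity. -/
def localEq (a₁ : C.Mero1) (a₂ : C.Mero2) (x : C.Pt) : OnePoint (C.kappa x) → (C.O x)[X]
  | some _ => fibreEq a₁ a₂ x
  | none => (fibreEq a₁ a₂ x).reflect 2

/-- The value at the point of the coordinate (`Y` at finite points, `Z` at infinity) that is used
near the point. -/
def coord (x : C.Pt) : OnePoint (C.kappa x) → C.kappa x
  | some y => y
  | none => 0

/-- A closed point of the spectral curve `Σ`: a closed point `x` of `C` and a point of the
projective line `\overline{T^*_x C}` at which the equation of `Σ` vanishes. -/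
structure SpectralPoint (a₁ : C.Mero1) (a₂ : C.Mero2) where
  base : C.Pt
  fibre : OnePoint (C.kappa base)
  vanishes : (localEq a₁ a₂ base fibre).eval₂ (IsLocalRing.residue (C.O base))
    (coord base fibre) = 0

namespace SpectralPoint

variable {a₁ : C.Mero1} {a₂ : C.Mero2}

/-- The coordinate ring `𝒪_{C,x}[Y] / (q(Y))` or `𝒪_{C,x}[Z] / (Z ^ 2 q(1 / Z))` of the part of
`Σ` over `Spec 𝒪_{C,x}` in the chart around the point. -/
abbrev Chart (P : SpectralPoint a₁ a₂) : Type := AdjoinRoot (localEq a₁ a₂ P.base P.fibre)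

/-- Evaluation of functions at the point. -/
def eval (P : SpectralPoint a₁ a₂) : P.Chart →+* C.kappa P.base :=
  AdjoinRoot.lift (IsLocalRing.residue (C.O P.base)) (coord P.base P.fibre) P.vanishes

/-- The ideal of functions vanishing at the point. -/
abbrev ideal (P : SpectralPoint a₁ a₂) : Ideal P.Chart := RingHom.ker P.eval

instance (P : SpectralPoint a₁ a₂) : P.ideal.IsPrime := RingHom.ker_isPrime P.eval

/-- The local ring `𝒪_{Σ,P}`. -/
abbrev LocalRing (P : SpectralPoint a₁ a₂) : Type := Localization.AtPrime P.ideal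

/-- The completed local ring of `Σ` at `P`. -/
abbrev Completed (P : SpectralPoint a₁ a₂) : Type :=
  AdicCompletion (IsLocalRing.maximalIdeal P.LocalRing) P.LocalRing

end SpectralPoint

/-- The completed local ring `ℂ⟦s, t⟧ / (t ^ 2 - s ^ (2m + 1))` of the plane curve germ
`t ^ 2 - s ^ (2m + 1) = 0`, with `s = X 0`, `t = X 1`. -/
abbrev CuspRing (m : ℕ) : Type :=
  MvPowerSeries (Fin 2) ℂ ⧸ Ideal.span
    {(MvPowerSeries.X 1 ^ 2 - MvPowerSeries.X 0 ^ (2 * m + 1) : MvPowerSeries (Fin 2) ℂ)}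

namespace SpectralPoint

variable {a₁ : C.Mero1} {a₂ : C.Mero2}

/-- `P` is a singular point of `Σ` of the form `t ^ 2 - s ^ (2m + 1) = 0` with `m ≥ 1`. -/
def IsSingularCusp (P : SpectralPoint a₁ a₂) : Prop :=
  ∃ m : ℕ, 1 ≤ m ∧ Nonempty (P.Completed ≃ₐ[ℂ] CuspRing m)

/-- `P` is a nonsingular point of `Σ` at which `π : Σ → C` is ramified: the pull-back of a local
parameter of `C` vanishes to order at least two. -/
def IsSmoothRamification (P : SpectralPoint a₁ a₂) : Prop :=
  IsRegularLocalRing P.LocalRing ∧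
    algebraMap (C.O P.base) P.LocalRing (C.param P.base) ∈
      IsLocalRing.maximalIdeal P.LocalRing ^ 2

/-- `P` is a cusp of `Σ`, smooth ramification points of `π` counting as cusps with `m = 0`. -/
def IsCusp (P : SpectralPoint a₁ a₂) : Prop := P.IsSingularCusp ∨ P.IsSmoothRamification

end SpectralPoint

/-- The spectral curve `Σ` is irreducible (and reduced). As `Σ` has no fibre of `\overline{T^*C}`
as a component, this says that its generic fibre over `C` is irreducible. -/
def IsIrreducibleSpectral (a₁ : C.Mero1) (a₂ : C.Mero2) : Prop :=
  Irreducible (charPoly C.frame a₁ a₂)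

/-- The function field of `Σ`. -/
abbrev SpectralField (a₁ : C.Mero1) (a₂ : C.Mero2) : Type := AdjoinRoot (charPoly C.frame a₁ a₂)

/-- The geometric genus `p_g(Σ)` of an irreducible spectral curve: the genus of its normalization,
i.e. of the nonsingular projective curve whose closed points are all the places of the function
field of `Σ`. -/
def geometricGenus (a₁ : C.Mero1) (a₂ : C.Mero2) (h : IsIrreducibleSpectral a₁ a₂) : ℕ∞ :=
  haveI : Fact (Irreducible (charPoly C.frame a₁ a₂)) := ⟨h⟩
  Place.genus (fun P : Place (SpectralField a₁ a₂) => P)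

end NonsingularCurve

end

/-!
# Cusps and the geometric genus of a spectral curve of degree two

Locally on `C` the spectral curve is the double cover `a Y ^ 2 + b Y + c = 0`, and its
discriminant `b ^ 2 - 4 a c` is the discriminant `Δ` of the curve up to a square
(`exists_fibreDisc_eq`). In particular both have orders of the same parity at each point. The
theorem has a local part, which identifies the cusps with the points of odd order of `Δ`, and a
global part, which is the formula of Riemann and Hurwitz for the extension of function fields
defined by a square root of `Δ`.

*The local part* (`SpectralPoint.isCusp_iff`). Let `s` be a local parameter of `C` at `x`, and let
`s ^ N` times a unit be the discriminant of the local equation.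

If `N` is even, the discriminant has a square root in `ℂ⟦s⟧`, so through each point over `x`
passes a branch on which `s` is a parameter (`QuadraticGerm.exists_branch_of_even`). Hence `s` is
not in the square of the maximal ideal, and the point is not a smooth ramification point. Nor is
it a singular cusp, as every homomorphism from the ring of the cusp `t ^ 2 = s ^ (2m + 1)`, `m ≥
1`, to power series in `τ` has values without linear term (`CuspRing.coeff_one_algHom_eq_zero`).

If `N = 2m + 1` is odd, the equation has a double root over `x`, so there is exactly one point
over `x` (`existsUnique_vanishes`). In the chart around it `a` is a unit, and the local ring is
generated over that of `C` by the square root `2 a Y + b` of the discriminant. It is parametrised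
by a square root `τ` of `s`, with `2 a Y + b` equal to `τ ^ N` times a unit that is even in `τ`.
Its completion is therefore the ring of power series in `τ` without odd terms of degree less than
`N`, which is also the image of the ring of the cusp `t ^ 2 = s ^ N` under `s = τ ^ 2`, `t = τ ^
N` (`QuadraticGerm.nonempty_algEquiv_cuspRing`). If `N = 1`, the maximal ideal is generated by the
square root of the discriminant, so the point is nonsingular and ramified
(`QuadraticGerm.isRegularLocalRing_of_disc`).

*The global part* (`Place.genus_quadratic`). The genus is treated in the language of places of a
function field `F` of one variable. Counting functions with poles bounded by multiples of the pole
divisor of a nonconstant function `g` shows that this divisor has degree `[F : ℂ(g)]`, that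
principal divisors have degree zero, and that the genus is finite and is the value of `deg D + 1 -
dim L(D)` for all large `D` (`Place.exists_genus_eq`). For `L = K(y)` with `y ^ 2 = β`, let `E` be
half of the divisor of `β`, rounded down, so that `2 deg E` is minus the number of places of odd
order of `β`. The conjugation `y ↦ -y` splits `L(π^* D)` as `L(D) ⊕ L(D + E) y`
(`Place.finrank_LSpace_pullback`), and `deg π^* D = 2 deg D`. Comparing dimensions for large `D`
gives `p = 2 g - 1 - deg E`.

*The link between the two.* The differentials of the function field of `C` are generated by that
of a local parameter, so the field has transcendence degree one, and by the valuative criterion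
the closed points of `C` are exactly its places (`place_injective`, `place_surjective`). That `Δ`
has finitely many zeros and poles follows from the finite generation of the coordinate rings of
affine open subsets of `C` (`finite_setOf_ord2_ne_zero`).
-/

noncomputable section

open AlgebraicGeometry CategoryTheory Polynomial TensorProduct

/-! ### Places and their independence -/

namespace Place

variable {F : Type} [Field F] [Algebra ℂ F]

theorem mem_ring_iff (P : Place F) (f : F) : f ∈ P.ring ↔ P.val f ≤ 1 := by
  have := P.isDVR
  constructor
  · intro h
    exact (IsDiscreteValuationRing.maximalIdeal P.ring).valuation_le_one (K := F) ⟨f, h⟩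
  · intro h
    obtain ⟨a, rfl⟩ := IsDiscreteValuationRing.exists_lift_of_le_one (A := P.ring) h
    exact a.2

theorem ext_ring {P Q : Place F} (h : P.ring = Q.ring) : P = Q := by
  cases P; cases Q; simpa using h

theorem exists_val_eq_exp_neg_one (P : Place F) : ∃ t : F, P.val t = WithZero.exp (-1 : ℤ) := by
  have := P.isDVR
  exact (IsDiscreteValuationRing.maximalIdeal P.ring).valuation_exists_uniformizer F

theorem val_eq_exp (P : Place F) {f : F} (hf : f ≠ 0) : P.val f = WithZero.exp (-P.ord f) := by
  rw [ord, neg_neg, WithZero.exp_log]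
  simpa using hf

theorem ord_eq_of_val_eq (P : Place F) {f : F} {n : ℤ} (h : P.val f = WithZero.exp n) :
    P.ord f = -n := by
  rw [ord, h, WithZero.log_exp]

theorem ord_mul (P : Place F) {f g : F} (hf : f ≠ 0) (hg : g ≠ 0) :
    P.ord (f * g) = P.ord f + P.ord g := by
  rw [ord, map_mul, WithZero.log_mul (by simpa using hf) (by simpa using hg), ord, ord]
  ring

@[simp] theorem ord_one (P : Place F) : P.ord 1 = 0 := by simp [ord]

theorem ord_inv (P : Place F) (f : F) : P.ord f⁻¹ = -P.ord f := by
  rw [ord, map_inv₀, WithZero.log_inv, ord]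

theorem ord_pow (P : Place F) (f : F) (n : ℕ) : P.ord (f ^ n) = n * P.ord f := by
  rw [ord, map_pow, WithZero.log_pow, ord]
  simp

theorem val_le_exp_iff (P : Place F) {f : F} (hf : f ≠ 0) (n : ℤ) :
    P.val f ≤ WithZero.exp n ↔ -n ≤ P.ord f := by
  rw [P.val_eq_exp hf, WithZero.exp_le_exp]
  omega

theorem val_le_one_iff (P : Place F) {f : F} (hf : f ≠ 0) : P.val f ≤ 1 ↔ 0 ≤ P.ord f := by
  rw [← WithZero.exp_zero, P.val_le_exp_iff hf, neg_zero]

theorem val_lt_one_iff (P : Place F) {f : F} (hf : f ≠ 0) : P.val f < 1 ↔ 0 < P.ord f := by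
  rw [P.val_eq_exp hf, ← WithZero.exp_zero, WithZero.exp_lt_exp]
  omega

theorem val_lt_one_iff_le_exp (P : Place F) (f : F) :
    P.val f < 1 ↔ P.val f ≤ WithZero.exp (-1) := by
  rcases eq_or_ne f 0 with rfl | hf
  · simp
  · rw [P.val_lt_one_iff hf, P.val_le_exp_iff hf]
    omega

theorem val_const (P : Place F) {c : ℂ} (hc : c ≠ 0) : P.val (algebraMap ℂ F c) = 1 := by
  apply le_antisymm (P.val_algebraMap_le c)
  have h := P.val_algebraMap_le c⁻¹
  rw [map_inv₀, map_inv₀] at h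
  have h0 : 0 < P.val (algebraMap ℂ F c) := by simpa [zero_lt_iff] using hc
  exact (inv_le_one₀ h0).mp h

theorem ne_zero_of_val_eq_exp {P : Place F} {f : F} {n : ℤ} (h : P.val f = WithZero.exp n) :
    f ≠ 0 :=
  (Valuation.ne_zero_iff P.val).1 (h ▸ WithZero.exp_ne_zero)

/-- The place defined by a nontrivial valuation with values in `ℤᵐ⁰` that is trivial on the
constants. The valuation itself need not be normalised. -/
def ofValuation (v : Valuation F (WithZero (Multiplicative ℤ))) (hv : ∃ f, f ≠ 0 ∧ v f ≠ 1)
    (hc : ∀ c : ℂ, v (algebraMap ℂ F c) ≤ 1) : Place F where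
  ring := v.valuationSubring
  isDVR := by
    have : Nontrivial (MonoidWithZeroHom.valueGroup (.ofClass v)) := by
      obtain ⟨f, hf, hf1⟩ := hv
      rw [Subgroup.nontrivial_iff_exists_ne_one]
      refine ⟨Units.mk0 (v f) (by simpa using hf), ?_, ?_⟩
      · apply MonoidWithZeroHom.mem_valueGroup
        exact ⟨f, rfl⟩
      · intro h
        exact hf1 (by simpa using congrArg Units.val h)
    infer_instance
  algebraMap_mem c := hc c

theorem ofValuation_mem {v : Valuation F (WithZero (Multiplicative ℤ))} (hv) (hc) (f : F) :
    (ofValuation v hv hc).val f ≤ 1 ↔ v f ≤ 1 := by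
  rw [← mem_ring_iff]
  rfl

theorem val_lt_one_iff_inv (P : Place F) {f : F} (hf : f ≠ 0) :
    P.val f < 1 ↔ ¬ P.val f⁻¹ ≤ 1 := by
  rw [P.val_lt_one_iff hf, P.val_le_one_iff (inv_ne_zero hf), ord_inv]
  omega

/-- A valuation that is at most one on the valuation ring of a place is a power of its normalised
valuation: the exponent is the order of a local parameter. -/
theorem eq_val_pow {P : Place F} {v : Valuation F (WithZero (Multiplicative ℤ))}
    (h : ∀ f, P.val f ≤ 1 → v f ≤ 1) {t : F} (ht : P.val t = WithZero.exp (-1)) {e : ℤ}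
    (he : v t = WithZero.exp (-e)) {f : F} (hf : f ≠ 0) :
    v f = WithZero.exp (-(e * P.ord f)) := by
  have ht0 := ne_zero_of_val_eq_exp ht
  have h1 : ∀ g : F, P.val g = 1 → v g = 1 := by
    intro g hg
    apply le_antisymm (h g hg.le)
    have h2 := h g⁻¹ (by rw [map_inv₀, hg, inv_one])
    have hg0 : g ≠ 0 := by rintro rfl; simp at hg
    have h0 : 0 < v g := by simpa [zero_lt_iff] using hg0
    rw [map_inv₀] at h2
    exact (inv_le_one₀ h0).mp h2
  have h2 := h1 (f * t ^ (-P.ord f)) (by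
    rw [map_mul, map_zpow₀, ht, ← WithZero.exp_zsmul, P.val_eq_exp hf, ← WithZero.exp_add]
    simp)
  rw [map_mul, map_zpow₀, he, ← WithZero.exp_zsmul] at h2
  rw [eq_inv_of_mul_eq_one_left h2, ← WithZero.exp_neg]
  congr 1
  simp
  ring

/-- The valuation rings of two distinct places are incomparable. -/
theorem exists_val_le_one_of_ne {P Q : Place F} (h : P ≠ Q) :
    ∃ f : F, P.val f ≤ 1 ∧ 1 < Q.val f := by
  by_contra! hcon
  apply h
  apply ext_ring
  ext f
  rw [mem_ring_iff, mem_ring_iff]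
  refine ⟨hcon f, fun hQ => ?_⟩
  obtain ⟨t, ht⟩ := P.exists_val_eq_exp_neg_one
  obtain ⟨s, hs⟩ := Q.exists_val_eq_exp_neg_one
  have ht0 := ne_zero_of_val_eq_exp ht
  have hs0 := ne_zero_of_val_eq_exp hs
  have key := fun {g : F} (hg : g ≠ 0) => eq_val_pow hcon ht (Q.val_eq_exp ht0) hg
  have h1 : Q.ord t * P.ord s = 1 := by
    have := key hs0
    rw [hs, WithZero.exp_inj] at this
    omega
  have h2 : 0 ≤ Q.ord t := by
    rw [← Q.val_le_one_iff ht0]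
    apply hcon
    rw [ht, ← WithZero.exp_zero, WithZero.exp_le_exp]
    omega
  have h3 : Q.ord t = 1 := by
    rcases Int.eq_one_or_neg_one_of_mul_eq_one h1 with h | h <;> omega
  rcases eq_or_ne f 0 with rfl | hf
  · simp
  rw [key hf, h3, one_mul, ← WithZero.exp_zero, WithZero.exp_le_exp] at hQ
  rw [P.val_eq_exp hf, ← WithZero.exp_zero, WithZero.exp_le_exp]
  exact hQ

theorem exists_pow_mul_val_lt_one (P : Place F) {f : F} (hf : P.val f < 1) (g : F) :
    ∃ N : ℕ, ∀ n ≥ N, P.val (f ^ n * g) < 1 := by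
  rcases eq_or_ne f 0 with rfl | hf0
  · exact ⟨1, fun n hn => by simp [zero_pow (by omega : n ≠ 0)]⟩
  rcases eq_or_ne g 0 with rfl | hg0
  · exact ⟨0, fun n hn => by simp⟩
  refine ⟨(P.ord g).natAbs + 1, fun n hn => ?_⟩
  rw [P.val_lt_one_iff hf0] at hf
  rw [P.val_lt_one_iff (by positivity), P.ord_mul (by positivity) hg0, P.ord_pow]
  have : (n : ℤ) ≤ n * P.ord f := by nlinarith
  omega

/-- Distinct places are independent: there is a function with a pole at `P` and zeros at finitely
many given other places. -/
theorem exists_val_gt_one_forall_lt_one (P : Place F) (S : Finset (Place F)) (hS : P ∉ S) :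
    ∃ f : F, 1 < P.val f ∧ ∀ Q ∈ S, Q.val f < 1 := by
  classical
  induction S using Finset.induction_on with
  | empty =>
    obtain ⟨t, ht⟩ := P.exists_val_eq_exp_neg_one
    refine ⟨t⁻¹, ?_, by simp⟩
    rw [map_inv₀, ht, ← WithZero.exp_neg, ← WithZero.exp_zero, WithZero.exp_lt_exp]
    omega
  | insert Q S hQ ih =>
    obtain ⟨f, hf1, hf2⟩ := ih fun h => hS (Finset.mem_insert_of_mem h)
    have hPQ : P ≠ Q := fun h => hS (h ▸ Finset.mem_insert_self _ _)
    obtain ⟨g, hg1, hg2⟩ : ∃ g : F, 1 < P.val g ∧ Q.val g < 1 := by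
      obtain ⟨a, ha1, ha2⟩ := exists_val_le_one_of_ne hPQ
      obtain ⟨b, hb1, hb2⟩ := exists_val_le_one_of_ne hPQ.symm
      have ha0 : 0 < Q.val a := zero_lt_one.trans ha2
      refine ⟨b / a, ?_, ?_⟩
      · rw [map_div₀]
        have : 0 < P.val a := by
          rw [zero_lt_iff, Valuation.ne_zero_iff]
          rintro rfl
          simp at ha0
        rw [one_lt_div₀ this]
        exact ha1.trans_lt hb2
      · rw [map_div₀, div_lt_one₀ ha0]
        exact hb1.trans_lt ha2
    have hf0 : f ≠ 0 := by rintro rfl; simp at hf1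
    -- one exponent that works for all places of `S`
    obtain ⟨N, hN⟩ : ∃ N : ℕ, ∀ n ≥ N, ∀ R ∈ S, R.val (f ^ n * g) < 1 := by
      choose! N hN using fun R hR => exists_pow_mul_val_lt_one R (hf2 R hR) g
      refine ⟨S.sup N, fun n hn R hR => hN R hR n ((Finset.le_sup hR).trans hn)⟩
    by_cases hQf : Q.val f ≤ 1
    · refine ⟨f ^ N * g, ?_, ?_⟩
      · rw [map_mul, map_pow]
        exact hg1.trans_le (le_mul_of_one_le_left' (one_le_pow₀ hf1.le))
      · intro R hR
        rcases Finset.mem_insert.1 hR with rfl | hR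
        · rw [map_mul, map_pow]
          exact (mul_le_of_le_one_left' (pow_le_one₀ zero_le hQf)).trans_lt hg2
        · exact hN N le_rfl R hR
    · -- multiply `g` by `f ^ n / (1 + f ^ n)`, a unit where `f` has a pole
      push Not at hQf
      have key : ∀ R : Place F, 1 < R.val f → R.val (1 + f ^ (N + 1)) = R.val (f ^ (N + 1)) := by
        intro R hR
        rw [add_comm]
        apply Valuation.map_add_eq_of_lt_left
        rw [map_one, map_pow]
        exact one_lt_pow₀ hR (by omega)
      have hne : ∀ R : Place F, 1 < R.val f → R.val (f ^ (N + 1) / (1 + f ^ (N + 1)) * g) =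
        R.val g := by
        intro R hR
        rw [map_mul, map_div₀, key R hR, div_self, one_mul]
        simp [hf0]
      refine ⟨f ^ (N + 1) / (1 + f ^ (N + 1)) * g, ?_, ?_⟩
      · rwa [hne P hf1]
      · intro R hR
        rcases Finset.mem_insert.1 hR with rfl | hR
        · rwa [hne _ hQf]
        · have h1 : R.val (1 + f ^ (N + 1)) = 1 := by
            rw [Valuation.map_add_eq_of_lt_left, map_one]
            rw [map_one, map_pow]
            exact pow_lt_one₀ zero_le (hf2 R hR) (by omega)
          rw [div_mul_eq_mul_div, map_div₀, h1, div_one]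
          exact hN (N + 1) (by omega) R hR

/-- A function with prescribed order at `P` that vanishes to high order at finitely many other
places. -/
theorem exists_val_eq_exp_forall_le (P : Place F) (S : Finset (Place F)) (hS : P ∉ S) (n m : ℤ) :
    ∃ f : F, P.val f = WithZero.exp (-n) ∧ ∀ Q ∈ S, Q.val f ≤ WithZero.exp (-m) := by
  obtain ⟨f, hf1, hf2⟩ := P.exists_val_gt_one_forall_lt_one S hS
  obtain ⟨t, ht⟩ := P.exists_val_eq_exp_neg_one
  have hu1 : P.val (f / (1 + f)) = 1 := by
    rw [map_div₀, add_comm, Valuation.map_add_eq_of_lt_left, div_self]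
    · exact (zero_lt_one.trans hf1).ne'
    · rwa [map_one]
  have hu2 : ∀ Q ∈ S, Q.val (f / (1 + f)) < 1 := by
    intro Q hQ
    rw [map_div₀, Valuation.map_add_eq_of_lt_left, map_one, div_one]
    · exact hf2 Q hQ
    · rw [map_one]
      exact hf2 Q hQ
  set u := f / (1 + f) with hu
  choose! s hs using fun Q : Place F => Q.exists_val_eq_exp_neg_one
  choose! N hN using fun Q hQ => exists_pow_mul_val_lt_one Q (hu2 Q hQ) (t ^ n * (s Q) ^ (-m))
  refine ⟨u ^ (S.sup N) * t ^ n, ?_, ?_⟩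
  · rw [map_mul, map_pow, hu1, one_pow, one_mul, map_zpow₀, ht, ← WithZero.exp_zsmul]
    simp
  · intro Q hQ
    have h1 := hN Q hQ _ (Finset.le_sup hQ)
    rw [← mul_assoc, map_mul, map_zpow₀, hs, ← WithZero.exp_zsmul] at h1
    have h2 : (WithZero.exp (-m • -1 : ℤ)) * WithZero.exp (-m) = 1 := by
      rw [← WithZero.exp_add]; simp
    calc Q.val (u ^ S.sup N * t ^ n)
        = Q.val (u ^ S.sup N * t ^ n) * ((WithZero.exp (-m • -1 : ℤ)) * WithZero.exp (-m)) := by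
          rw [h2, mul_one]
      _ ≤ 1 * WithZero.exp (-m) := by
          rw [← mul_assoc]
          exact mul_le_mul_left h1.le _
      _ = _ := one_mul _

end Place

/-! ### Function fields of one variable -/

/-- A function field of one variable over `ℂ`: finitely generated, of transcendence degree one. -/
class IsCurveField (F : Type) [Field F] [Algebra ℂ F] : Prop where
  essFiniteType : Algebra.EssFiniteType ℂ F
  trdeg_eq_one : Algebra.trdeg ℂ F = 1

namespace IsCurveField

variable {F : Type} [Field F] [Algebra ℂ F]

theorem transcendental_of_notMem_range {f : F} (hf : f ∉ (algebraMap ℂ F).range) :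
    Transcendental ℂ f := by
  intro h
  apply hf
  exact minpoly.mem_range_of_degree_eq_one ℂ f
    (IsAlgClosed.degree_eq_one_of_irreducible ℂ (minpoly.irreducible h.isIntegral))

theorem finiteDimensional_adjoin [h : IsCurveField F] {f : F} (hf : Transcendental ℂ f) :
    FiniteDimensional (IntermediateField.adjoin ℂ {f}) F := by
  have h1 := h.essFiniteType
  have hb : IsTranscendenceBasis ℂ (fun _ : Unit => f) := by
    refine ((algebraicIndependent_unique_type_iff (ι := Unit)).2
      hf).isTranscendenceBasis_of_trdeg_le ?_ ?_ <;>
      simp [h.trdeg_eq_one]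
  have h2 : Algebra.IsAlgebraic (IntermediateField.adjoin ℂ {f}) F := by
    convert! hb.isAlgebraic_field <;> simp
  have : Algebra.EssFiniteType (IntermediateField.adjoin ℂ {f}) F :=
    Algebra.EssFiniteType.of_comp ℂ _ _
  exact Algebra.finite_of_essFiniteType_of_isAlgebraic

theorem of_finiteDimensional {L : Type} [Field L] [Algebra ℂ L] [Algebra F L] [IsScalarTower ℂ F L]
    [h : IsCurveField F] [FiniteDimensional F L] : IsCurveField L := by
  have := h.essFiniteType
  refine ⟨Algebra.EssFiniteType.comp ℂ F L, ?_⟩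
  rw [← trdeg_add_eq ℂ F (A := L), h.trdeg_eq_one, trdeg_eq_zero, add_zero]

theorem exists_transcendental (F : Type) [Field F] [Algebra ℂ F] [h : IsCurveField F] :
    ∃ f : F, Transcendental ℂ f := by
  have : Algebra.Transcendental ℂ F := by
    rw [← trdeg_ne_zero_iff, h.trdeg_eq_one]
    exact one_ne_zero
  exact this.transcendental

end IsCurveField

namespace Place

variable {F : Type} [Field F] [Algebra ℂ F]

/-- Valuation rings are integrally closed. -/
theorem val_le_one_of_isIntegral (P : Place F) {R : Type} [CommRing R] [Algebra R F]
    (hR : ∀ r : R, P.val (algebraMap R F r) ≤ 1) {x : F} (hx : IsIntegral R x) : P.val x ≤ 1 := by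
  let φ : R →+* P.ring := (algebraMap R F).codRestrict P.ring.toSubring
    fun r => (P.mem_ring_iff _).2 (hR r)
  have h : (P.ring.subtype).IsIntegralElem x :=
    RingHom.IsIntegralElem.of_comp (f := φ) (g := P.ring.subtype) hx
  obtain ⟨y, hy⟩ := IsIntegrallyClosed.algebraMap_eq_of_integral (R := P.ring) (K := F) (x := x) h
  rw [← mem_ring_iff, ← hy]
  exact y.2

/-- `ℂ(f)` is the fraction field of the polynomial ring `ℂ[f]`, for transcendental `f`. -/
theorem isFractionRing_adjoin {f : F} (hf : Transcendental ℂ f) :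
    let _ : Algebra ℂ[X] (IntermediateField.adjoin ℂ {f}) :=
      (aeval (IntermediateField.AdjoinSimple.gen ℂ f)).toAlgebra
    IsFractionRing ℂ[X] (IntermediateField.adjoin ℂ {f}) := by
  let _ : Algebra ℂ[X] (IntermediateField.adjoin ℂ {f}) :=
      (aeval (IntermediateField.AdjoinSimple.gen ℂ f)).toAlgebra
  have hc : ∀ p : ℂ[X], ((algebraMap ℂ[X] (IntermediateField.adjoin ℂ {f}) p :
      IntermediateField.adjoin ℂ {f}) : F) = aeval f p := by
    intro p
    change algebraMap (IntermediateField.adjoin ℂ {f}) F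
      (aeval (IntermediateField.AdjoinSimple.gen ℂ f) p) = _
    rw [← aeval_algebraMap_apply]
    simp
  have hinj : Function.Injective (algebraMap ℂ[X] (IntermediateField.adjoin ℂ {f})) := by
    intro p q h
    apply transcendental_iff_injective.1 hf
    rw [← hc, ← hc, h]
  have : FaithfulSMul ℂ[X] (IntermediateField.adjoin ℂ {f}) :=
    (faithfulSMul_iff_algebraMap_injective _ _).2 hinj
  refine IsFractionRing.of_field _ _ fun z => ?_
  obtain ⟨r, s, h⟩ := (IntermediateField.mem_adjoin_simple_iff ℂ _).1 z.2
  refine ⟨r, s, ?_⟩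
  apply Subtype.ext
  rw [h]
  simp [hc]


/-- Let `π` be a non-unit of a domain `R` over which a field `F` is an algebra, and let `S` be a
finite set of places of `F` at which `π` vanishes to order `e P`, while elements of `R` not
divisible by `π` are units. Then functions `b P j` for `P ∈ S` and `j < e P` with order `j` at `P`
and large order at the other places of `S` are linearly independent over `R`. -/
theorem exists_linearIndependent_of_ord {R : Type} [CommRing R] [IsDomain R] [Algebra R F]
    [FaithfulSMul R F] {π : R} (hπ0 : π ≠ 0) (hπ : ∀ a : R, a ≠ 0 → ∃ n : ℕ, ¬ π ^ n ∣ a)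
    (S : Finset (Place F))
    (e : Place F → ℕ) (h1 : ∀ P ∈ S, ∀ a : R, P.val (algebraMap R F a) ≤ 1)
    (h2 : ∀ P ∈ S, ∀ a : R, ¬ π ∣ a → P.val (algebraMap R F a) = 1)
    (h3 : ∀ P ∈ S, P.val (algebraMap R F π) = WithZero.exp (-(e P : ℤ))) :
    ∃ b : (Σ P : S, Fin (e P)) → F, LinearIndependent R b := by
  classical
  choose b hb1 hb2 using fun i : (Σ P : S, Fin (e P)) =>
    exists_val_eq_exp_forall_le i.1.1 (S.erase i.1.1) (by simp) i.2 ((S.sup e : ℕ) : ℤ)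
  refine ⟨b, ?_⟩
  have hsmall : ∀ (P : S) (j : Fin (e P)) (i : Σ P : S, Fin (e P)), i.1 ≠ P →
      P.1.val (b i) < WithZero.exp (-(j : ℤ)) := by
    intro P j i hi
    refine (hb2 i P.1 (Finset.mem_erase.2 ⟨fun h => hi (Subtype.ext h.symm), P.2⟩)).trans_lt ?_
    rw [WithZero.exp_lt_exp]
    have h4 : e P ≤ S.sup e := Finset.le_sup (f := e) P.2
    have := j.2
    omega
  -- in a linear relation all coefficients are divisible by `π`
  have hdvd : ∀ g : (Σ P : S, Fin (e P)) → R, ∑ i, g i • b i = 0 → ∀ i, π ∣ g i := by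
    intro g hg
    by_contra! hcon
    obtain ⟨⟨P, j⟩, hj⟩ := hcon
    obtain ⟨j0, hj0, hmin⟩ := WellFounded.has_min
      (wellFounded_lt (α := Fin (e P))) {j | ¬ π ∣ g ⟨P, j⟩} ⟨j, hj⟩
    have hlt : ∀ i ∈ Finset.univ.erase (⟨P, j0⟩ : Σ P : S, Fin (e P)),
        P.1.val (g i • b i) < WithZero.exp (-(j0 : ℤ)) := by
      rintro ⟨Q, k⟩ hi
      rw [Algebra.smul_def, map_mul]
      rcases eq_or_ne Q P with rfl | hQP
      · have hbQ : Q.1.val (b ⟨Q, k⟩) = WithZero.exp (-(k : ℤ)) := hb1 ⟨Q, k⟩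
        rw [hbQ]
        have hne : k ≠ j0 := by rintro rfl; simp at hi
        by_cases hdiv : π ∣ g ⟨Q, k⟩
        · obtain ⟨a, ha⟩ := hdiv
          rw [ha, map_mul, map_mul, h3 Q Q.2]
          calc _ ≤ WithZero.exp (-(e Q : ℤ)) * 1 * 1 := by
                refine mul_le_mul' (mul_le_mul' le_rfl (h1 Q Q.2 a)) ?_
                rw [← WithZero.exp_zero, WithZero.exp_le_exp]
                simp
            _ < _ := by
                rw [mul_one, mul_one, WithZero.exp_lt_exp]
                have := j0.2
                omega
        · have hjj : j0 < k := lt_of_le_of_ne (not_lt.1 (hmin k hdiv)) hne.symm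
          calc _ ≤ 1 * WithZero.exp (-(k : ℤ)) := mul_le_mul' (h1 Q Q.2 _) le_rfl
            _ < _ := by
                rw [one_mul, WithZero.exp_lt_exp]
                have : (j0 : ℕ) < k := hjj
                omega
      · exact (mul_le_of_le_one_left' (h1 P P.2 _)).trans_lt (hsmall P j0 ⟨Q, k⟩ hQP)
    have hv : P.1.val (g ⟨P, j0⟩ • b ⟨P, j0⟩) = WithZero.exp (-(j0 : ℤ)) := by
      rw [Algebra.smul_def, map_mul, h2 P P.2 _ hj0, one_mul]
      exact hb1 ⟨P, j0⟩
    rw [← Finset.add_sum_erase _ _ (Finset.mem_univ (⟨P, j0⟩ : Σ P : S, Fin (e P))),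
      add_eq_zero_iff_eq_neg] at hg
    rw [hg, Valuation.map_neg] at hv
    exact (Valuation.map_sum_lt _ WithZero.exp_ne_zero hlt).ne hv
  have hdvd' : ∀ n : ℕ, ∀ g : (Σ P : S, Fin (e P)) → R, ∑ i, g i • b i = 0 → ∀ i, π ^ n ∣ g i := by
    intro n
    induction n with
    | zero => intro g _ i; simp
    | succ n ih =>
      intro g hg
      choose q hq using hdvd g hg
      intro i
      rw [hq i, pow_succ']
      refine mul_dvd_mul_left _ (ih q ?_ i)
      simp_rw [hq, mul_smul, ← Finset.smul_sum] at hg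
      exact (smul_eq_zero.1 hg).resolve_left hπ0
  rw [Fintype.linearIndependent_iff]
  intro g hg i
  by_contra hi
  obtain ⟨n, hn⟩ := hπ _ hi
  exact hn (hdvd' n g hg i)

/-- The number of zeros of `π` (in the situation of `exists_linearIndependent_of_ord`) is bounded
by the degree of the field extension. -/
theorem sum_ord_le_finrank {R E : Type} [CommRing R] [IsDomain R] [Algebra R F] [Field E]
    [Algebra R E] [IsFractionRing R E] [Algebra E F] [IsScalarTower R E F] [FiniteDimensional E F]
    {π : R} (hπ0 : π ≠ 0) (hπ : ∀ a : R, a ≠ 0 → ∃ n : ℕ, ¬ π ^ n ∣ a) (S : Finset (Place F))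
    (e : Place F → ℕ) (h1 : ∀ P ∈ S, ∀ a : R, P.val (algebraMap R F a) ≤ 1)
    (h2 : ∀ P ∈ S, ∀ a : R, ¬ π ∣ a → P.val (algebraMap R F a) = 1)
    (h3 : ∀ P ∈ S, P.val (algebraMap R F π) = WithZero.exp (-(e P : ℤ))) :
    ∑ P ∈ S, e P ≤ Module.finrank E F := by
  have : FaithfulSMul R F := by
    rw [faithfulSMul_iff_algebraMap_injective, IsScalarTower.algebraMap_eq R E F]
    exact (algebraMap E F).injective.comp (IsFractionRing.injective R E)
  obtain ⟨b, hb⟩ := exists_linearIndependent_of_ord hπ0 hπ S e h1 h2 h3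
  have h := ((LinearIndependent.iff_fractionRing R E).1 hb).fintype_card_le_finrank
  simp only [Fintype.card_sigma, Fintype.card_fin, Finset.univ_eq_attach,
    Finset.sum_attach S e] at h
  exact h

/-- The number of zeros of `f` is at most `[F : ℂ(f)]`. -/
theorem sum_ord_le_finrank_adjoin [IsCurveField F] {f : F} (hf : Transcendental ℂ f)
    (S : Finset (Place F))
    (hS : ∀ P ∈ S, P.val f < 1) :
    ∑ P ∈ S, (P.ord f).toNat ≤ Module.finrank (IntermediateField.adjoin ℂ {f}) F := by
  let _ : Algebra ℂ[X] (IntermediateField.adjoin ℂ {f}) :=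
      (aeval (IntermediateField.AdjoinSimple.gen ℂ f)).toAlgebra
  let _ : Algebra ℂ[X] F := (aeval f).toAlgebra
  have := isFractionRing_adjoin hf
  have := IsCurveField.finiteDimensional_adjoin hf
  have hf0 : f ≠ 0 := by
    rintro rfl
    exact hf isAlgebraic_zero
  have hT : IsScalarTower ℂ[X] (IntermediateField.adjoin ℂ {f}) F := by
    refine IsScalarTower.of_algebraMap_eq fun p => ?_
    change aeval f p = algebraMap (IntermediateField.adjoin ℂ {f}) F
      (aeval (IntermediateField.AdjoinSimple.gen ℂ f) p)
    rw [← aeval_algebraMap_apply]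
    simp
  have hle : ∀ P ∈ S, ∀ a : ℂ[X], P.val (aeval f a) ≤ 1 := by
    intro P hP a
    rw [aeval_eq_sum_range]
    refine Valuation.map_sum_le _ fun i _ => ?_
    rw [Algebra.smul_def, map_mul, map_pow]
    exact mul_le_one' (P.val_algebraMap_le _) (pow_le_one₀ zero_le (hS P hP).le)
  refine sum_ord_le_finrank (R := ℂ[X]) (π := X) X_ne_zero (fun a ha => ?_) S
    (fun P => (P.ord f).toNat) hle (fun P hP a ha => ?_) (fun P hP => ?_)
  · refine ⟨a.natDegree + 1, fun h => ?_⟩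
    have := natDegree_le_of_dvd h ha
    simp at this
  · change P.val (aeval f a) = 1
    rw [X_dvd_iff] at ha
    rw [← divX_mul_X_add a, map_add, map_mul, aeval_X, aeval_C, add_comm,
      Valuation.map_add_eq_of_lt_left, P.val_const ha]
    rw [P.val_const ha, map_mul]
    exact (mul_le_of_le_one_left' (hle P hP _)).trans_lt (hS P hP)
  · change P.val (aeval f X) = _
    have := (P.val_lt_one_iff hf0).1 (hS P hP)
    rw [aeval_X, P.val_eq_exp hf0]
    congr 2
    omega

/-- Every nonconstant function has a pole. -/
theorem exists_one_lt_val [IsCurveField F] {f : F} (hf : Transcendental ℂ f) :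
    ∃ P : Place F, 1 < P.val f := by
  have hf0 : f ≠ 0 := by
    rintro rfl
    exact hf isAlgebraic_zero
  -- a zero of `g = 1 / f` is found on the integral closure of `ℂ[g]`
  obtain ⟨g, hg⟩ : ∃ g, g = f⁻¹ := ⟨_, rfl⟩
  have hgt : Transcendental ℂ g := by
    intro h
    apply hf
    rw [hg] at h
    exact IsAlgebraic.inv_iff.1 h
  let _ : Algebra ℂ[X] (IntermediateField.adjoin ℂ {g}) :=
      (aeval (IntermediateField.AdjoinSimple.gen ℂ g)).toAlgebra
  let _ : Algebra ℂ[X] F := (aeval g).toAlgebra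
  have := isFractionRing_adjoin hgt
  have := IsCurveField.finiteDimensional_adjoin hgt
  have hT : IsScalarTower ℂ[X] (IntermediateField.adjoin ℂ {g}) F := by
    refine IsScalarTower.of_algebraMap_eq fun p => ?_
    change aeval g p = algebraMap (IntermediateField.adjoin ℂ {g}) F
      (aeval (IntermediateField.AdjoinSimple.gen ℂ g) p)
    rw [← aeval_algebraMap_apply]
    simp
  let B := integralClosure ℂ[X] F
  have hD : IsDedekindDomain B :=
    integralClosure.isDedekindDomain ℂ[X] (IntermediateField.adjoin ℂ {g}) F
  have hFr : IsFractionRing B F :=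
    integralClosure.isFractionRing_of_finite_extension (IntermediateField.adjoin ℂ {g}) F
  have hinj : Function.Injective (algebraMap ℂ[X] B) := by
    refine Function.Injective.of_comp (f := algebraMap B F) ?_
    exact transcendental_iff_injective.1 hgt
  have hmax : (Ideal.span {(X : ℂ[X])}).IsMaximal :=
    PrincipalIdealRing.isMaximal_of_irreducible irreducible_X
  obtain ⟨M, hM, hMX⟩ :=
    Ideal.exists_ideal_over_maximal_of_isIntegral (S := B) (Ideal.span {(X : ℂ[X])})
    (by rw [(RingHom.injective_iff_ker_eq_bot _).1 hinj]; exact bot_le)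
  have hXM : algebraMap ℂ[X] B X ∈ M := by
    rw [← Ideal.mem_comap, hMX]
    exact Ideal.mem_span_singleton_self _
  have hX0 : algebraMap ℂ[X] B X ≠ 0 := by
    rw [Ne, map_eq_zero_iff _ hinj]
    exact X_ne_zero
  let v : IsDedekindDomain.HeightOneSpectrum B := ⟨M, hM.isPrime, fun h => by
    rw [h] at hXM
    exact hX0 hXM⟩
  have hvg : v.valuation F g < 1 := by
    have h := (v.valuation_lt_one_iff_mem (K := F) (algebraMap ℂ[X] B X)).2 hXM
    change v.valuation F (aeval g X) < 1 at h
    rwa [aeval_X] at h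
  have hg0 : g ≠ 0 := by rw [hg]; exact inv_ne_zero hf0
  refine ⟨ofValuation (v.valuation F) ⟨g, hg0, hvg.ne⟩ (fun c => ?_), ?_⟩
  · have h := v.valuation_le_one (K := F) (algebraMap ℂ[X] B (Polynomial.C c))
    change v.valuation F (aeval g (Polynomial.C c)) ≤ 1 at h
    rwa [aeval_C] at h
  · rw [← not_le, ofValuation_mem, not_le]
    rw [hg, map_inv₀] at hvg
    have h0 : 0 < v.valuation F f := by simpa [zero_lt_iff] using hf0
    exact (inv_lt_one₀ h0).1 hvg

/-- The residue field of a place of a function field of one variable is `ℂ`. -/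
theorem exists_val_sub_const_lt_one [IsCurveField F] (P : Place F) {f : F} (hf : P.val f ≤ 1) :
    ∃ c : ℂ, P.val (f - algebraMap ℂ F c) < 1 := by
  by_contra! hcon
  have hval : ∀ c : ℂ, P.val (f - algebraMap ℂ F c) = 1 := by
    intro c
    refine le_antisymm ?_ (hcon c)
    exact (Valuation.map_sub _ _ _).trans (max_le hf (P.val_algebraMap_le c))
  have hpoly : ∀ p : ℂ[X], p ≠ 0 → P.val (aeval f p) = 1 := by
    intro p hp
    rw [(IsAlgClosed.splits p).eq_prod_roots, map_mul, aeval_C, map_mul,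
      P.val_const (leadingCoeff_ne_zero.2 hp), one_mul, map_multiset_prod, map_multiset_prod]
    refine Multiset.prod_eq_one fun x hx => ?_
    simp only [Multiset.map_map, Multiset.mem_map] at hx
    obtain ⟨c, -, rfl⟩ := hx
    simpa using hval c
  have hft : Transcendental ℂ f := by
    rw [transcendental_iff]
    intro p hp
    by_contra h
    have := hpoly p h
    simp [hp] at this
  have hE : ∀ z : IntermediateField.adjoin ℂ {f}, P.val (z : F) ≤ 1 := by
    intro z
    obtain ⟨r, s, h⟩ := (IntermediateField.mem_adjoin_simple_iff ℂ _).1 z.2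
    rw [h, map_div₀]
    rcases eq_or_ne s 0 with rfl | hs
    · simp
    rcases eq_or_ne r 0 with rfl | hr
    · simp
    rw [hpoly r hr, hpoly s hs, div_one]
  have := IsCurveField.finiteDimensional_adjoin hft
  obtain ⟨t, ht⟩ := P.exists_val_eq_exp_neg_one
  have h := P.val_le_one_of_isIntegral (R := IntermediateField.adjoin ℂ {f}) hE
    (Algebra.IsIntegral.isIntegral t⁻¹)
  rw [map_inv₀, ht, ← WithZero.exp_neg, ← WithZero.exp_zero, WithZero.exp_le_exp] at h
  omega

end Place

/-! ### Divisors and Riemann's theorem -/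

namespace Place

variable {F : Type} [Field F] [Algebra ℂ F]

/-- The degree of a divisor; all points have degree one. -/
def deg {ι : Type} : (ι →₀ ℤ) →+ ℤ := Finsupp.liftAddHom fun _ => AddMonoidHom.id ℤ

theorem deg_apply {ι : Type} (D : ι →₀ ℤ) : deg D = D.sum fun _ n => n := rfl

@[simp] theorem deg_single {ι : Type} (i : ι) (n : ℤ) : deg (Finsupp.single i n) = n := by
  simp [deg_apply]

theorem deg_nonneg {ι : Type} {D : ι →₀ ℤ} (hD : 0 ≤ D) : 0 ≤ deg D :=
  Finset.sum_nonneg fun i _ => hD i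

theorem deg_mono {ι : Type} {D D' : ι →₀ ℤ} (h : D ≤ D') : deg D ≤ deg D' := by
  have := deg_nonneg (sub_nonneg.2 h)
  rw [map_sub] at this
  omega

/-- An effective divisor is built up by adding one point at a time. -/
theorem effective_induction {ι : Type} {p : (ι →₀ ℤ) → Prop} (D₀ : ι →₀ ℤ) (h0 : p D₀)
    (hs : ∀ D, D₀ ≤ D → ∀ i, p D → p (D + Finsupp.single i 1)) (D : ι →₀ ℤ)
    (hD : D₀ ≤ D) : p D := by
  classical
  obtain ⟨n, hn⟩ : ∃ n : ℕ, deg (D - D₀) = n :=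
    ⟨_, (Int.toNat_of_nonneg (deg_nonneg (sub_nonneg.2 hD))).symm⟩
  induction n generalizing D with
  | zero =>
    have h1 : D = D₀ := by
      ext i
      by_contra hne
      have h2 : Finsupp.single i 1 ≤ D - D₀ := by
        intro j
        have h3 := hD j
        rcases eq_or_ne i j with rfl | hij
        · simp only [Finsupp.single_eq_same, Finsupp.sub_apply]
          omega
        · simp [hij, h3]
      have := deg_mono h2
      rw [deg_single, hn] at this
      norm_num at this
    rwa [h1]
  | succ n ih =>
    obtain ⟨i, hi⟩ : ∃ i, D₀ i < D i := by
      by_contra! hcon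
      have h1 := deg_mono (sub_nonpos.2 (show D ≤ D₀ from hcon))
      rw [hn, map_zero] at h1
      omega
    have h1 : D₀ ≤ D - Finsupp.single i 1 := by
      intro j
      have h3 := hD j
      rcases eq_or_ne i j with rfl | hij
      · simp only [Finsupp.single_eq_same, Finsupp.sub_apply]
        omega
      · simp [hij, h3]
    have h2 := hs _ h1 i (ih _ h1 (by
      rw [sub_right_comm, map_sub, deg_single, hn]
      push_cast
      ring))
    simpa using h2

/-- The space `L(D)` for a divisor on the curve whose points are all places of `F`. -/
abbrev LSpace (D : Place F →₀ ℤ) : Submodule ℂ F := rrSpace (fun P : Place F => P) D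

theorem mem_LSpace {D : Place F →₀ ℤ} {f : F} :
    f ∈ LSpace D ↔ ∀ P : Place F, P.val f ≤ WithZero.exp (D P) := Iff.rfl

theorem LSpace_mono {D D' : Place F →₀ ℤ} (h : D ≤ D') : LSpace D ≤ LSpace D' :=
  fun _ hf P => (hf P).trans (WithZero.exp_le_exp.2 (h P))

/-- The number `deg D + 1 - dim L(D)`; the genus is the supremum of these numbers. -/
def defect (D : Place F →₀ ℤ) : ℤ := deg D + 1 - Module.finrank ℂ (LSpace D)

variable [IsCurveField F]

/-- Functions without poles are constant. -/
theorem LSpace_zero : LSpace (0 : Place F →₀ ℤ) = Submodule.span ℂ {1} := by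
  ext f
  rw [Submodule.mem_span_singleton, mem_LSpace]
  constructor
  · intro h
    by_contra hcon
    obtain ⟨P, hP⟩ := exists_one_lt_val (IsCurveField.transcendental_of_notMem_range (f := f) (by
      rintro ⟨c, rfl⟩
      exact hcon ⟨c, by rw [Algebra.smul_def, mul_one]⟩))
    have := h P
    simp only [Finsupp.coe_zero, Pi.zero_apply, WithZero.exp_zero] at this
    exact this.not_gt hP
  · rintro ⟨c, rfl⟩ P
    simpa [Algebra.smul_def] using P.val_algebraMap_le c

/-- Adding a point to a divisor raises the dimension of `L(D)` by at most one, as the residue field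
of the point is `ℂ`. -/
theorem exists_LSpace_add_single_le (D : Place F →₀ ℤ) (P : Place F) :
    ∃ g : F, LSpace (D + Finsupp.single P 1) ≤ LSpace D ⊔ Submodule.span ℂ {g} := by
  classical
  by_cases h : LSpace (D + Finsupp.single P 1) ≤ LSpace D
  · exact ⟨0, h.trans le_sup_left⟩
  have hother : ∀ f ∈ LSpace (D + Finsupp.single P 1), P.val f ≤ WithZero.exp (D P) →
    f ∈ LSpace D := by
    intro f hf hP Q
    rcases eq_or_ne P Q with rfl | hPQ
    · exact hP
    · simpa [Finsupp.single_apply, hPQ] using hf Q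
  have hPD : ∀ f ∈ LSpace (D + Finsupp.single P 1), P.val f ≤ WithZero.exp (D P + 1) := by
    intro f hf
    simpa [- WithZero.exp_add] using hf P
  obtain ⟨g, hg, hgD⟩ := SetLike.not_le_iff_exists.1 h
  have hgv : P.val g = WithZero.exp (D P + 1) := by
    have h1 := hPD g hg
    have h2 : ¬ P.val g ≤ WithZero.exp (D P) := fun h => hgD (hother g hg h)
    have hg0 : g ≠ 0 := by rintro rfl; simp at hgD
    rw [P.val_eq_exp hg0, WithZero.exp_le_exp] at h1 h2
    rw [P.val_eq_exp hg0, WithZero.exp_inj]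
    omega
  have hg0 : g ≠ 0 := ne_zero_of_val_eq_exp hgv
  refine ⟨g, fun f hf => ?_⟩
  obtain ⟨c, hc⟩ := P.exists_val_sub_const_lt_one (f := f / g) (by
    rw [map_div₀, hgv]
    exact div_le_one_of_le₀ (hPD f hf) zero_le)
  rw [Submodule.mem_sup]
  refine ⟨f - c • g, ?_, c • g, Submodule.mem_span_singleton.2 ⟨c, rfl⟩, by ring⟩
  refine hother _ (Submodule.sub_mem _ hf (Submodule.smul_mem _ c hg)) ?_
  have h1 : f - c • g = (f / g - algebraMap ℂ F c) * g := by
    rw [Algebra.smul_def]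
    field_simp
  rw [val_lt_one_iff_le_exp] at hc
  rw [h1, map_mul, hgv]
  calc _ ≤ WithZero.exp (-1) * WithZero.exp (D P + 1) := mul_le_mul' hc le_rfl
    _ = _ := by rw [← WithZero.exp_add]; congr 1; ring

instance finiteDimensional_LSpace (D : Place F →₀ ℤ) : FiniteDimensional ℂ (LSpace D) := by
  have h : ∀ D : Place F →₀ ℤ, 0 ≤ D → FiniteDimensional ℂ (LSpace D) := by
    refine effective_induction 0 ?_ fun D _ P hD => ?_
    · rw [LSpace_zero]
      infer_instance
    · obtain ⟨g, hg⟩ := exists_LSpace_add_single_le D P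
      exact Submodule.finiteDimensional_of_le hg
  have := h (D ⊔ 0) le_sup_right
  exact Submodule.finiteDimensional_of_le (LSpace_mono (le_sup_left : D ≤ D ⊔ 0))

theorem finrank_LSpace_zero : Module.finrank ℂ (LSpace (0 : Place F →₀ ℤ)) = 1 := by
  rw [LSpace_zero, finrank_span_singleton one_ne_zero]

theorem defect_zero : defect (0 : Place F →₀ ℤ) = 0 := by
  rw [defect, finrank_LSpace_zero, map_zero]
  simp

/-- Adding a point raises the degree by one and the dimension by at most one. -/
theorem defect_mono {D D' : Place F →₀ ℤ} (h : D ≤ D') : defect D ≤ defect D' := by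
  refine effective_induction (p := fun D' => defect D ≤ defect D') D le_rfl
    (fun D' _ P hD => hD.trans ?_) D' h
  obtain ⟨g, hg⟩ := exists_LSpace_add_single_le D' P
  have h1 : Module.finrank ℂ (LSpace (D' + Finsupp.single P 1)) ≤
    Module.finrank ℂ (LSpace D') + 1 := by
    refine (Submodule.finrank_mono hg).trans
      ((Submodule.finrank_add_le_finrank_add_finrank _ _).trans ?_)
    have := finrank_span_le_card (R := ℂ) ({g} : Set F)
    simp only [Set.toFinset_singleton, Finset.card_singleton] at this
    omega
  rw [defect, defect, map_add, deg_single]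
  omega

theorem defect_nonneg {D : Place F →₀ ℤ} (h : 0 ≤ D) : 0 ≤ defect D := by
  rw [← defect_zero (F := F)]
  exact defect_mono h

omit [IsCurveField F] in
theorem adjoin_inv (f : F) : IntermediateField.adjoin ℂ {f⁻¹} = IntermediateField.adjoin ℂ {f} := by
  apply le_antisymm <;> rw [IntermediateField.adjoin_simple_le_iff]
  · exact inv_mem (IntermediateField.mem_adjoin_simple_self ℂ f)
  · have := inv_mem (IntermediateField.mem_adjoin_simple_self ℂ f⁻¹)
    rwa [inv_inv] at this

omit [IsCurveField F] in
theorem transcendental_inv {f : F} (hf : Transcendental ℂ f) : Transcendental ℂ f⁻¹ :=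
  fun h => hf (IsAlgebraic.inv_iff.1 h)

omit [IsCurveField F] in
theorem ne_zero_of_transcendental {f : F} (hf : Transcendental ℂ f) : f ≠ 0 := by
  rintro rfl
  exact hf isAlgebraic_zero

theorem finite_setOf_val_lt_one {f : F} (hf : Transcendental ℂ f) :
    {P : Place F | P.val f < 1}.Finite := by
  by_contra hinf
  obtain ⟨S, hS, hcard⟩ := Set.Infinite.exists_subset_card_eq hinf
    (Module.finrank (IntermediateField.adjoin ℂ {f}) F + 1)
  have h := sum_ord_le_finrank_adjoin hf S fun P hP => hS hP
  have h1 : S.card ≤ ∑ P ∈ S, (P.ord f).toNat := by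
    rw [Finset.card_eq_sum_ones]
    refine Finset.sum_le_sum fun P hP => ?_
    have := (P.val_lt_one_iff (ne_zero_of_transcendental hf)).1 (hS hP)
    omega
  omega

theorem finite_support_ord (f : F) : (Function.support fun P : Place F => P.ord f).Finite := by
  by_cases hf : f ∈ (algebraMap ℂ F).range
  · obtain ⟨c, rfl⟩ := hf
    convert! Set.finite_empty
    ext P
    rcases eq_or_ne c 0 with rfl | hc
    · simp [ord]
    · simp [ord, P.val_const hc]
  · have hf := IsCurveField.transcendental_of_notMem_range hf
    have hf0 := ne_zero_of_transcendental hf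
    refine ((finite_setOf_val_lt_one hf).union
      (finite_setOf_val_lt_one (transcendental_inv hf))).subset ?_
    intro P hP
    simp only [Set.mem_union, Set.mem_ofPred_eq, P.val_lt_one_iff hf0,
      P.val_lt_one_iff (inv_ne_zero hf0), ord_inv]
    have : P.ord f ≠ 0 := hP
    omega

/-- The divisor of a function (of `f ≠ 0`; the divisor of `0` is `0`). -/
def divisor (f : F) : Place F →₀ ℤ :=
  Finsupp.ofSupportFinite (fun P => P.ord f) (finite_support_ord f)

@[simp] theorem divisor_apply (f : F) (P : Place F) : divisor f P = P.ord f := rfl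

/-- The divisor of poles of a function. -/
def poleDivisor (f : F) : Place F →₀ ℤ := (-divisor f) ⊔ 0

theorem poleDivisor_apply (f : F) (P : Place F) : poleDivisor f P = max (-P.ord f) 0 := rfl

theorem poleDivisor_nonneg (f : F) : 0 ≤ poleDivisor f := le_sup_right

theorem divisor_eq_sub (f : F) : divisor f = poleDivisor f⁻¹ - poleDivisor f := by
  ext P
  rw [Finsupp.sub_apply, poleDivisor_apply, poleDivisor_apply, ord_inv, divisor_apply]
  omega

theorem mem_LSpace_iff {D : Place F →₀ ℤ} {f : F} (hf : f ≠ 0) :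
    f ∈ LSpace D ↔ 0 ≤ divisor f + D := by
  rw [mem_LSpace]
  refine forall_congr' fun P => ?_
  rw [P.val_le_exp_iff hf]
  simp only [Finsupp.coe_zero, Pi.zero_apply, Finsupp.add_apply, divisor_apply]
  omega

theorem deg_poleDivisor_le {f : F} (hf : Transcendental ℂ f) :
    deg (poleDivisor f) ≤ Module.finrank (IntermediateField.adjoin ℂ {f}) F := by
  have hf0 := ne_zero_of_transcendental hf
  have hpos : ∀ P ∈ (poleDivisor f).support, 0 < -P.ord f := by
    intro P hP
    rw [Finsupp.mem_support_iff, poleDivisor_apply] at hP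
    omega
  have h := sum_ord_le_finrank_adjoin (transcendental_inv hf) (poleDivisor f).support
    (fun P hP => by
    rw [P.val_lt_one_iff (inv_ne_zero hf0), ord_inv]
    exact hpos P hP)
  rw [adjoin_inv] at h
  have h1 : deg (poleDivisor f) = ((∑ P ∈ (poleDivisor f).support, (P.ord f⁻¹).toNat : ℕ) : ℤ) := by
    rw [deg_apply, Finsupp.sum, Nat.cast_sum]
    refine Finset.sum_congr rfl fun P hP => ?_
    have := hpos P hP
    rw [poleDivisor_apply, ord_inv]
    omega
  rw [h1]
  exact_mod_cast h

/-- A basis `b` of `F` over `ℂ(g)` without poles outside those of `g`; the products `g ^ j * b i`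
are linearly independent over `ℂ`. -/
theorem exists_integral_basis {g : F} (hg : Transcendental ℂ g) :
    ∃ b : Fin (Module.finrank (IntermediateField.adjoin ℂ {g}) F) → F,
      (∀ i (P : Place F), P.val g ≤ 1 → P.val (b i) ≤ 1) ∧
      ∀ k : ℕ, LinearIndependent ℂ
        (fun p : Fin k × Fin (Module.finrank (IntermediateField.adjoin ℂ {g}) F) =>
        g ^ (p.1 : ℕ) * b p.2) := by
  let _ : Algebra ℂ[X] (IntermediateField.adjoin ℂ {g}) :=
      (aeval (IntermediateField.AdjoinSimple.gen ℂ g)).toAlgebra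
  let _ : Algebra ℂ[X] F := (aeval g).toAlgebra
  have := isFractionRing_adjoin hg
  have := IsCurveField.finiteDimensional_adjoin hg
  have hT : IsScalarTower ℂ[X] (IntermediateField.adjoin ℂ {g}) F := by
    refine IsScalarTower.of_algebraMap_eq fun p => ?_
    change aeval g p = algebraMap (IntermediateField.adjoin ℂ {g}) F
      (aeval (IntermediateField.AdjoinSimple.gen ℂ g) p)
    rw [← aeval_algebraMap_apply]
    simp
  have hT' : IsScalarTower ℂ ℂ[X] F := by
    refine IsScalarTower.of_algebraMap_eq fun c => ?_
    change _ = aeval g (Polynomial.C c)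
    rw [aeval_C]
  obtain ⟨s, b, hb⟩ := FiniteDimensional.exists_is_basis_integral ℂ[X]
    (IntermediateField.adjoin ℂ {g}) F
  let e : s ≃ Fin (Module.finrank (IntermediateField.adjoin ℂ {g}) F) :=
    Fintype.equivFinOfCardEq (Module.finrank_eq_card_basis b).symm
  refine ⟨fun i => b (e.symm i), fun i P hP => ?_, fun k => ?_⟩
  · refine P.val_le_one_of_isIntegral (R := ℂ[X]) (fun a => ?_) (hb _)
    change P.val (aeval g a) ≤ 1
    rw [aeval_eq_sum_range]
    refine Valuation.map_sum_le _ fun i _ => ?_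
    rw [Algebra.smul_def, map_mul, map_pow]
    exact mul_le_one' (P.val_algebraMap_le _) (pow_le_one₀ zero_le hP)
  · have h1 : LinearIndependent ℂ[X] (b ∘ e.symm) :=
      (LinearIndependent.iff_fractionRing ℂ[X] (IntermediateField.adjoin ℂ {g})).2
        (b.linearIndependent.comp _ e.symm.injective)
    have h2 : LinearIndependent ℂ (fun j : Fin k => (Polynomial.basisMonomials ℂ j : ℂ[X])) :=
      (Polynomial.basisMonomials ℂ).linearIndependent.comp _ Fin.val_injective
    convert! linearIndependent_smul h2 h1 using 2 with p
    rw [Algebra.smul_def]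
    congr 1
    change _ = aeval g _
    simp

/-- The divisor of poles of a nonconstant function `g` has degree `[F : ℂ(g)]`, and the numbers
`deg D + 1 - dim L(D)` are bounded on its multiples. This is seen by counting the functions
`g ^ j * b i` for a basis `b` of `F` over `ℂ(g)` that is integral over `ℂ[g]`. -/
theorem deg_poleDivisor_and_exists_defect_le {g : F} (hg : Transcendental ℂ g) :
    deg (poleDivisor g) = Module.finrank (IntermediateField.adjoin ℂ {g}) F ∧
    ∃ c : ℤ, ∀ k : ℕ, defect (k • poleDivisor g) ≤ c := by
  classical
  have hb := exists_integral_basis hg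
  have hg0 := ne_zero_of_transcendental hg
  have hle := deg_poleDivisor_le hg
  generalize Module.finrank (IntermediateField.adjoin ℂ {g}) F = n at hb hle ⊢
  obtain ⟨b, hb, hind⟩ := hb
  set A := poleDivisor g with hA
  have hA0 : 0 ≤ A := poleDivisor_nonneg g
  obtain ⟨c, hc⟩ : ∃ c : ℕ, ∀ i, b i ∈ LSpace (c • A) := by
    refine ⟨∑ i, ∑ P ∈ A.support, (P.ord (b i)).natAbs, fun i => ?_⟩
    rcases eq_or_ne (b i) 0 with h0 | h0
    · rw [h0]
      exact Submodule.zero_mem _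
    rw [mem_LSpace_iff h0]
    intro P
    simp only [Finsupp.coe_zero, Pi.zero_apply, Finsupp.add_apply, divisor_apply,
      Finsupp.smul_apply]
    by_cases hP : P ∈ A.support
    · have h1 : (P.ord (b i)).natAbs ≤ ∑ i, ∑ P ∈ A.support, (P.ord (b i)).natAbs :=
        (Finset.single_le_sum (f := fun P : Place F => (P.ord (b i)).natAbs)
          (fun _ _ => Nat.zero_le _) hP).trans
          (Finset.single_le_sum (f := fun i => ∑ P ∈ A.support, (P.ord (b i)).natAbs)
            (fun _ _ => Nat.zero_le _) (Finset.mem_univ i))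
      have h2 : 1 ≤ A P := by
        have := hA0 P
        rw [Finsupp.mem_support_iff] at hP
        simp only [Finsupp.coe_zero, Pi.zero_apply] at this
        omega
      rw [nsmul_eq_mul]
      have h3 : ((∑ i, ∑ P ∈ A.support, (P.ord (b i)).natAbs : ℕ) : ℤ) ≤
        ((∑ i, ∑ P ∈ A.support, (P.ord (b i)).natAbs : ℕ) : ℤ) * A P :=
        le_mul_of_one_le_right (Nat.cast_nonneg _) h2
      omega
    · rw [Finsupp.notMem_support_iff] at hP
      rw [hP, smul_zero, add_zero, ← P.val_le_one_iff h0]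
      apply hb
      rw [P.val_le_one_iff hg0]
      rw [hA, poleDivisor_apply] at hP
      omega
  have hgA : g ∈ LSpace A := by
    rw [mem_LSpace_iff hg0]
    intro P
    rw [Finsupp.add_apply, hA, poleDivisor_apply, divisor_apply]
    simp only [Finsupp.coe_zero, Pi.zero_apply]
    omega
  -- `c` bounds the poles of the `b i`, so `L((k + c) A)` contains the products with `j < k`
  have hcount : ∀ k : ℕ, (k * n : ℤ) ≤ Module.finrank ℂ (LSpace ((k + c) • A)) := by
    intro k
    have hmem : ∀ p : Fin k × Fin n, g ^ (p.1 : ℕ) * b p.2 ∈ LSpace ((k + c) • A) := by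
      intro p P
      have h1 : P.val (g ^ (p.1 : ℕ)) ≤ WithZero.exp (k * A P) := by
        rw [map_pow]
        refine (pow_le_pow_left₀ zero_le (hgA P) _).trans ?_
        rw [← WithZero.exp_nsmul, WithZero.exp_le_exp, nsmul_eq_mul]
        have := p.1.2
        exact mul_le_mul_of_nonneg_right (by exact_mod_cast this.le) (hA0 P)
      rw [map_mul]
      refine (mul_le_mul' h1 (hc p.2 P)).trans ?_
      rw [← WithZero.exp_add, WithZero.exp_le_exp]
      simp only [Finsupp.smul_apply, nsmul_eq_mul]
      push_cast
      linarith
    have h2 : LinearIndependent ℂ (fun p : Fin k × Fin n => (⟨_, hmem p⟩ : LSpace ((k + c) • A))) :=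
      LinearIndependent.of_comp (LSpace ((k + c) • A)).subtype (hind k)
    have := h2.fintype_card_le_finrank
    simp only [Fintype.card_prod, Fintype.card_fin] at this
    exact_mod_cast this
  have hdefect : ∀ k : ℕ, defect ((k + c) • A) ≤ (k + c) * deg A + 1 - k * n := by
    intro k
    have := hcount k
    rw [defect, map_nsmul, nsmul_eq_mul]
    push_cast
    linarith
  -- if `deg A < n`, the defect would become negative for large `k`
  have hdeg : deg A = n := by
    by_contra hne
    have h1 : deg A ≤ n - 1 := by omega
    have h2 : 0 ≤ deg A := deg_nonneg hA0
    have h3 := hdefect (c * (deg A).toNat + 2)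
    have h4 := defect_nonneg (nsmul_nonneg hA0 (c * (deg A).toNat + 2 + c))
    push_cast [Int.toNat_of_nonneg h2] at h3
    nlinarith [mul_nonneg (Nat.cast_nonneg (α := ℤ) c) h2]
  refine ⟨hdeg, c * n + 1, fun k => ?_⟩
  refine (defect_mono (nsmul_le_nsmul_left hA0 (Nat.le_add_right k c))).trans ((hdefect k).trans ?_)
  rw [hdeg]
  linarith

/-- A nonzero function has as many zeros as poles. -/
theorem deg_divisor {f : F} (hf0 : f ≠ 0) : deg (divisor f) = 0 := by
  by_cases hf : f ∈ (algebraMap ℂ F).range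
  · obtain ⟨c, rfl⟩ := hf
    have hc : c ≠ 0 := by rintro rfl; simp at hf0
    have : divisor (algebraMap ℂ F c) = 0 := by
      ext P
      simp [ord, P.val_const hc]
    rw [this, map_zero]
  · have hf := IsCurveField.transcendental_of_notMem_range hf
    rw [divisor_eq_sub, map_sub, (deg_poleDivisor_and_exists_defect_le hf).1,
      (deg_poleDivisor_and_exists_defect_le (transcendental_inv hf)).1, adjoin_inv, sub_self]

/-- Multiplication by `h` identifies `L(D)` with `L(D - (h))`. -/
theorem finrank_LSpace_sub_divisor (D : Place F →₀ ℤ) {h : F} (hh : h ≠ 0) :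
    Module.finrank ℂ (LSpace (D - divisor h)) = Module.finrank ℂ (LSpace D) := by
  have key : ∀ (D : Place F →₀ ℤ) {h : F}, h ≠ 0 →
      Module.finrank ℂ (LSpace D) ≤ Module.finrank ℂ (LSpace (D - divisor h)) := by
    intro D h hh
    refine LinearMap.finrank_le_finrank_of_injective
      (f := (((LinearMap.mulLeft ℂ h).domRestrict (LSpace D)).codRestrict (LSpace (D - divisor h))
        ?_)) ?_
    · rintro ⟨f, hf⟩ P
      rw [LinearMap.domRestrict_apply, LinearMap.mulLeft_apply, map_mul, P.val_eq_exp hh,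
        Finsupp.sub_apply,
        divisor_apply, neg_add_eq_sub _ _ |>.symm, WithZero.exp_add]
      exact mul_le_mul' le_rfl (hf P)
    · rintro ⟨f, hf⟩ ⟨f', hf'⟩ hff
      have := congrArg Subtype.val hff
      simpa [hh] using this
  refine le_antisymm ?_ (key D hh)
  have h1 := key (D - divisor h) (inv_ne_zero hh)
  have h2 : divisor h⁻¹ = -divisor h := by
    ext P
    simp [ord_inv]
  rwa [h2, sub_neg_eq_add, sub_add_cancel] at h1

theorem defect_sub_divisor (D : Place F →₀ ℤ) {h : F} (hh : h ≠ 0) :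
    defect (D - divisor h) = defect D := by
  rw [defect, defect, finrank_LSpace_sub_divisor D hh, map_sub, deg_divisor hh, sub_zero]

/-- Riemann's theorem: the numbers `deg D + 1 - dim L(D)` are bounded. -/
theorem exists_forall_defect_le (F : Type) [Field F] [Algebra ℂ F] [IsCurveField F] :
    ∃ c : ℤ, ∀ D : Place F →₀ ℤ, defect D ≤ c := by
  obtain ⟨g, hg⟩ := IsCurveField.exists_transcendental F
  obtain ⟨hdeg, c, hc⟩ := deg_poleDivisor_and_exists_defect_le hg
  refine ⟨c, fun D => ?_⟩
  refine (defect_mono (le_sup_left : D ≤ D ⊔ 0)).trans ?_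
  have hE : 0 ≤ D ⊔ 0 := le_sup_right
  generalize D ⊔ 0 = E at hE ⊢
  have := IsCurveField.finiteDimensional_adjoin hg
  have hpos : 0 < deg (poleDivisor g) := by
    rw [hdeg]
    exact_mod_cast Module.finrank_pos
  -- a multiple of the pole divisor for which `L(k A - E)` is nonzero
  obtain ⟨k, hk⟩ : ∃ k : ℕ, 0 < Module.finrank ℂ (LSpace (k • poleDivisor g - E)) := by
    refine ⟨(c + deg E).toNat, ?_⟩
    have h1 := (defect_mono (sub_le_self ((c + deg E).toNat • poleDivisor g) hE)).trans
      (hc (c + deg E).toNat)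
    rw [defect, map_sub, map_nsmul, nsmul_eq_mul] at h1
    have h2 : ((c + deg E).toNat : ℤ) ≤ (c + deg E).toNat * deg (poleDivisor g) :=
      le_mul_of_one_le_right (Nat.cast_nonneg _) hpos
    omega
  obtain ⟨⟨h, hmem⟩, hne⟩ := Module.finrank_pos_iff_exists_ne_zero.1 hk
  have hh : h ≠ 0 := fun h0 => hne (Subtype.ext h0)
  rw [mem_LSpace_iff hh] at hmem
  -- `E` is linearly equivalent to `E - (h) ≤ k A`
  rw [← defect_sub_divisor E hh]
  refine (defect_mono ?_).trans (hc k)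
  intro P
  have := hmem P
  simp only [Finsupp.coe_zero, Pi.zero_apply, Finsupp.add_apply, Finsupp.sub_apply] at this ⊢
  omega

/-- `deg D + 1 - dim L(D)` is equal to the genus when `D` is large. -/
theorem exists_genus_eq (F : Type) [Field F] [Algebra ℂ F] [IsCurveField F] :
    ∃ g : ℕ, genus (fun P : Place F => P) = g ∧ ∃ D₀ : Place F →₀ ℤ,
      ∀ D, D₀ ≤ D → defect D = g := by
  obtain ⟨c, hc⟩ := exists_forall_defect_le F
  obtain ⟨g, ⟨D₀, hD₀⟩, hmax⟩ :=
    Int.exists_greatest_of_bdd (P := fun z => ∃ D : Place F →₀ ℤ, defect D = z)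
    ⟨c, fun z ⟨D, hD⟩ => hD ▸ hc D⟩ ⟨_, 0, rfl⟩
  have hg : 0 ≤ g := hmax 0 ⟨0, defect_zero⟩
  refine ⟨g.toNat, ?_, D₀, fun D hD => ?_⟩
  · refine le_antisymm (iSup_le fun D => ?_) ?_
    · have := hmax _ ⟨D, rfl⟩
      exact_mod_cast Int.toNat_le_toNat this
    · refine le_trans ?_ (le_iSup _ D₀)
      change _ ≤ ((defect D₀).toNat : ℕ∞)
      rw [hD₀]
  · rw [Int.toNat_of_nonneg hg]
    exact le_antisymm (hmax _ ⟨D, rfl⟩) (hD₀ ▸ defect_mono hD)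

/-- The genus computed with the points of a curve indexed in any way. -/
theorem genus_eq_of_bijective {F : Type} [Field F] [Algebra ℂ F] {ι : Type} (P : ι → Place F)
    (hP : Function.Bijective P) : genus P = genus (fun P : Place F => P) := by
  let e : ι ≃ Place F := Equiv.ofBijective P hP
  refine (Finsupp.domCongr (M := ℤ) e).toEquiv.iSup_congr fun D => ?_
  have h1 : rrSpace (fun P : Place F => P) (Finsupp.domCongr e D) = rrSpace P D := by
    ext f
    refine (e.forall_congr fun i => ?_).symm
    change _ ↔ (P i).val f ≤ WithZero.exp ((Finsupp.domCongr e D) (e i))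
    simp
  have h2 : ((Finsupp.domCongr e D).sum fun _ n => n) = D.sum fun _ n => n := by
    simp [Finsupp.domCongr, Finsupp.sum_equivMapDomain]
  change ((((Finsupp.domCongr e D).sum fun _ n => n) + 1 -
    (Module.finrank ℂ (rrSpace (fun P : Place F => P) (Finsupp.domCongr e D)) : ℤ)).toNat : ℕ∞) = _
  rw [h1, h2]

end Place

namespace Place

variable {K L : Type} [Field K] [Algebra ℂ K] [Field L] [Algebra ℂ L] [Algebra K L]
    [IsScalarTower ℂ K L]

/-! ### Places in finite extensions -/

section Restrict

variable (K) [FiniteDimensional K L]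

omit [Algebra ℂ K] [IsScalarTower ℂ K L] in
/-- A place of `L` is nontrivial on `K`, as `L` is algebraic over `K`. -/
theorem exists_val_algebraMap_ne_one (Q : Place L) :
    ∃ a : K, a ≠ 0 ∧ Q.val (algebraMap K L a) ≠ 1 := by
  by_contra! hcon
  obtain ⟨t, ht⟩ := Q.exists_val_eq_exp_neg_one
  have h := Q.val_le_one_of_isIntegral (R := K) (fun a => by
    rcases eq_or_ne a 0 with rfl | ha
    · simp
    · exact (hcon a ha).le) (Algebra.IsIntegral.isIntegral t⁻¹)
  rw [map_inv₀, ht, ← WithZero.exp_neg, ← WithZero.exp_zero, WithZero.exp_le_exp] at h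
  omega

/-- The place of `K` below a place of a finite extension `L`. -/
def below (Q : Place L) : Place K :=
  ofValuation (Q.val.comap (algebraMap K L)) (exists_val_algebraMap_ne_one K Q) fun c => by
    rw [Valuation.comap_apply, ← IsScalarTower.algebraMap_apply]
    exact Q.val_algebraMap_le c

variable {K}

theorem below_val_le_one_iff (Q : Place L) (a : K) :
    (Q.below K).val a ≤ 1 ↔ Q.val (algebraMap K L a) ≤ 1 :=
  ofValuation_mem _ _ a

/-- A local parameter at a place. -/
def unif {F : Type} [Field F] [Algebra ℂ F] (P : Place F) : F := P.exists_val_eq_exp_neg_one.choose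

theorem val_unif {F : Type} [Field F] [Algebra ℂ F] (P : Place F) :
    P.val P.unif = WithZero.exp (-1) :=
  P.exists_val_eq_exp_neg_one.choose_spec

theorem unif_ne_zero {F : Type} [Field F] [Algebra ℂ F] (P : Place F) : P.unif ≠ 0 :=
  ne_zero_of_val_eq_exp P.val_unif

theorem ord_zpow {F : Type} [Field F] [Algebra ℂ F] (P : Place F) (f : F) (n : ℤ) :
    P.ord (f ^ n) = n * P.ord f := by
  rw [ord, map_zpow₀, WithZero.log_zpow, ord, smul_eq_mul]
  ring

variable (K) in
/-- The ramification index of a place over the place below. -/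
def ramIdx (Q : Place L) : ℤ := Q.ord (algebraMap K L (Q.below K).unif)

theorem ord_algebraMap (Q : Place L) {a : K} (ha : a ≠ 0) :
    Q.ord (algebraMap K L a) = Q.ramIdx K * (Q.below K).ord a := by
  have h := eq_val_pow (P := Q.below K) (v := Q.val.comap (algebraMap K L))
    (fun f hf => (Q.below_val_le_one_iff f).1 hf) (val_unif _) (e := Q.ramIdx K)
    (Q.val_eq_exp (by simpa using unif_ne_zero _)) ha
  rw [Q.ord_eq_of_val_eq h, neg_neg]

variable (K) in
theorem ramIdx_pos (Q : Place L) : 0 < Q.ramIdx K := by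
  have h0 := (Q.below K).unif_ne_zero
  have h1 : (Q.below K).val (Q.below K).unif < 1 := by
    rw [val_unif, ← WithZero.exp_zero, WithZero.exp_lt_exp]
    omega
  rw [val_lt_one_iff_inv _ h0, below_val_le_one_iff, map_inv₀,
    ← val_lt_one_iff_inv _ (by simpa using h0),
    val_lt_one_iff _ (by simpa using h0)] at h1
  exact h1

theorem transcendental_unif {F : Type} [Field F] [Algebra ℂ F] (P : Place F) :
    Transcendental ℂ P.unif := by
  apply IsCurveField.transcendental_of_notMem_range
  rintro ⟨c, hc⟩
  have h := P.val_unif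
  rw [← hc] at h
  rcases eq_or_ne c 0 with rfl | hc0
  · exact P.unif_ne_zero (by rw [← hc, map_zero])
  · rw [P.val_const hc0, ← WithZero.exp_zero, WithZero.exp_inj] at h
    omega

variable [IsCurveField L]

theorem finite_setOf_below_eq (P : Place K) : {Q : Place L | Q.below K = P}.Finite := by
  refine (finite_support_ord (algebraMap K L P.unif)).subset ?_
  rintro Q rfl
  exact (Q.ramIdx_pos K).ne'

/-- The pull-back of a divisor to a finite extension. -/
def pullback : (Place K →₀ ℤ) →+ (Place L →₀ ℤ) where
  toFun D := Finsupp.ofSupportFinite (fun Q => Q.ramIdx K * D (Q.below K)) (by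
    refine (D.support.finite_toSet.biUnion fun P _ => finite_setOf_below_eq (L := L) P).subset ?_
    intro Q hQ
    simp only [Set.mem_iUnion]
    refine ⟨Q.below K, ?_, rfl⟩
    simp only [Finset.mem_coe, Finsupp.mem_support_iff]
    intro h
    simp [h] at hQ)
  map_zero' := by ext Q; simp [Finsupp.ofSupportFinite_coe]
  map_add' D D' := by ext Q; simp [Finsupp.ofSupportFinite_coe, mul_add]

theorem pullback_apply (D : Place K →₀ ℤ) (Q : Place L) :
    pullback D Q = Q.ramIdx K * D (Q.below K) := rfl

theorem pullback_mono {D D' : Place K →₀ ℤ} (h : D ≤ D') : pullback (L := L) D ≤ pullback D' :=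
  fun Q => mul_le_mul_of_nonneg_left (h _) (Q.ramIdx_pos K).le

variable (L) in
/-- The number of points above a place, counted with ramification indices. -/
def fibreDeg (P : Place K) : ℤ := deg (pullback (L := L) (Finsupp.single P 1))

theorem deg_pullback_eq_sum (D : Place K →₀ ℤ) :
    deg (pullback (L := L) D) = D.sum fun P n => n * fibreDeg L P := by
  induction D using Finsupp.induction_linear with
  | zero => simp
  | add D D' h h' =>
    rw [map_add, map_add, h, h', Finsupp.sum_add_index'] <;> intros <;> ring
  | single P n =>
    rw [Finsupp.sum_single_index (by simp), fibreDeg, ← smul_eq_mul, ← map_zsmul, ← map_zsmul]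
    simp

theorem fibreDeg_eq_sum (P : Place K) :
    fibreDeg L P = ∑ Q ∈ (finite_setOf_below_eq (L := L) P).toFinset, Q.ramIdx K := by
  rw [fibreDeg, deg_apply,
    Finsupp.sum_of_support_subset (s := (finite_setOf_below_eq (L := L) P).toFinset)]
  · refine Finset.sum_congr rfl fun Q hQ => ?_
    simp only [Set.Finite.mem_toFinset, Set.mem_ofPred_eq] at hQ
    rw [pullback_apply, hQ]
    simp
  · intro Q hQ
    simp only [Set.Finite.mem_toFinset, Set.mem_ofPred_eq]
    by_contra hne
    rw [Finsupp.mem_support_iff, pullback_apply] at hQ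
    exact hQ (by simp [Ne.symm hne])
  · simp

/-- The inequality `∑ e ≤ [L : K]`, from `sum_ord_le_finrank` for the valuation ring of `P`. -/
theorem fibreDeg_le (P : Place K) : fibreDeg L P ≤ Module.finrank K L := by
  have := P.isDVR
  have hmem : P.unif ∈ P.ring := by
    rw [P.mem_ring_iff, val_unif, ← WithZero.exp_zero, WithZero.exp_le_exp]
    omega
  have hdvd : ∀ a : P.ring, P.val a < 1 → (⟨P.unif, hmem⟩ : P.ring) ∣ a := by
    intro a ha
    have h0 := P.unif_ne_zero
    refine ⟨⟨(a : K) / P.unif, ?_⟩, ?_⟩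
    · rw [P.mem_ring_iff, map_div₀, val_unif]
      exact div_le_one_of_le₀ ((P.val_lt_one_iff_le_exp _).1 ha) zero_le
    · ext
      simp [mul_div_cancel₀ _ h0]
  have h := sum_ord_le_finrank (F := L) (R := P.ring) (E := K) (π := ⟨P.unif, hmem⟩)
    (fun h => P.unif_ne_zero (congrArg Subtype.val h)) (fun a ha => ?_)
    (finite_setOf_below_eq (L := L) P).toFinset (fun Q => (Q.ramIdx K).toNat) ?_ ?_ ?_
  · rw [fibreDeg_eq_sum]
    calc _ = ∑ Q ∈ (finite_setOf_below_eq (L := L) P).toFinset, (((Q.ramIdx K).toNat : ℕ) : ℤ) :=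
          Finset.sum_congr rfl fun Q _ => (Int.toNat_of_nonneg (Q.ramIdx_pos K).le).symm
      _ ≤ _ := by exact_mod_cast h
  · have ha0 : (a : K) ≠ 0 := fun h => ha (Subtype.ext h)
    refine ⟨(P.ord (a : K)).toNat + 1, ?_⟩
    rintro ⟨b, hb⟩
    have hb' : (a : K) = P.unif ^ ((P.ord (a : K)).toNat + 1) * (b : K) := congrArg Subtype.val hb
    have hb0 : (b : K) ≠ 0 := by
      intro h
      rw [h, mul_zero] at hb'
      exact ha0 hb'
    have h1 := congrArg P.ord hb'
    rw [P.ord_mul (pow_ne_zero _ P.unif_ne_zero) hb0, ord_pow, P.ord_eq_of_val_eq P.val_unif] at h1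
    have h2 := (P.val_le_one_iff ha0).1 ((P.mem_ring_iff _).1 a.2)
    have h3 := (P.val_le_one_iff hb0).1 ((P.mem_ring_iff _).1 b.2)
    push_cast at h1
    omega
  · rintro Q hQ a
    simp only [Set.Finite.mem_toFinset, Set.mem_ofPred_eq] at hQ
    exact (Q.below_val_le_one_iff (a : K)).1 (by rw [hQ]; exact (P.mem_ring_iff _).1 a.2)
  · intro Q hQ a ha
    simp only [Set.Finite.mem_toFinset, Set.mem_ofPred_eq] at hQ
    have h1 : P.val (a : K) = 1 :=
      le_antisymm ((P.mem_ring_iff _).1 a.2) (not_lt.1 fun h => ha (hdvd a h))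
    have h0 : (a : K) ≠ 0 := by
      intro h
      rw [h] at h1
      simp at h1
    have h2 := Q.ord_algebraMap h0
    rw [hQ, P.ord_eq_of_val_eq (n := 0) h1, neg_zero, mul_zero] at h2
    change Q.val (algebraMap K L a) = 1
    rw [Q.val_eq_exp (by simpa using h0), h2, neg_zero, WithZero.exp_zero]
  · intro Q hQ
    simp only [Set.Finite.mem_toFinset, Set.mem_ofPred_eq] at hQ
    rw [Int.toNat_of_nonneg (Q.ramIdx_pos K).le]
    change Q.val (algebraMap K L P.unif) = _
    rw [Q.val_eq_exp (by simpa using P.unif_ne_zero), ramIdx, hQ]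

omit [IsCurveField L] in
theorem finrank_adjoin_algebraMap (f : K) :
    Module.finrank (IntermediateField.adjoin ℂ {algebraMap K L f}) L =
      Module.finrank (IntermediateField.adjoin ℂ {f}) K * Module.finrank K L := by
  rw [Module.finrank_mul_finrank]
  let φ : K →ₐ[ℂ] L := IsScalarTower.toAlgHom ℂ K L
  have h : (IntermediateField.adjoin ℂ {f}).map φ =
    IntermediateField.adjoin ℂ {algebraMap K L f} := by
    rw [IntermediateField.adjoin_map, Set.image_singleton]
    rfl
  rw [← h]
  refine (Algebra.finrank_eq_of_equiv_equiv
    ((IntermediateField.adjoin ℂ {f}).equivMap φ).toRingEquiv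
    (RingEquiv.refl L) ?_).symm
  ext x
  rfl

variable [IsCurveField K]

theorem poleDivisor_algebraMap (f : K) :
    poleDivisor (algebraMap K L f) = pullback (poleDivisor f) := by
  ext Q
  rw [pullback_apply, poleDivisor_apply, poleDivisor_apply]
  rcases eq_or_ne f 0 with rfl | hf
  · simp [ord]
  rw [Q.ord_algebraMap hf]
  have := Q.ramIdx_pos K
  rcases le_total ((Q.below K).ord f) 0 with h | h
  · rw [max_eq_left (by nlinarith), max_eq_left (by omega)]
    ring
  · rw [max_eq_right (by nlinarith), max_eq_right (by omega)]
    ring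

/-- The fundamental equality `∑ e = [L : K]`. The inequality `≤` holds for each place, and for the
places that are poles of a function there is equality, as its pole divisor has the degree of the
field extension it defines, both on `K` and on `L`. -/
theorem fibreDeg_eq (P : Place K) : fibreDeg L P = Module.finrank K L := by
  have hft := transcendental_inv P.transcendental_unif
  set f := P.unif⁻¹ with hf
  have hft' : Transcendental ℂ (algebraMap K L f) := by
    intro h
    exact hft ((isAlgebraic_algebraMap_iff (algebraMap K L).injective).1 h)
  have h1 := (deg_poleDivisor_and_exists_defect_le hft').1
  rw [poleDivisor_algebraMap, finrank_adjoin_algebraMap, Nat.cast_mul,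
    ← (deg_poleDivisor_and_exists_defect_le hft).1,
    deg_pullback_eq_sum, deg_apply, Finsupp.sum_mul, Finsupp.sum, Finsupp.sum,
    ← sub_eq_zero, ← Finset.sum_sub_distrib] at h1
  have h2 : ∀ R ∈ (poleDivisor f).support,
      poleDivisor f R * fibreDeg L R - poleDivisor f R * Module.finrank K L ≤ 0 := by
    intro R _
    have := mul_le_mul_of_nonneg_left (fibreDeg_le (L := L) R) (poleDivisor_nonneg f R)
    simpa using this
  have h3 : poleDivisor f P = 1 := by
    rw [poleDivisor_apply, hf, ord_inv, P.ord_eq_of_val_eq P.val_unif]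
    simp
  have h4 := (Finset.sum_eq_zero_iff_of_nonpos h2).1 h1 P (by simp [Finsupp.mem_support_iff, h3])
  rw [h3] at h4
  linarith

theorem deg_pullback (D : Place K →₀ ℤ) :
    deg (pullback (L := L) D) = Module.finrank K L * deg D := by
  rw [deg_pullback_eq_sum, deg_apply, Finsupp.mul_sum]
  refine Finsupp.sum_congr fun P _ => ?_
  rw [fibreDeg_eq, mul_comm]

variable (L) in
theorem exists_below_eq (P : Place K) : ∃ Q : Place L, Q.below K = P := by
  by_contra! hcon
  have h := fibreDeg_eq (L := L) P
  rw [fibreDeg_eq_sum, Finset.sum_eq_zero] at h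
  · exact Module.finrank_pos.ne (by exact_mod_cast h)
  · intro Q hQ
    simp only [Set.Finite.mem_toFinset, Set.mem_ofPred_eq] at hQ
    exact (hcon Q hQ).elim

omit [IsCurveField K] in
theorem exists_le_pullback (D : Place L →₀ ℤ) : ∃ D' : Place K →₀ ℤ, D ≤ pullback D' := by
  classical
  have h : ∀ D : Place L →₀ ℤ, 0 ≤ D → ∃ D' : Place K →₀ ℤ, D ≤ pullback D' := by
    refine effective_induction 0 ⟨0, by simp⟩ ?_
    rintro D _ Q ⟨D', hD'⟩
    refine ⟨D' + Finsupp.single (Q.below K) 1, ?_⟩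
    rw [map_add]
    refine add_le_add hD' fun R => ?_
    have h1 := R.ramIdx_pos K
    rw [pullback_apply]
    rcases eq_or_ne Q R with rfl | hQR
    · simp only [Finsupp.single_eq_same]
      omega
    · rw [Finsupp.single_apply, if_neg hQR, Finsupp.single_apply]
      split_ifs <;> omega
  obtain ⟨D', hD'⟩ := h (D ⊔ 0) le_sup_right
  exact ⟨D', le_sup_left.trans hD'⟩

omit [IsCurveField K] in
/-- Membership in `L(π^* D)` can be tested by multiplying with powers of local parameters of `K`. -/
theorem mem_LSpace_pullback_iff {D : Place K →₀ ℤ} {f : L} :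
    f ∈ LSpace (pullback D) ↔
      ∀ Q : Place L, Q.val (f * algebraMap K L ((Q.below K).unif ^ D (Q.below K))) ≤ 1 := by
  refine forall_congr' fun Q => ?_
  have h0 : algebraMap K L (Q.below K).unif ≠ 0 := by simpa using unif_ne_zero _
  have h1 : Q.val (algebraMap K L ((Q.below K).unif ^ D (Q.below K))) =
      (WithZero.exp (Q.ramIdx K * D (Q.below K)))⁻¹ := by
    rw [map_zpow₀, map_zpow₀, Q.val_eq_exp h0, ← WithZero.exp_zsmul, ← WithZero.exp_neg]
    congr 1
    change _ * -(Q.ramIdx K) = _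
    ring
  rw [map_mul, h1, ← div_eq_mul_inv, div_le_one₀ (by simp [zero_lt_iff]), pullback_apply]

end Restrict

/-! ### The genus of a quadratic extension -/

section Quadratic

variable [FiniteDimensional K L] [IsCurveField K] [IsCurveField L]

/-- Half of the divisor of a function, rounded down. -/
def halfDivisor (β : K) : Place K →₀ ℤ :=
  Finsupp.ofSupportFinite (fun P => P.ord β / 2) ((finite_support_ord β).subset fun P hP h => hP (by
    change P.ord β / 2 = 0
    change P.ord β = 0 at h
    rw [h]
    rfl))

theorem halfDivisor_apply (β : K) (P : Place K) : halfDivisor β P = P.ord β / 2 := rfl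

omit [FiniteDimensional K L] in
theorem finite_setOf_odd_ord (β : K) : {P : Place K | Odd (P.ord β)}.Finite := by
  refine (finite_support_ord β).subset ?_
  rintro P hP h
  change P.ord β = 0 at h
  simp [h] at hP

theorem two_mul_deg_halfDivisor {β : K} (hβ : β ≠ 0) :
    2 * deg (halfDivisor β) = -({P : Place K | Odd (P.ord β)}.ncard : ℤ) := by
  classical
  have hfin : (Function.support fun P : Place K => P.ord β % 2).Finite :=
    (finite_support_ord β).subset fun P hP h => hP (by
      change P.ord β % 2 = 0
      change P.ord β = 0 at h
      rw [h]
      rfl)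
  have h1 : (2 : ℤ) • halfDivisor β + Finsupp.ofSupportFinite _ hfin = divisor β := by
    ext P
    simp only [Finsupp.add_apply, Finsupp.smul_apply, halfDivisor_apply, smul_eq_mul, divisor_apply,
      Finsupp.ofSupportFinite_coe]
    omega
  have h2 : deg (Finsupp.ofSupportFinite _ hfin) = ({P : Place K | Odd (P.ord β)}.ncard : ℤ) := by
    rw [deg_apply, Finsupp.sum, Finsupp.ofSupportFinite_support,
      Set.ncard_eq_toFinset_card _ (finite_setOf_odd_ord β),
      Finset.card_eq_sum_ones, Nat.cast_sum]
    refine Finset.sum_congr ?_ ?_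
    · ext P
      simp only [Set.Finite.mem_toFinset, Function.mem_support, Set.mem_ofPred_eq, Int.odd_iff]
      omega
    · intro P hP
      simp only [Set.Finite.mem_toFinset, Set.mem_ofPred_eq, Int.odd_iff] at hP
      simp [Finsupp.ofSupportFinite_coe, hP]
  have h3 := congrArg deg h1
  rw [map_add, map_zsmul, h2, deg_divisor hβ, smul_eq_mul] at h3
  omega

variable {y : L} {β : K} (hy : y ^ 2 = algebraMap K L β) (hyK : y ∉ (algebraMap K L).range)
  (hgen : ∀ f : L, ∃ a b : K, f = algebraMap K L a + algebraMap K L b * y)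
  (σ : L →ₐ[K] L) (hσ : σ y = -y)

include hy in
/-- `b y ∈ L(π^* D)` means that `b ^ 2 β` has poles bounded by `2 D`, and this depends only on half
of the divisor of `β`, rounded down. -/
theorem algebraMap_mul_mem_LSpace_pullback_iff (hβ : β ≠ 0) {D : Place K →₀ ℤ} {b : K} :
    algebraMap K L b * y ∈ LSpace (pullback D) ↔ b ∈ LSpace (D + halfDivisor β) := by
  rw [mem_LSpace_pullback_iff]
  have key : ∀ Q : Place L,
      Q.val (algebraMap K L b * y * algebraMap K L ((Q.below K).unif ^ D (Q.below K))) ≤ 1 ↔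
      (Q.below K).val b ≤ WithZero.exp ((D + halfDivisor β) (Q.below K)) := by
    intro Q
    rcases eq_or_ne b 0 with rfl | hb
    · simp
    set P := Q.below K with hP
    have h1 : (algebraMap K L b * y * algebraMap K L (P.unif ^ D P)) ^ 2 =
        algebraMap K L ((b * P.unif ^ D P) ^ 2 * β) := by
      rw [map_mul, map_pow, map_mul, ← hy]
      ring
    have h2 : b * P.unif ^ D P ≠ 0 := mul_ne_zero hb (zpow_ne_zero _ P.unif_ne_zero)
    have h3 : P.ord (b * P.unif ^ D P) = P.ord b + D P := by
      rw [P.ord_mul hb (zpow_ne_zero _ P.unif_ne_zero)]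
      rw [ord_zpow, P.ord_eq_of_val_eq P.val_unif]
      ring
    rw [← pow_le_one_iff_of_nonneg zero_le (two_ne_zero), ← map_pow, h1, ← below_val_le_one_iff,
      ← hP, P.val_le_one_iff (mul_ne_zero (pow_ne_zero _ h2) hβ),
      P.ord_mul (pow_ne_zero _ h2) hβ, ord_pow, h3,
      P.val_le_exp_iff hb, Finsupp.add_apply, halfDivisor_apply]
    push_cast
    omega
  constructor
  · intro h P
    obtain ⟨Q, rfl⟩ := exists_below_eq L P
    exact (key Q).1 (h Q)
  · intro h Q
    exact (key Q).2 (h _)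

omit [IsCurveField K] in
include hσ in
/-- As `π^* D` is invariant under the conjugation `σ`, the space `L(π^* D)` contains with
`f = a + b y` also the trace `f + σ f = 2 a`. -/
theorem algebraMap_mem_LSpace_pullback {D : Place K →₀ ℤ} {a b : K}
    (h : algebraMap K L a + algebraMap K L b * y ∈ LSpace (pullback D)) :
    algebraMap K L a ∈ LSpace (pullback D) := by
  rw [mem_LSpace_pullback_iff] at h ⊢
  intro Q
  -- the place `Q'` conjugate to `Q`
  let Q' : Place L := ofValuation (Q.val.comap σ.toRingHom) (by
    obtain ⟨c, hc0, hc⟩ := exists_val_algebraMap_ne_one K Q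
    refine ⟨algebraMap K L c, by simpa using hc0, ?_⟩
    simpa using hc) (fun c => by
      rw [Valuation.comap_apply, IsScalarTower.algebraMap_apply ℂ K L]
      simp only [AlgHom.toRingHom_eq_coe, RingHom.coe_coe, AlgHom.commutes]
      rw [← IsScalarTower.algebraMap_apply]
      exact Q.val_algebraMap_le c)
  have hmem : ∀ f : L, Q'.val f ≤ 1 ↔ Q.val (σ f) ≤ 1 := fun f => ofValuation_mem _ _ f
  have hbelow : Q'.below K = Q.below K := by
    apply ext_ring
    ext c
    rw [mem_ring_iff, mem_ring_iff, below_val_le_one_iff, below_val_le_one_iff, hmem,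
      AlgHom.commutes]
  have h1 := h Q
  have h2 := h Q'
  rw [hbelow, hmem] at h2
  rw [map_mul σ, map_add σ, map_mul σ, hσ, AlgHom.commutes, AlgHom.commutes, AlgHom.commutes] at h2
  have h3 := Valuation.map_add_le _ h1 h2
  have hQ2 : Q.val (algebraMap ℂ L 2) = 1 := Q.val_const two_ne_zero
  have h4 : algebraMap K L a * algebraMap K L ((Q.below K).unif ^ D (Q.below K)) *
    algebraMap ℂ L 2 =
      (algebraMap K L a + algebraMap K L b * y) * algebraMap K L
        ((Q.below K).unif ^ D (Q.below K)) +
      (algebraMap K L a + algebraMap K L b * -y) * algebraMap K L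
        ((Q.below K).unif ^ D (Q.below K)) := by
    rw [map_ofNat]
    ring
  rw [← h4, map_mul, hQ2, mul_one] at h3
  exact h3

theorem algebraMap_mem_LSpace_pullback_iff {D : Place K →₀ ℤ} {a : K} :
    algebraMap K L a ∈ LSpace (pullback D) ↔ a ∈ LSpace D := by
  have key : ∀ Q : Place L, Q.val (algebraMap K L a) ≤ WithZero.exp (pullback D Q) ↔
      (Q.below K).val a ≤ WithZero.exp (D (Q.below K)) := by
    intro Q
    rcases eq_or_ne a 0 with rfl | ha
    · simp
    rw [Q.val_le_exp_iff (by simpa using ha), Place.val_le_exp_iff _ ha, Q.ord_algebraMap ha,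
      pullback_apply]
    have := Q.ramIdx_pos K
    constructor <;> intro h <;> nlinarith
  constructor
  · intro h P
    obtain ⟨Q, rfl⟩ := exists_below_eq L P
    exact (key Q).1 (h Q)
  · intro h Q
    exact (key Q).2 (h _)

include hy hyK hgen hσ in
/-- For the double cover defined by `y ^ 2 = β`:
`L(π^* D) = L(D) ⊕ L(D + E) y`, where `E` is half of the divisor of `β`, rounded down. -/
theorem finrank_LSpace_pullback (hβ : β ≠ 0) (D : Place K →₀ ℤ) :
    Module.finrank ℂ (LSpace (pullback (L := L) D)) =
      Module.finrank ℂ (LSpace D) + Module.finrank ℂ (LSpace (D + halfDivisor β)) := by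
  let φ : K →ₗ[ℂ] L := (IsScalarTower.toAlgHom ℂ K L).toLinearMap
  let ψ : (LSpace D × LSpace (D + halfDivisor β)) →ₗ[ℂ] L :=
    LinearMap.coprod (φ.comp (LSpace D).subtype)
      (((LinearMap.mulRight ℂ y).comp φ).comp (LSpace (D + halfDivisor β)).subtype)
  have hψ : ∀ p, ψ p = algebraMap K L p.1 + algebraMap K L p.2 * y := fun p => rfl
  have hinj : Function.Injective ψ := by
    rw [injective_iff_map_eq_zero]
    rintro ⟨⟨a, ha⟩, ⟨b, hb⟩⟩ h
    rw [hψ] at h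
    simp only at h
    have hb0 : b = 0 := by
      by_contra hb0
      refine hyK ⟨-a / b, ?_⟩
      have : algebraMap K L b ≠ 0 := by simpa using hb0
      rw [map_div₀, map_neg, div_eq_iff this]
      linear_combination -h
    subst hb0
    have ha0 : a = 0 := by simpa using h
    subst ha0
    rfl
  have hrange : LinearMap.range ψ = LSpace (pullback (L := L) D) := by
    ext f
    constructor
    · rintro ⟨p, rfl⟩
      rw [hψ]
      exact Submodule.add_mem _ (algebraMap_mem_LSpace_pullback_iff.2 p.1.2)
        ((algebraMap_mul_mem_LSpace_pullback_iff hy hβ).2 p.2.2)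
    · intro hf
      obtain ⟨a, b, rfl⟩ := hgen f
      have ha := algebraMap_mem_LSpace_pullback σ hσ hf
      have hb := Submodule.sub_mem _ hf ha
      rw [add_sub_cancel_left, algebraMap_mul_mem_LSpace_pullback_iff hy hβ] at hb
      exact ⟨(⟨a, algebraMap_mem_LSpace_pullback_iff.1 ha⟩, ⟨b, hb⟩), hψ _⟩
  rw [← hrange, LinearMap.finrank_range_of_inj hinj, Module.finrank_prod]

include hy hyK hgen hσ in
/-- The Riemann–Hurwitz formula for the double cover `y ^ 2 = β`, which is ramified over the points
at which `β` has odd order. -/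
theorem genus_quadratic (hβ : β ≠ 0) (h2 : Module.finrank K L = 2) :
    ∃ g p : ℕ, genus (fun P : Place K => P) = g ∧ genus (fun Q : Place L => Q) = p ∧
      (2 * p : ℤ) = 4 * g - 2 + {P : Place K | Odd (P.ord β)}.ncard := by
  obtain ⟨g, hg, D₀, hD₀⟩ := exists_genus_eq K
  obtain ⟨p, hp, D₁, hD₁⟩ := exists_genus_eq L
  refine ⟨g, p, hg, hp, ?_⟩
  -- a divisor so large that the defects of `D`, `D + E` and `π^* D` are equal to the genera
  obtain ⟨D₂, hD₂⟩ := exists_le_pullback (K := K) D₁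
  set D := D₀ ⊔ (D₀ - halfDivisor β) ⊔ D₂ with hD
  have h3 := hD₀ D (le_sup_left.trans le_sup_left)
  have h4 := hD₀ (D + halfDivisor β) (by
    rw [← sub_le_iff_le_add]
    exact le_sup_right.trans le_sup_left)
  have h5 := hD₁ (pullback D) (hD₂.trans (pullback_mono le_sup_right))
  have h6 := two_mul_deg_halfDivisor hβ
  rw [defect] at h3 h4 h5
  rw [finrank_LSpace_pullback hy hyK hgen σ hσ hβ, deg_pullback, h2] at h5
  rw [map_add] at h4
  push_cast at h5
  omega

end Quadratic

end Place

/-! ### Local rings of the curve -/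

namespace NonsingularCurve

instance (C : NonsingularCurve) : IsProper C.str := C.isProper

variable (C : NonsingularCurve)

/-- The structure morphism is given on a local ring by the inclusion of the constants. -/
theorem fromSpecStalk_str (x : C.scheme) :
    C.scheme.fromSpecStalk x ≫ C.str = Spec.map (CommRingCat.ofHom (C.const x)) := by
  rw [const, CommRingCat.ofHom_hom, Spec.map_comp, Spec.map_comp, ← Scheme.fromSpecStalk_toSpecΓ]
  simp only [Category.assoc]
  rw [← Scheme.toSpecΓ_naturality_assoc, ← SpecMap_ΓSpecIso_hom, ← Spec.map_comp]
  simp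

/-- The constants in the ring of regular functions on an open set. -/
def constΓ (U : C.scheme.Opens) : ℂ →+* Γ(C.scheme, U) :=
  ((Scheme.ΓSpecIso (CommRingCat.of ℂ)).inv ≫ C.str.appTop ≫
    C.scheme.presheaf.map (homOfLE le_top).op).hom

instance (U : C.scheme.Opens) : Algebra ℂ Γ(C.scheme, U) := (C.constΓ U).toAlgebra

theorem germ_constΓ (U : C.scheme.Opens) (x : C.scheme) (hx : x ∈ U) :
    (C.scheme.presheaf.germ U x hx).hom.comp (C.constΓ U) = C.const x := by
  rw [const, constΓ, ← CommRingCat.hom_comp, Category.assoc, Category.assoc,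
    C.scheme.presheaf.germ_res]

theorem finiteType_of_isAffineOpen {U : C.scheme.Opens} (hU : IsAffineOpen U) :
    Algebra.FiniteType ℂ Γ(C.scheme, U) := by
  have h := LocallyOfFiniteType.finiteType_appLE C.str (isAffineOpen_top _) hU le_top
  exact h.comp (RingHom.FiniteType.of_surjective _
    (ConcreteCategory.bijective_of_isIso ((Scheme.ΓSpecIso (CommRingCat.of ℂ)).inv)).2)

theorem essFiniteType_stalk (x : C.scheme) :
    Algebra.EssFiniteType ℂ (C.scheme.presheaf.stalk x) := by
  obtain ⟨U, hU, hx, -⟩ :=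
    exists_isAffineOpen_mem_and_subset (X := C.scheme) (U := ⊤) (x := x) trivial
  have h1 := hU.isLocalization_stalk ⟨x, hx⟩
  let _ := C.scheme.presheaf.algebra_section_stalk ⟨x, hx⟩
  have : IsScalarTower ℂ Γ(C.scheme, U) (C.scheme.presheaf.stalk x) :=
    IsScalarTower.of_algebraMap_eq' (C.germ_constΓ U x hx).symm
  have := C.finiteType_of_isAffineOpen hU
  have : Algebra.EssFiniteType Γ(C.scheme, U) (C.scheme.presheaf.stalk x) :=
    Algebra.EssFiniteType.of_isLocalization _ (hU.primeIdealOf ⟨x, hx⟩).asIdeal.primeCompl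
  exact Algebra.EssFiniteType.comp ℂ Γ(C.scheme, U) _

/-- The residue field of a closed point is `ℂ`. -/
theorem exists_sub_const_mem (x : C.Pt) (f : C.O x) :
    ∃ c : ℂ, f - algebraMap ℂ (C.O x) c ∈ IsLocalRing.maximalIdeal (C.O x) := by
  let e := residueFieldIsoBase C.str x.1 x.2
  have h := SpecMap_residueFieldIsoBase_inv C.str x.1 x.2
  rw [Scheme.fromSpecResidueField, Category.assoc, fromSpecStalk_str, ← Spec.map_comp] at h
  have h2 := Spec.map_injective h
  obtain ⟨c, hc⟩ := (ConcreteCategory.bijective_of_isIso e.inv).2 (C.scheme.residue x.1 f)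
  refine ⟨c, ?_⟩
  rw [← IsLocalRing.residue_eq_zero_iff, map_sub, sub_eq_zero]
  have h3 := congrArg (fun φ => φ.hom c) h2
  exact hc.symm.trans h3

end NonsingularCurve

/-! ### Differentials of local rings and function fields -/

/-- Nakayama's lemma: the differentials of a local ring with residue field `ℂ`, whose maximal ideal
is generated by `t`, are generated by `dt`. -/
theorem KaehlerDifferential.exists_D_eq_smul_of_maximalIdeal {O : Type} [CommRing O] [IsLocalRing O]
    [Algebra ℂ O] [Algebra.EssFiniteType ℂ O] {t : O}
    (h : ∀ f : O, ∃ c : ℂ, ∃ g : O, f = algebraMap ℂ O c + t * g)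
    (ht : t ∈ IsLocalRing.maximalIdeal O) (f : O) :
    ∃ g : O, KaehlerDifferential.D ℂ O f = g • KaehlerDifferential.D ℂ O t := by
  have := KaehlerDifferential.finite ℂ O
  have key : (⊤ : Submodule O Ω[O⁄ℂ]) ≤ Submodule.span O {KaehlerDifferential.D ℂ O t} := by
    apply Submodule.le_of_le_smul_of_le_jacobson_bot (I := IsLocalRing.maximalIdeal O)
      Module.Finite.fg_top (IsLocalRing.maximalIdeal_le_jacobson _)
    rw [← KaehlerDifferential.span_range_derivation, Submodule.span_le]
    rintro _ ⟨f, rfl⟩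
    obtain ⟨c, g, rfl⟩ := h f
    rw [map_add, Derivation.map_algebraMap, zero_add, Derivation.leibniz, add_comm]
    refine Submodule.add_mem_sup
      (Submodule.smul_mem _ _ (Submodule.mem_span_singleton_self _))
      (Submodule.smul_mem_smul ht ?_)
    rw [KaehlerDifferential.span_range_derivation]
    trivial
  obtain ⟨g, hg⟩ := Submodule.mem_span_singleton.1
    (key (Submodule.mem_top (x := KaehlerDifferential.D ℂ O f)))
  exact ⟨g, hg.symm⟩

section

variable {O K : Type} [CommRing O] [Field K] [Algebra O K] [Algebra ℂ O] [Algebra ℂ K]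
  [IsScalarTower ℂ O K]

theorem KaehlerDifferential.D_algebraMap_eq_smul {t f g : O}
    (h : KaehlerDifferential.D ℂ O f = g • KaehlerDifferential.D ℂ O t) :
    KaehlerDifferential.D ℂ K (algebraMap O K f) =
      algebraMap O K g • KaehlerDifferential.D ℂ K (algebraMap O K t) := by
  have := congrArg (KaehlerDifferential.map ℂ ℂ O K) h
  rw [map_smul, KaehlerDifferential.map_D, KaehlerDifferential.map_D] at this
  rw [this, algebraMap_smul]

/-- The differentials of a fraction field are generated by those of the ring. -/
theorem KaehlerDifferential.span_D_eq_top_of_isFractionRing [IsFractionRing O K] {t : O}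
    (h : ∀ f : O, ∃ g : O,
      KaehlerDifferential.D ℂ O f = g • KaehlerDifferential.D ℂ O t) :
    Submodule.span K {KaehlerDifferential.D ℂ K (algebraMap O K t)} = ⊤ := by
  rw [eq_top_iff, ← KaehlerDifferential.span_range_derivation, Submodule.span_le]
  rintro _ ⟨f, rfl⟩
  obtain ⟨a, b, hb, rfl⟩ := IsFractionRing.div_surjective (A := O) f
  obtain ⟨g, hg⟩ := h a
  obtain ⟨k, hk⟩ := h b
  have hg := D_algebraMap_eq_smul (K := K) hg
  have hk := D_algebraMap_eq_smul (K := K) hk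
  rw [Derivation.leibniz_div, hg, hk]
  refine Submodule.smul_mem _ _ (Submodule.sub_mem _ ?_ ?_) <;>
  exact Submodule.smul_mem _ _ (Submodule.smul_mem _ _ (Submodule.mem_span_singleton_self _))

end

/-- In characteristic zero, an extension is algebraic when it has no differentials. -/
theorem KaehlerDifferential.subsingleton_iff_isAlgebraic
    {E K : Type} [Field E] [CharZero E] [Field K] [Algebra E K]
    [Algebra.EssFiniteType E K] : Subsingleton Ω[K⁄E] ↔ Algebra.IsAlgebraic E K := by
  rw [← Algebra.formallyUnramified_iff, Algebra.FormallyUnramified.iff_isSeparable]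
  exact ⟨fun h => inferInstance, fun h => inferInstance⟩

section
variable {K : Type} [Field K] [Algebra ℂ K] [Algebra.EssFiniteType ℂ K]

/-- If the differentials of `K` are generated by `dt`, then `K` has no differentials over `ℂ(t)`, so
it is algebraic over `ℂ(t)`. -/
theorem IsCurveField.of_span_D_eq_top {t : K} (ht : t ∉ (algebraMap ℂ K).range)
    (h : Submodule.span K {KaehlerDifferential.D ℂ K t} = ⊤) : IsCurveField K := by
  refine ⟨inferInstance, ?_⟩
  have htr : Transcendental ℂ t := transcendental_of_notMem_range ht
  let E := IntermediateField.adjoin ℂ {t}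
  have hE : Algebra.EssFiniteType E K := Algebra.EssFiniteType.of_comp ℂ E K
  have h2 : Algebra.IsAlgebraic E K := by
    rw [← KaehlerDifferential.subsingleton_iff_isAlgebraic (K := K), ← Submodule.subsingleton_iff K,
      ← subsingleton_iff_bot_eq_top]
    have h1 : (⊤ : Submodule K Ω[K⁄E]) ≤ ⊥ := by
      rw [← KaehlerDifferential.span_range_derivation, Submodule.span_le]
      rintro _ ⟨f, rfl⟩
      have h3 : KaehlerDifferential.D ℂ K f ∈ Submodule.span K {KaehlerDifferential.D ℂ K t} := by
        rw [h]; trivial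
      obtain ⟨g, hg⟩ := Submodule.mem_span_singleton.1 h3
      have h4 := congrArg (KaehlerDifferential.map ℂ E K K) hg
      rw [map_smul, KaehlerDifferential.map_D, KaehlerDifferential.map_D] at h4
      have h5 : KaehlerDifferential.D E K t = 0 :=
        Derivation.map_algebraMap (KaehlerDifferential.D E K)
          (IntermediateField.AdjoinSimple.gen ℂ t)
      simp only [Algebra.algebraMap_self, RingHom.id_apply, h5, smul_zero] at h4
      exact h4.symm
    exact (le_bot_iff.1 h1).symm
  have hb : IsTranscendenceBasis ℂ (fun _ : Unit => t) := by
    refine isTranscendenceBasis_iff_algebraicIndependent_isAlgebraic.2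
      ⟨(algebraicIndependent_unique_type_iff (ι := Unit)).2 htr, ?_⟩
    have h6 : Algebra.IsAlgebraic (IntermediateField.adjoin ℂ (Set.range fun _ : Unit => t)) K := by
      rw [Set.range_const]
      exact h2
    exact ⟨fun a => IntermediateField.isAlgebraic_adjoin_iff.1 (h6.isAlgebraic a)⟩
  simpa using hb.cardinalMk_eq_trdeg.symm

theorem IsCurveField.D_ne_zero {t : K} (ht : t ∉ (algebraMap ℂ K).range)
    (h : Submodule.span K {KaehlerDifferential.D ℂ K t} = ⊤) : KaehlerDifferential.D ℂ K t ≠ 0 := by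
  intro h0
  rw [h0, Submodule.span_zero_singleton, subsingleton_iff_bot_eq_top, Submodule.subsingleton_iff,
    KaehlerDifferential.subsingleton_iff_isAlgebraic] at h
  exact transcendental_of_notMem_range ht (h.isAlgebraic t)
end

/-! ### Local parameters -/

namespace NonsingularCurve

variable (C : NonsingularCurve)

theorem irreducible_param (x : C.Pt) : Irreducible (C.param x) :=
  (IsDiscreteValuationRing.exists_irreducible (C.O x)).choose_spec

theorem maximalIdeal_eq_span_param (x : C.Pt) :
    IsLocalRing.maximalIdeal (C.O x) = Ideal.span {C.param x} :=
  (IsDiscreteValuationRing.irreducible_iff_uniformizer _).1 (C.irreducible_param x)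

theorem param_mem (x : C.Pt) : C.param x ∈ IsLocalRing.maximalIdeal (C.O x) := by
  rw [maximalIdeal_eq_span_param]
  exact Ideal.mem_span_singleton_self _

theorem exists_eq_const_add_param_mul (x : C.Pt) (f : C.O x) :
    ∃ c : ℂ, ∃ g : C.O x, f = algebraMap ℂ (C.O x) c + C.param x * g := by
  obtain ⟨c, hc⟩ := C.exists_sub_const_mem x f
  rw [maximalIdeal_eq_span_param, Ideal.mem_span_singleton] at hc
  obtain ⟨g, hg⟩ := hc
  exact ⟨c, g, by rw [← hg]; ring⟩

theorem exists_D_eq_smul_dt (x : C.Pt) (f : C.O x) :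
    ∃ g : C.O x, KaehlerDifferential.D ℂ C.K (algebraMap (C.O x) C.K f) =
      algebraMap (C.O x) C.K g • C.dt x := by
  have := C.essFiniteType_stalk x.1
  obtain ⟨g, hg⟩ := KaehlerDifferential.exists_D_eq_smul_of_maximalIdeal
    (C.exists_eq_const_add_param_mul x) (C.param_mem x) f
  exact ⟨g, KaehlerDifferential.D_algebraMap_eq_smul hg⟩

theorem span_dt (x : C.Pt) : Submodule.span C.K {C.dt x} = ⊤ := by
  have := C.essFiniteType_stalk x.1
  exact KaehlerDifferential.span_D_eq_top_of_isFractionRing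
    (KaehlerDifferential.exists_D_eq_smul_of_maximalIdeal
      (C.exists_eq_const_add_param_mul x) (C.param_mem x))

theorem param_notMem_range (x : C.Pt) :
    algebraMap (C.O x) C.K (C.param x) ∉ (algebraMap ℂ C.K).range := by
  rintro ⟨c, hc⟩
  rw [IsScalarTower.algebraMap_apply ℂ (C.O x) C.K] at hc
  have h := IsFractionRing.injective (C.O x) C.K hc
  have h1 := C.irreducible_param x
  rw [← h] at h1
  rcases eq_or_ne c 0 with rfl | hc0
  · exact h1.ne_zero (map_zero _)
  · exact h1.not_isUnit ((IsUnit.mk0 c hc0).map _)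

instance : Algebra.EssFiniteType ℂ C.K := C.essFiniteType_stalk (genericPoint C.scheme)

theorem dt_ne_zero (x : C.Pt) : C.dt x ≠ 0 :=
  IsCurveField.D_ne_zero (C.param_notMem_range x) (C.span_dt x)

theorem nonempty_pt : Nonempty C.Pt := by
  have : CompactSpace C.scheme := QuasiCompact.compactSpace_of_compactSpace C.str
  obtain ⟨x, -, hx⟩ := IsClosed.exists_closed_singleton (isClosed_univ (X := C.scheme))
    Set.univ_nonempty
  exact ⟨⟨x, hx⟩⟩

instance : IsCurveField C.K :=
  let x := C.nonempty_pt.some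
  IsCurveField.of_span_D_eq_top (C.param_notMem_range x) (C.span_dt x)

/-! ### Closed points are places -/

theorem mem_place_iff (x : C.Pt) (f : C.K) :
    f ∈ (C.place x).ring ↔ ∃ g : C.O x, algebraMap (C.O x) C.K g = f :=
  ValuationRing.mem_integer_iff (C.O x) C.K f

theorem place_val_algebraMap_le (x : C.Pt) (f : C.O x) :
    (C.place x).val (algebraMap (C.O x) C.K f) ≤ 1 :=
  (Place.mem_ring_iff _ _).1 ((C.mem_place_iff x _).2 ⟨f, rfl⟩)

theorem place_val_eq_one_of_isUnit (x : C.Pt) {f : C.O x} (hf : IsUnit f) :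
    (C.place x).val (algebraMap (C.O x) C.K f) = 1 := by
  obtain ⟨u, rfl⟩ := hf
  refine le_antisymm (C.place_val_algebraMap_le x _) ?_
  have h : (C.place x).val (algebraMap (C.O x) C.K u) *
      (C.place x).val (algebraMap (C.O x) C.K ((u⁻¹ : (C.O x)ˣ) : C.O x)) = 1 := by
    rw [← map_mul, ← map_mul, Units.mul_inv, map_one, map_one]
  rw [← h]
  exact mul_le_of_le_one_right' (C.place_val_algebraMap_le x _)

theorem isUnit_of_place_val_eq_one (x : C.Pt) {f : C.O x}
    (hf : (C.place x).val (algebraMap (C.O x) C.K f) = 1) : IsUnit f := by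
  have h0 : algebraMap (C.O x) C.K f ≠ 0 := fun h => by simp [h] at hf
  have h : (C.place x).val (algebraMap (C.O x) C.K f)⁻¹ ≤ 1 := by
    rw [map_inv₀, hf, inv_one]
  obtain ⟨g, hg⟩ := (C.mem_place_iff x _).1 ((Place.mem_ring_iff _ _).2 h)
  refine IsUnit.of_mul_eq_one g (IsFractionRing.injective (C.O x) C.K ?_)
  rw [map_mul, hg, mul_inv_cancel₀ h0, map_one]

theorem place_val_lt_one_iff (x : C.Pt) (f : C.O x) :
    (C.place x).val (algebraMap (C.O x) C.K f) < 1 ↔ f ∈ IsLocalRing.maximalIdeal (C.O x) := by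
  rw [IsLocalRing.mem_maximalIdeal, mem_nonunits_iff, (C.place_val_algebraMap_le x f).lt_iff_ne]
  exact not_congr ⟨C.isUnit_of_place_val_eq_one x, C.place_val_eq_one_of_isUnit x⟩

/-- The local parameter of the curve is a uniformizer of the place. -/
theorem place_val_param (x : C.Pt) :
    (C.place x).val (algebraMap (C.O x) C.K (C.param x)) = WithZero.exp (-1 : ℤ) := by
  apply le_antisymm
  · rw [← Place.val_lt_one_iff_le_exp, place_val_lt_one_iff]
    exact C.param_mem x
  · obtain ⟨p, hp⟩ := (C.place x).exists_val_eq_exp_neg_one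
    have hp1 : (C.place x).val p < 1 := by
      rw [hp, ← WithZero.exp_zero, WithZero.exp_lt_exp]
      omega
    obtain ⟨f, rfl⟩ := (C.mem_place_iff x _).1 ((Place.mem_ring_iff _ _).2 hp1.le)
    rw [place_val_lt_one_iff, maximalIdeal_eq_span_param, Ideal.mem_span_singleton] at hp1
    obtain ⟨g, rfl⟩ := hp1
    rw [← hp, map_mul, map_mul]
    exact mul_le_of_le_one_right' (C.place_val_algebraMap_le x _)

theorem place_ord_param (x : C.Pt) :
    (C.place x).ord (algebraMap (C.O x) C.K (C.param x)) = 1 := by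
  rw [Place.ord_eq_of_val_eq _ (C.place_val_param x), neg_neg]

/-- The generic point of `C`, as a morphism from the spectrum of the function field. -/
def fromSpecK : Spec (CommRingCat.of C.K) ⟶ C.scheme :=
  C.scheme.fromSpecStalk (genericPoint C.scheme)

theorem specMap_algebraMap_fromSpecStalk (x : C.scheme) :
    Spec.map (CommRingCat.ofHom (algebraMap (C.scheme.presheaf.stalk x) C.K)) ≫
      C.scheme.fromSpecStalk x = C.fromSpecK :=
  Scheme.SpecMap_stalkSpecializes_fromSpecStalk ((genericPoint_spec C.scheme).specializes trivial)

theorem fromSpecK_str :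
    C.fromSpecK ≫ C.str = Spec.map (CommRingCat.ofHom (algebraMap ℂ C.K)) :=
  C.fromSpecStalk_str (genericPoint C.scheme)

/-- The constants in the valuation ring of a place. -/
def constPlace (P : Place C.K) : ℂ →+* P.ring :=
  (algebraMap ℂ C.K).codRestrict P.ring.toSubring P.algebraMap_mem

/-- The square to which the valuative criterion of properness is applied. -/
def valuativeSq (P : Place C.K) : ValuativeCommSq C.str where
  R := P.ring
  K := C.K
  i₁ := C.fromSpecK
  i₂ := Spec.map (CommRingCat.ofHom (C.constPlace P))
  commSq := ⟨by
    rw [fromSpecK_str, ← Spec.map_comp]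
    rfl⟩

/-- By the valuative criterion, the generic point extends to the spectrum of the valuation ring of a
place. -/
theorem exists_lift (P : Place C.K) : ∃ l : Spec (CommRingCat.of P.ring) ⟶ C.scheme,
    Spec.map (CommRingCat.ofHom (algebraMap P.ring C.K)) ≫ l = C.fromSpecK := by
  have hp : (@IsProper : MorphismProperty Scheme) C.str := C.isProper
  rw [IsProper.eq_valuativeCriterion] at hp
  obtain ⟨⟨l, hl1, hl2⟩⟩ := (hp.1.1.1.existence (C.valuativeSq P)).exists_lift
  exact ⟨l, hl1⟩

/-- The valuation ring of a place contains a local ring of `C`: that of the image of the closed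
point under the extension of `exists_lift`. -/
theorem exists_stalk_le (P : Place C.K) : ∃ x : C.scheme, ∀ f : C.scheme.presheaf.stalk x,
    algebraMap _ C.K f ∈ P.ring := by
  obtain ⟨l, hl⟩ := C.exists_lift P
  refine ⟨l (IsLocalRing.closedPoint P.ring), fun f => ?_⟩
  rw [← Scheme.Spec_stalkClosedPointTo_fromSpecStalk l,
    ← C.specMap_algebraMap_fromSpecStalk (l (IsLocalRing.closedPoint P.ring)), ← Category.assoc,
    cancel_mono, ← Spec.map_comp] at hl
  have h := congrArg (fun φ => φ.hom f) (Spec.map_injective hl)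
  refine (congrArg (· ∈ P.ring) h).mp ?_
  exact ((Scheme.stalkClosedPointTo l).hom f).2

/-- The centre of a place specializes to a closed point, whose valuation ring is contained in that
of the place, and hence equal to it. -/
theorem place_surjective : Function.Surjective C.place := by
  intro P
  obtain ⟨x, hx⟩ := C.exists_stalk_le P
  have : CompactSpace C.scheme := QuasiCompact.compactSpace_of_compactSpace C.str
  obtain ⟨y, hy1, hy2⟩ := IsClosed.exists_closed_singleton (isClosed_closure (s := {x}))
     ⟨x, subset_closure rfl⟩
  have hxy : x ⤳ y := specializes_iff_mem_closure.2 hy1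
  refine ⟨⟨y, hy2⟩, ?_⟩
  by_contra hne
  obtain ⟨f, hf1, hf2⟩ := Place.exists_val_le_one_of_ne hne
  rw [← Place.mem_ring_iff, mem_place_iff] at hf1
  obtain ⟨g, rfl⟩ := hf1
  apply hf2.not_ge
  rw [← Place.mem_ring_iff]
  convert! hx ((C.scheme.presheaf.stalkSpecializes hxy).hom g)
  change (C.scheme.presheaf.stalkSpecializes _).hom g = (C.scheme.presheaf.stalkSpecializes _).hom _
  rw [← CommRingCat.comp_apply, TopCat.Presheaf.stalkSpecializes_comp]

theorem algebraMap_mem_place (x : C.Pt) (f : C.O x) :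
    algebraMap (C.O x) C.K f ∈ (C.place x).ring := (C.mem_place_iff x _).2 ⟨f, rfl⟩

/-- The morphism to `C` from the spectrum of the valuation ring of a place with centre `x`. -/
def fromPlace (P : Place C.K) (x : C.Pt) (h : C.place x = P) :
    Spec (CommRingCat.of P.ring) ⟶ C.scheme :=
  Spec.map (CommRingCat.ofHom ((algebraMap (C.O x) C.K).codRestrict P.ring.toSubring
    fun f => h ▸ C.algebraMap_mem_place x f)) ≫ C.scheme.fromSpecStalk x.1

theorem fromPlace_closedPoint (P : Place C.K) (x : C.Pt) (h : C.place x = P) :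
    C.fromPlace P x h (IsLocalRing.closedPoint P.ring) = x.1 := by
  subst h
  let φ : C.O x →+* (C.place x).ring := (algebraMap (C.O x) C.K).codRestrict _
    (C.algebraMap_mem_place x)
  have : IsLocalHom φ := by
    refine ⟨fun f hf => C.isUnit_of_place_val_eq_one x ?_⟩
    obtain ⟨b, hb⟩ := isUnit_iff_exists_inv.1 hf
    refine le_antisymm (C.place_val_algebraMap_le x f) ?_
    have h1 : (C.place x).val (algebraMap (C.O x) C.K f) * (C.place x).val b = 1 := by
      rw [← map_mul, ← map_one (C.place x).val]
      exact congrArg (fun z : (C.place x).ring => (C.place x).val z) hb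
    rw [← h1]
    exact mul_le_of_le_one_right' ((Place.mem_ring_iff _ _).1 b.2)
  change C.scheme.fromSpecStalk x.1 (Spec.map (CommRingCat.ofHom φ) _) = _
  have h2 : (Spec.map (CommRingCat.ofHom φ)) (IsLocalRing.closedPoint (C.place x).ring) =
    IsLocalRing.closedPoint (C.O x) :=
    IsLocalRing.comap_closedPoint φ
  rw [h2, Scheme.fromSpecStalk_closedPoint]

theorem specMap_fromPlace (P : Place C.K) (x : C.Pt) (h : C.place x = P) :
    Spec.map (CommRingCat.ofHom (algebraMap P.ring C.K)) ≫ C.fromPlace P x h = C.fromSpecK := by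
  rw [← C.specMap_algebraMap_fromSpecStalk x.1, fromPlace, ← Category.assoc, ← Spec.map_comp]
  rfl

theorem fromPlace_str (P : Place C.K) (x : C.Pt) (h : C.place x = P) :
    C.fromPlace P x h ≫ C.str = Spec.map (CommRingCat.ofHom (C.constPlace P)) := by
  rw [fromPlace, Category.assoc, fromSpecStalk_str, ← Spec.map_comp]
  congr 1
  ext c
  exact (IsScalarTower.algebraMap_apply ℂ (C.O x) C.K c).symm

/-- By the uniqueness part of the valuative criterion, a place has only one centre. -/
theorem place_injective : Function.Injective C.place := by
  intro x y hxy
  have key := IsSeparated.valuativeCriterion C.str (C.valuativeSq (C.place y))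
  have h := key.elim ⟨C.fromPlace _ x hxy, C.specMap_fromPlace _ x hxy, C.fromPlace_str _ x hxy⟩
    ⟨C.fromPlace _ y rfl, C.specMap_fromPlace _ y rfl, C.fromPlace_str _ y rfl⟩
  have h : C.fromPlace _ x hxy = C.fromPlace _ y rfl := congrArg (fun l => l.l) h
  apply Subtype.ext
  rw [← C.fromPlace_closedPoint _ x hxy, ← C.fromPlace_closedPoint _ y rfl, h]

end NonsingularCurve

/-! ### Meromorphic differentials and their divisors -/

namespace NonsingularCurve

variable {C : NonsingularCurve}

theorem exists_eq_smul_of_ne_zero {ω : C.Mero1} (hω : ω ≠ 0) (a : C.Mero1) :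
    ∃ f : C.K, a = f • ω := by
  have h : ∀ a : C.Mero1, ∃ f : C.K, f • C.dt C.nonempty_pt.some = a := fun a =>
    Submodule.mem_span_singleton.1 (by rw [C.span_dt]; trivial)
  obtain ⟨f, rfl⟩ := h a
  obtain ⟨g, rfl⟩ := h ω
  have hg : g ≠ 0 := fun h => hω (by rw [h, zero_smul])
  exact ⟨f / g, by rw [smul_smul, div_mul_cancel₀ _ hg]⟩

theorem eq_coeff1_smul {ω : C.Mero1} (hω : ω ≠ 0) (a : C.Mero1) : a = coeff1 ω a • ω :=
  Classical.epsilon_spec (exists_eq_smul_of_ne_zero hω a)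

theorem coeff1_eq {ω : C.Mero1} (hω : ω ≠ 0) {a : C.Mero1} {f : C.K} (h : a = f • ω) :
    coeff1 ω a = f :=
  smul_left_injective C.K hω ((eq_coeff1_smul hω a).symm.trans h)

theorem eq_coeff2_smul {ω : C.Mero1} (hω : ω ≠ 0) (s : C.Mero2) :
    s = coeff2 ω s • (ω ⊗ₜ[C.K] ω) := by
  refine Classical.epsilon_spec (p := fun f => s = f • (ω ⊗ₜ[C.K] ω)) ?_
  induction s using TensorProduct.induction_on with
  | zero => exact ⟨0, by rw [zero_smul]⟩
  | tmul a b =>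
    obtain ⟨f, rfl⟩ := exists_eq_smul_of_ne_zero hω a
    obtain ⟨g, rfl⟩ := exists_eq_smul_of_ne_zero hω b
    exact ⟨f * g, by rw [TensorProduct.smul_tmul_smul]⟩
  | add s t hs ht =>
    obtain ⟨f, rfl⟩ := hs
    obtain ⟨g, rfl⟩ := ht
    exact ⟨f + g, by rw [add_smul]⟩

theorem tmul_self_ne_zero {ω : C.Mero1} (hω : ω ≠ 0) : ω ⊗ₜ[C.K] ω ≠ 0 := by
  obtain ⟨φ, hφ⟩ := Module.Projective.exists_dual_eq_one C.K hω
  intro h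
  have := congrArg (LinearMap.mul' C.K C.K ∘ₗ TensorProduct.map φ φ) h
  simp [hφ] at this

theorem coeff2_eq {ω : C.Mero1} (hω : ω ≠ 0) {s : C.Mero2} {f : C.K}
    (h : s = f • (ω ⊗ₜ[C.K] ω)) : coeff2 ω s = f :=
  smul_left_injective C.K (tmul_self_ne_zero hω) ((eq_coeff2_smul hω s).symm.trans h)

theorem coeff2_discr {ω : C.Mero1} (hω : ω ≠ 0) (a₁ : C.Mero1) (a₂ : C.Mero2) :
    coeff2 ω (discr a₁ a₂) = coeff1 ω a₁ ^ 2 / 4 - coeff2 ω a₂ := by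
  apply coeff2_eq hω
  conv_lhs => rw [discr, eq_coeff2_smul hω a₂, eq_coeff1_smul hω a₁]
  rw [TensorProduct.smul_tmul_smul, smul_smul, ← sub_smul]
  congr 1
  ring

theorem coeff2_smul_frame {ω : C.Mero1} (hω : ω ≠ 0) {k : C.K} (hk : k ≠ 0) (s : C.Mero2) :
    coeff2 ω s = k ^ 2 * coeff2 (k • ω) s := by
  apply coeff2_eq hω
  conv_lhs => rw [eq_coeff2_smul (smul_ne_zero hk hω) s]
  rw [TensorProduct.smul_tmul_smul, smul_smul]
  congr 1
  ring

theorem coeff1_smul_frame {ω : C.Mero1} (hω : ω ≠ 0) {k : C.K} (hk : k ≠ 0) (a : C.Mero1) :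
    coeff1 ω a = k * coeff1 (k • ω) a := by
  apply coeff1_eq hω
  conv_lhs => rw [eq_coeff1_smul (smul_ne_zero hk hω) a]
  rw [smul_smul, mul_comm]

theorem frame_ne_zero : C.frame ≠ 0 :=
  Classical.epsilon_spec (p := fun ω : C.Mero1 => ω ≠ 0) ⟨_, C.dt_ne_zero C.nonempty_pt.some⟩

theorem coeff2_eq_zero_iff {ω : C.Mero1} (hω : ω ≠ 0) (s : C.Mero2) : coeff2 ω s = 0 ↔ s = 0 := by
  constructor
  · intro h
    rw [eq_coeff2_smul hω s, h, zero_smul]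
  · rintro rfl
    exact coeff2_eq hω (by rw [zero_smul])

theorem coeff1_dt_ne_zero {ω : C.Mero1} (hω : ω ≠ 0) (x : C.Pt) : coeff1 ω (C.dt x) ≠ 0 := by
  intro h
  apply C.dt_ne_zero x
  rw [eq_coeff1_smul hω (C.dt x), h, zero_smul]

theorem ord2_eq {ω : C.Mero1} (hω : ω ≠ 0) {s : C.Mero2} (hs : s ≠ 0) (x : C.Pt) :
    ord2 s x = (C.place x).ord (coeff2 ω s) - 2 * (C.place x).ord (coeff1 ω (C.dt x)) := by
  have hk := coeff1_dt_ne_zero hω x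
  have h := coeff2_smul_frame hω hk s
  rw [← eq_coeff1_smul hω] at h
  rw [h, Place.ord_mul _ (pow_ne_zero _ hk) ((coeff2_eq_zero_iff (C.dt_ne_zero x) s).not.2 hs),
    Place.ord_pow, ord2]
  push_cast
  ring

/-- As `K_C ^ 2` is a square, the parity of the order does not depend on the trivialization. -/
theorem odd_ord2_iff {ω : C.Mero1} (hω : ω ≠ 0) {s : C.Mero2} (hs : s ≠ 0) (x : C.Pt) :
    Odd (ord2 s x) ↔ Odd ((C.place x).ord (coeff2 ω s)) := by
  rw [ord2_eq hω hs, Int.odd_sub, iff_iff_eq, eq_iff_iff]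
  simp

/-- The functions regular at the place `P` whose differentials are regular multiples of `ω`. -/
def regularDifferential (P : Place C.K) {ω : C.Mero1} (hω : ω ≠ 0) : Subalgebra ℂ C.K where
  carrier := {f | P.val f ≤ 1 ∧ P.val (coeff1 ω (KaehlerDifferential.D ℂ C.K f)) ≤ 1}
  mul_mem' := by
    rintro f g ⟨hf, hf'⟩ ⟨hg, hg'⟩
    refine ⟨by rw [map_mul]; exact mul_le_one' hf hg, ?_⟩
    rw [coeff1_eq (f := f * coeff1 ω (KaehlerDifferential.D ℂ C.K g) +
      g * coeff1 ω (KaehlerDifferential.D ℂ C.K f)) hω]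
    · refine (P.val.map_add _ _).trans (max_le ?_ ?_) <;> rw [map_mul]
      · exact mul_le_one' hf hg'
      · exact mul_le_one' hg hf'
    · rw [add_smul, mul_smul, mul_smul, ← eq_coeff1_smul hω, ← eq_coeff1_smul hω,
        Derivation.leibniz]
  add_mem' := by
    rintro f g ⟨hf, hf'⟩ ⟨hg, hg'⟩
    refine ⟨(P.val.map_add _ _).trans (max_le hf hg), ?_⟩
    rw [coeff1_eq (f := coeff1 ω (KaehlerDifferential.D ℂ C.K f) +
      coeff1 ω (KaehlerDifferential.D ℂ C.K g)) hω]
    · exact (P.val.map_add _ _).trans (max_le hf' hg')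
    · rw [add_smul, ← eq_coeff1_smul hω, ← eq_coeff1_smul hω, map_add]
  algebraMap_mem' c := by
    refine ⟨P.val_algebraMap_le c, ?_⟩
    rw [coeff1_eq (f := 0) hω, map_zero]
    · exact zero_le
    · rw [Derivation.map_algebraMap, zero_smul]

theorem inv_mem_regularDifferential (P : Place C.K) {ω : C.Mero1} (hω : ω ≠ 0) {f : C.K}
    (hf : f ∈ regularDifferential P hω) (h1 : P.val f = 1) : f⁻¹ ∈ regularDifferential P hω := by
  refine ⟨by rw [map_inv₀, h1, inv_one], ?_⟩
  rw [coeff1_eq (f := -(f⁻¹ ^ 2 * coeff1 ω (KaehlerDifferential.D ℂ C.K f))) hω]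
  · rw [Valuation.map_neg, map_mul, map_pow, map_inv₀, h1, inv_one, one_pow, one_mul]
    exact hf.2
  · rw [neg_smul, mul_smul, ← eq_coeff1_smul hω, Derivation.leibniz_inv, neg_smul]

/-- If the differentials of generators of the coordinate ring of an affine open set are regular
multiples of `ω` at `x`, then so is `dt`, because the local parameter is a quotient of regular
functions. -/
theorem val_coeff1_dt_le {U : C.scheme.Opens} (hU : IsAffineOpen U) (x : C.Pt) (hx : x.1 ∈ U)
    {ω : C.Mero1} (hω : ω ≠ 0) {S : Set Γ(C.scheme, U)} (hS : Algebra.adjoin ℂ S = ⊤)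
    (h : ∀ a ∈ S, (C.place x).val (coeff1 ω (KaehlerDifferential.D ℂ C.K
      (algebraMap (C.O x) C.K ((C.scheme.presheaf.germ U x.1 hx).hom a)))) ≤ 1) :
    (C.place x).val (coeff1 ω (C.dt x)) ≤ 1 := by
  let g : Γ(C.scheme, U) →ₐ[ℂ] C.K :=
    { (algebraMap (C.O x) C.K).comp (C.scheme.presheaf.germ U x.1 hx).hom with
      commutes' := fun c => by
        change algebraMap (C.O x) C.K
          (((C.scheme.presheaf.germ U x.1 hx).hom.comp (C.constΓ U)) c) = _
        rw [germ_constΓ]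
        exact (IsScalarTower.algebraMap_apply ℂ (C.O x) C.K c).symm }
  have hg : ∀ a, g a ∈ regularDifferential (C.place x) hω := by
    have h1 : Algebra.adjoin ℂ S ≤ (regularDifferential (C.place x) hω).comap g :=
      Algebra.adjoin_le fun a ha => ⟨C.place_val_algebraMap_le x _, h a ha⟩
    rw [hS] at h1
    exact fun a => h1 (x := a) trivial
  let _ : Algebra Γ(C.scheme, U) (C.O x) := C.scheme.presheaf.algebra_section_stalk ⟨x.1, hx⟩
  have h1 : IsLocalization (hU.primeIdealOf ⟨x.1, hx⟩).asIdeal.primeCompl (C.O x) :=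
    hU.isLocalization_stalk ⟨x.1, hx⟩
  obtain ⟨⟨a, b⟩, hab⟩ :=
    IsLocalization.surj (hU.primeIdealOf ⟨x.1, hx⟩).asIdeal.primeCompl (C.param x)
  have hb : (C.place x).val (g b) = 1 :=
    C.place_val_eq_one_of_isUnit x (IsLocalization.map_units (C.O x) b)
  have hb0 : g b ≠ 0 := fun h0 => by simp [h0] at hb
  have h2 : algebraMap (C.O x) C.K (C.param x) = g a * (g b)⁻¹ := by
    rw [eq_mul_inv_iff_mul_eq₀ hb0]
    exact (map_mul _ _ _).symm.trans (congrArg (algebraMap (C.O x) C.K) hab)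
  have h3 := (regularDifferential (C.place x) hω).mul_mem (hg a)
    (inv_mem_regularDifferential _ hω (hg b) hb)
  rw [← h2] at h3
  exact h3.2

theorem finite_setOf_one_lt_val (f : C.K) : {x : C.Pt | 1 < (C.place x).val f}.Finite := by
  rcases eq_or_ne f 0 with rfl | hf
  · simp
  · refine ((Place.finite_support_ord f).preimage C.place_injective.injOn).subset fun x hx => ?_
    intro h
    change (C.place x).ord f = 0 at h
    rw [Set.mem_ofPred_eq, (C.place x).val_eq_exp hf, h] at hx
    simp at hx

/-- `C` is covered by finitely many affine open sets, and the coordinate ring of each is generated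
by finitely many functions, whose differentials have finitely many poles relative to `ω`. -/
theorem finite_setOf_one_lt_val_coeff1_dt {ω : C.Mero1} (hω : ω ≠ 0) :
    {x : C.Pt | 1 < (C.place x).val (coeff1 ω (C.dt x))}.Finite := by
  have : CompactSpace C.scheme := QuasiCompact.compactSpace_of_compactSpace C.str
  suffices h : {x : C.Pt | x.1 ∈ Set.univ ∧ 1 < (C.place x).val (coeff1 ω (C.dt x))}.Finite by
    simpa using h
  refine isCompact_univ.induction_on (p := fun s : Set C.scheme =>
    {x : C.Pt | x.1 ∈ s ∧ 1 < (C.place x).val (coeff1 ω (C.dt x))}.Finite) ?_ ?_ ?_ ?_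
  · simp
  · exact fun s t hst ht => ht.subset fun x hx => ⟨hst hx.1, hx.2⟩
  · exact fun s t hs ht => (hs.union ht).subset fun x hx =>
      hx.1.imp (fun h => ⟨h, hx.2⟩) (fun h => ⟨h, hx.2⟩)
  · intro y _
    obtain ⟨U, hU, hy, -⟩ :=
      exists_isAffineOpen_mem_and_subset (X := C.scheme) (U := ⊤) (x := y) trivial
    refine ⟨U, mem_nhdsWithin_of_mem_nhds (U.2.mem_nhds hy), ?_⟩
    obtain ⟨S, hS⟩ := (C.finiteType_of_isAffineOpen hU).out
    have hgen : genericPoint C.scheme ∈ U :=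
      ((genericPoint_spec C.scheme).mem_open_set_iff U.2).2 ⟨y, trivial, hy⟩
    refine (Set.Finite.biUnion S.finite_toSet fun a _ => finite_setOf_one_lt_val (coeff1 ω
      (KaehlerDifferential.D ℂ C.K
        ((C.scheme.presheaf.germ U (genericPoint C.scheme) hgen).hom a)))).subset ?_
    rintro x ⟨hx, hx2⟩
    by_contra hcon
    simp only [Set.mem_iUnion, not_exists] at hcon
    refine hx2.not_ge (val_coeff1_dt_le hU x hx hω hS fun a ha => ?_)
    have h1 := not_lt.1 (Set.notMem_ofPred_iff.1 (hcon a ha))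
    convert! h1 using 5
    change (C.scheme.presheaf.germ U x.1 hx ≫ C.scheme.presheaf.stalkSpecializes _).hom a = _
    rw [TopCat.Presheaf.germ_stalkSpecializes]

/-- A nonzero meromorphic differential has finitely many zeros and poles: it is enough to see this
for the differential `ω₀` of a function `z`, which is a regular multiple of `dt` where `z` is
regular, while `dt` is a regular multiple of `ω₀` at almost all points. -/
theorem finite_setOf_ord_coeff1_dt_ne_zero {ω : C.Mero1} (hω : ω ≠ 0) :
    {x : C.Pt | (C.place x).ord (coeff1 ω (C.dt x)) ≠ 0}.Finite := by
  suffices key : ∃ ω₀ : C.Mero1, ω₀ ≠ 0 ∧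
      {x : C.Pt | (C.place x).ord (coeff1 ω₀ (C.dt x)) ≠ 0}.Finite by
    obtain ⟨ω₀, hω₀, hfin⟩ := key
    obtain ⟨k, rfl⟩ := exists_eq_smul_of_ne_zero hω ω₀
    have hk : k ≠ 0 := fun h => hω₀ (by rw [h, zero_smul])
    refine (hfin.union ((Place.finite_support_ord k).preimage C.place_injective.injOn)).subset ?_
    intro x hx
    by_contra hcon
    simp only [Set.mem_union, Set.mem_ofPred_eq, Set.mem_preimage, Function.mem_support, not_or,
      not_not] at hcon
    apply hx
    rw [coeff1_smul_frame hω hk, Place.ord_mul _ hk (coeff1_dt_ne_zero hω₀ x), hcon.1, hcon.2,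
      add_zero]
  let x₀ := C.nonempty_pt.some
  set z := algebraMap (C.O x₀) C.K (C.param x₀) with hz
  have hω₀ := C.dt_ne_zero x₀
  refine ⟨C.dt x₀, hω₀, ?_⟩
  refine ((finite_setOf_one_lt_val_coeff1_dt hω₀).union (finite_setOf_one_lt_val z)).subset ?_
  intro x hx
  by_contra hcon
  simp only [Set.mem_union, Set.mem_ofPred_eq, not_or, not_lt] at hcon
  apply hx
  have hk := coeff1_dt_ne_zero hω₀ x
  refine le_antisymm ?_ (((C.place x).val_le_one_iff hk).1 hcon.1)
  rw [← Place.mem_ring_iff _ z, mem_place_iff] at hcon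
  obtain ⟨f, hf⟩ := hcon.2
  obtain ⟨g, hg⟩ := C.exists_D_eq_smul_dt x f
  have h1 : C.dt x₀ = (algebraMap (C.O x) C.K g * coeff1 (C.dt x₀) (C.dt x)) • C.dt x₀ := by
    rw [mul_smul, ← eq_coeff1_smul hω₀, ← hg, hf]
    rfl
  have h2 := smul_left_injective C.K hω₀ ((one_smul C.K _).trans h1)
  have hg0 : algebraMap (C.O x) C.K g ≠ 0 := fun h => by simp [h] at h2
  have h3 := congrArg (C.place x).ord h2
  rw [Place.ord_mul _ hg0 hk, Place.ord_one] at h3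
  have := ((C.place x).val_le_one_iff hg0).1 (C.place_val_algebraMap_le x g)
  omega

theorem finite_setOf_ord2_ne_zero {s : C.Mero2} (hs : s ≠ 0) :
    {x : C.Pt | ord2 s x ≠ 0}.Finite := by
  have hω := frame_ne_zero (C := C)
  refine ((finite_setOf_ord_coeff1_dt_ne_zero hω).union
    ((Place.finite_support_ord (coeff2 C.frame s)).preimage C.place_injective.injOn)).subset ?_
  intro x hx
  by_contra hcon
  simp only [Set.mem_union, Set.mem_ofPred_eq, Set.mem_preimage, Function.mem_support, not_or,
      not_not] at hcon
  apply hx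
  rw [ord2_eq hω hs, hcon.1, hcon.2]
  rfl

end NonsingularCurve

/-! ### Square roots of power series -/

namespace PowerSeries

/-- Hensel's lemma: a power series with nonzero constant term has a square root. -/
theorem exists_sq_eq (u : PowerSeries ℂ) {c : ℂ} (hc : c ≠ 0) (h : c ^ 2 = constantCoeff u) :
    ∃ w : PowerSeries ℂ, w ^ 2 = u ∧ constantCoeff w = c := by
  have hen : HenselianRing (PowerSeries ℂ) (Ideal.span {(PowerSeries.X : PowerSeries ℂ)}) :=
    inferInstance
  have hd : (Polynomial.X ^ 2 - Polynomial.C u).derivative.eval (C c) = C (2 * c) := by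
    simp [one_add_one_eq_two, map_ofNat]
  obtain ⟨w, hw, hwc⟩ := hen.is_henselian (Polynomial.X ^ 2 - Polynomial.C u)
    (Polynomial.monic_X_pow_sub_C u two_ne_zero) (C c)
    (by
      rw [Ideal.mem_span_singleton, X_dvd_iff]
      simp [h])
    (by
      rw [hd]
      refine IsUnit.map _ ?_
      rw [isUnit_iff_constantCoeff]
      simpa using hc)
  refine ⟨w, ?_, ?_⟩
  · have h1 := hw.eq_zero
    rw [Polynomial.eval_sub, Polynomial.eval_pow, Polynomial.eval_X, Polynomial.eval_C] at h1
    exact sub_eq_zero.1 h1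
  · rw [Ideal.mem_span_singleton, X_dvd_iff] at hwc
    simpa [sub_eq_zero] using hwc

end PowerSeries

/-! ### The ring of a cusp -/

namespace NonsingularCurve.CuspRing

/-- The equation `t ^ 2 - s ^ N` of a plane curve germ. -/
abbrev equation (N : ℕ) : MvPowerSeries (Fin 2) ℂ := MvPowerSeries.X 1 ^ 2 - MvPowerSeries.X 0 ^ N

theorem hasSubst_param {N : ℕ} (hN : N ≠ 0) :
    MvPowerSeries.HasSubst (![PowerSeries.X ^ 2, PowerSeries.X ^ N] : Fin 2 → PowerSeries ℂ) := by
  refine MvPowerSeries.hasSubst_of_constantCoeff_zero fun i => ?_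
  change PowerSeries.constantCoeff _ = 0
  fin_cases i <;> simp [hN]

/-- The parametrisation `s = τ ^ 2`, `t = τ ^ N` of the germ `t ^ 2 = s ^ N`. -/
def paramHom {N : ℕ} (hN : N ≠ 0) : MvPowerSeries (Fin 2) ℂ →ₐ[ℂ] PowerSeries ℂ :=
  MvPowerSeries.substAlgHom (hasSubst_param hN)

theorem paramHom_X_zero {N : ℕ} (hN : N ≠ 0) :
    paramHom hN (MvPowerSeries.X 0) = PowerSeries.X ^ 2 :=
  MvPowerSeries.substAlgHom_X (hasSubst_param hN) 0

theorem paramHom_X_one {N : ℕ} (hN : N ≠ 0) : paramHom hN (MvPowerSeries.X 1) = PowerSeries.X ^ N :=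
  MvPowerSeries.substAlgHom_X (hasSubst_param hN) 1

theorem paramHom_equation {N : ℕ} (hN : N ≠ 0) : paramHom hN (equation N) = 0 := by
  rw [equation, map_sub, map_pow, map_pow, paramHom_X_one, paramHom_X_zero, ← pow_mul, ← pow_mul,
    mul_comm, sub_self]

/-- A power series in `s` alone. -/
def inS : PowerSeries ℂ →ₐ[ℂ] MvPowerSeries (Fin 2) ℂ :=
  PowerSeries.substAlgHom (PowerSeries.HasSubst.X 0)

theorem paramHom_inS {N : ℕ} (hN : N ≠ 0) (r : PowerSeries ℂ) :
    paramHom hN (inS r) = PowerSeries.expand 2 two_ne_zero r := by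
  have h := MvPowerSeries.subst_comp_subst_apply (R := ℂ) (S := ℂ)
    (PowerSeries.HasSubst.const (PowerSeries.HasSubst.X (0 : Fin 2) (S := ℂ)))
    (hasSubst_param hN) r
  rw [paramHom, inS, MvPowerSeries.substAlgHom_apply, PowerSeries.coe_substAlgHom,
    PowerSeries.subst, h,
    PowerSeries.expand_apply, PowerSeries.subst]
  congr 1
  funext i
  exact MvPowerSeries.subst_X (hasSubst_param hN) 0

/-- The coefficients of the quotient of `∑ F i j s ^ i t ^ j` by `t ^ 2 - s ^ N`. -/
def quotCoeff (N : ℕ) (F : ℕ → ℕ → ℂ) (i j : ℕ) : ℂ :=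
  F i (j + 2) + if h : 0 < N ∧ N ≤ i then quotCoeff N F (i - N) (j + 2) else 0
termination_by i
decreasing_by omega

theorem coeff_inS (r : PowerSeries ℂ) (e : Fin 2 →₀ ℕ) :
    MvPowerSeries.coeff e (inS r) = if e 1 = 0 then PowerSeries.coeff (e 0) r else 0 := by
  rw [inS, PowerSeries.coe_substAlgHom, PowerSeries.coeff_subst_single]
  refine if_congr ?_ rfl rfl
  constructor
  · intro h
    rw [h]
    simp
  · intro h
    ext i
    fin_cases i <;> simp [h]

/-- Weierstrass division by `t ^ 2 - s ^ N`. -/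
theorem exists_eq_mul_equation_add {N : ℕ} (hN : N ≠ 0) (F : MvPowerSeries (Fin 2) ℂ) :
    ∃ (Q : MvPowerSeries (Fin 2) ℂ) (r₀ r₁ : PowerSeries ℂ),
      F = Q * equation N + inS r₀ + MvPowerSeries.X 1 * inS r₁ := by
  -- the exponent of `s ^ i t ^ j`
  let p : ℕ → ℕ → (Fin 2 →₀ ℕ) := fun i j => Finsupp.single 0 i + Finsupp.single 1 j
  have hp : ∀ e, p (e 0) (e 1) = e := fun e => by
    ext i
    fin_cases i <;> simp [p]
  let q := quotCoeff N fun i j => MvPowerSeries.coeff (p i j) F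
  let Q : MvPowerSeries (Fin 2) ℂ := fun e => q (e 0) (e 1)
  have hQ : ∀ e, MvPowerSeries.coeff e Q = q (e 0) (e 1) := fun e => rfl
  have hR : ∀ e, MvPowerSeries.coeff e (F - Q * equation N) = MvPowerSeries.coeff e F -
      (if 2 ≤ e 1 then q (e 0) (e 1 - 2) else 0) + if N ≤ e 0 then q (e 0 - N) (e 1) else 0 := by
    intro e
    rw [equation, mul_sub, map_sub, map_sub, MvPowerSeries.X_pow_eq, MvPowerSeries.X_pow_eq,
      MvPowerSeries.coeff_mul_monomial, MvPowerSeries.coeff_mul_monomial, hQ, hQ]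
    simp
    ring
  refine ⟨Q, PowerSeries.mk fun i => MvPowerSeries.coeff (p i 0) (F - Q * equation N),
    PowerSeries.mk fun i => MvPowerSeries.coeff (p i 1) (F - Q * equation N), ?_⟩
  rw [add_assoc, ← sub_eq_iff_eq_add']
  ext e
  rw [map_add, MvPowerSeries.X_def, MvPowerSeries.coeff_monomial_mul, coeff_inS, coeff_inS,
    PowerSeries.coeff_mk, PowerSeries.coeff_mk]
  simp only [Finsupp.single_le_iff, Finsupp.coe_tsub, Pi.sub_apply, Finsupp.single_eq_same, one_mul]
  have h0 : (Finsupp.single (1 : Fin 2) 1 : Fin 2 →₀ ℕ) 0 = 0 := by simp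
  rw [h0, Nat.sub_zero]
  rcases Nat.lt_trichotomy (e 1) 1 with h | h | h
  · have h1 : e 1 = 0 := by omega
    have h2 := hp e
    rw [h1] at h2
    simp [h1, h2]
  · have h2 := hp e
    rw [h] at h2
    simp [h, h2]
  · obtain ⟨k, hk⟩ : ∃ k, e 1 = k + 2 := ⟨e 1 - 2, by omega⟩
    have h3 : q (e 0) k = MvPowerSeries.coeff e F + if N ≤ e 0 then q (e 0 - N) (k + 2) else 0 := by
      have h2 := hp e
      rw [hk] at h2
      simp only [q]
      rw [quotCoeff, h2]
      simp [Nat.pos_of_ne_zero hN]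
    rw [hR, hk]
    simp [h3]

theorem coeff_expand_even (r : PowerSeries ℂ) (n : ℕ) :
    PowerSeries.coeff (2 * n) (PowerSeries.expand 2 two_ne_zero r) = PowerSeries.coeff n r :=
  PowerSeries.coeff_expand_mul 2 two_ne_zero r n

theorem coeff_expand_odd (r : PowerSeries ℂ) {n : ℕ} (hn : Odd n) :
    PowerSeries.coeff n (PowerSeries.expand 2 two_ne_zero r) = 0 :=
  PowerSeries.coeff_expand_of_not_dvd 2 two_ne_zero r
    (by rwa [← even_iff_two_dvd, Nat.not_even_iff_odd])

theorem coeff_X_pow_mul_expand_even {N : ℕ} (hN : Odd N) (r : PowerSeries ℂ) {n : ℕ} (hn : Even n) :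
    PowerSeries.coeff n (PowerSeries.X ^ N * PowerSeries.expand 2 two_ne_zero r) = 0 := by
  rw [PowerSeries.coeff_X_pow_mul']
  split_ifs with h
  · exact coeff_expand_odd r (Nat.Even.sub_odd h hn hN)
  · rfl

/-- Comparing even and odd coefficients. -/
theorem X_pow_dvd_of_dvd_expand_add {N n k : ℕ} (hN : Odd N) {r₀ r₁ : PowerSeries ℂ}
    (h : (PowerSeries.X : PowerSeries ℂ) ^ n ∣ PowerSeries.expand 2 two_ne_zero r₀ +
      PowerSeries.X ^ N * PowerSeries.expand 2 two_ne_zero r₁) (hn : 2 * k + N ≤ n) :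
    PowerSeries.X ^ k ∣ r₀ ∧ PowerSeries.X ^ k ∣ r₁ := by
  rw [PowerSeries.X_pow_dvd_iff] at h
  constructor <;> rw [PowerSeries.X_pow_dvd_iff] <;> intro i hi
  · have := h (2 * i) (by omega)
    rwa [map_add, coeff_expand_even, coeff_X_pow_mul_expand_even hN _ (even_two_mul i),
      add_zero] at this
  · have := h (2 * i + N) (by omega)
    rwa [map_add, coeff_expand_odd _ ((even_two_mul i).add_odd hN), PowerSeries.coeff_X_pow_mul,
      coeff_expand_even, zero_add] at this

theorem eq_zero_of_expand_add_eq_zero {N : ℕ} (hN : Odd N) {r₀ r₁ : PowerSeries ℂ}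
    (h : PowerSeries.expand 2 two_ne_zero r₀ +
      PowerSeries.X ^ N * PowerSeries.expand 2 two_ne_zero r₁ = 0) : r₀ = 0 ∧ r₁ = 0 := by
  have key := fun k => X_pow_dvd_of_dvd_expand_add (n := 2 * k + N) (k := k) hN
    (h ▸ dvd_zero _) le_rfl
  constructor <;> ext k
  · exact PowerSeries.X_pow_dvd_iff.1 (key (k + 1)).1 k (Nat.lt_succ_self k)
  · exact PowerSeries.X_pow_dvd_iff.1 (key (k + 1)).2 k (Nat.lt_succ_self k)

/-- The normalization `τ ↦ (τ ^ 2, τ ^ (2m + 1))` of the germ `t ^ 2 = s ^ (2m + 1)`. -/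
def toPowerSeries (m : ℕ) : CuspRing m →ₐ[ℂ] PowerSeries ℂ :=
  Ideal.Quotient.liftₐ _ (paramHom (N := 2 * m + 1) (by omega)) fun a ha => by
    obtain ⟨Q, rfl⟩ := Ideal.mem_span_singleton'.1 ha
    rw [map_mul, paramHom_equation, mul_zero]

theorem toPowerSeries_injective (m : ℕ) : Function.Injective (toPowerSeries m) := by
  rw [injective_iff_map_eq_zero]
  intro a ha
  obtain ⟨F, rfl⟩ := Ideal.Quotient.mk_surjective a
  have h : paramHom (N := 2 * m + 1) (by omega) F = 0 := ha
  obtain ⟨Q, r₀, r₁, rfl⟩ := exists_eq_mul_equation_add (N := 2 * m + 1) (by omega) F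
  rw [map_add, map_add, map_mul, paramHom_equation, map_mul, paramHom_X_one, paramHom_inS,
    paramHom_inS, mul_zero, zero_add] at h
  obtain ⟨rfl, rfl⟩ := eq_zero_of_expand_add_eq_zero (by exact ⟨m, rfl⟩) h
  rw [map_zero, mul_zero, add_zero, add_zero, Ideal.Quotient.eq_zero_iff_mem]
  exact Ideal.mul_mem_left _ _ (Ideal.mem_span_singleton_self _)

theorem mem_range_toPowerSeries (m : ℕ) (f : PowerSeries ℂ) :
    f ∈ (toPowerSeries m).range ↔ ∃ r₀ r₁ : PowerSeries ℂ, f = PowerSeries.expand 2 two_ne_zero r₀ +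
      PowerSeries.X ^ (2 * m + 1) * PowerSeries.expand 2 two_ne_zero r₁ := by
  constructor
  · rintro ⟨a, rfl⟩
    obtain ⟨F, rfl⟩ := Ideal.Quotient.mk_surjective a
    obtain ⟨Q, r₀, r₁, rfl⟩ := exists_eq_mul_equation_add (N := 2 * m + 1) (by omega) F
    refine ⟨r₀, r₁, ?_⟩
    change paramHom (N := 2 * m + 1) (by omega) _ = _
    rw [map_add, map_add, map_mul, paramHom_equation, map_mul, paramHom_X_one, paramHom_inS,
      paramHom_inS, mul_zero, zero_add]
  · rintro ⟨r₀, r₁, rfl⟩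
    refine ⟨Ideal.Quotient.mk _ (inS r₀ + MvPowerSeries.X 1 * inS r₁), ?_⟩
    change paramHom (N := 2 * m + 1) (by omega) _ = _
    rw [map_add, map_mul, paramHom_X_one, paramHom_inS, paramHom_inS]

end NonsingularCurve.CuspRing

/-! ### Homomorphisms from the ring of a cusp -/

namespace NonsingularCurve.CuspRing

/-- Homomorphisms of `ℂ`-algebras between power series rings are automatically local: `X i - c` is a
unit for `c ≠ 0`. -/
theorem constantCoeff_algHom_X (ψ : MvPowerSeries (Fin 2) ℂ →ₐ[ℂ] PowerSeries ℂ) (i : Fin 2) :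
    PowerSeries.constantCoeff (ψ (MvPowerSeries.X i)) = 0 := by
  by_contra hc
  set c := PowerSeries.constantCoeff (ψ (MvPowerSeries.X i)) with hcdef
  have h1 : IsUnit (MvPowerSeries.X i - algebraMap ℂ (MvPowerSeries (Fin 2) ℂ) c) := by
    rw [MvPowerSeries.isUnit_iff_constantCoeff, MvPowerSeries.algebraMap_apply]
    simpa using hc
  have h2 := h1.map ψ
  rw [map_sub, AlgHom.commutes, PowerSeries.isUnit_iff_constantCoeff, map_sub, ← hcdef,
    PowerSeries.algebraMap_apply] at h2
  simp at h2

/-- A germ `ℂ⟦τ⟧ → Spf ℂ⟦s, t⟧` on the cusp `t ^ 2 = s ^ (2m + 1)` with `m ≥ 1` is never an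
immersion: by parity, the orders of `s` and `t` are at least two. -/
theorem coeff_one_algHom_eq_zero {m : ℕ} (hm : 1 ≤ m) (φ : CuspRing m →ₐ[ℂ] PowerSeries ℂ)
    (a : CuspRing m) : PowerSeries.coeff 1 (φ a) = 0 := by
  obtain ⟨F, rfl⟩ := Ideal.Quotient.mk_surjective a
  let ψ : MvPowerSeries (Fin 2) ℂ →ₐ[ℂ] PowerSeries ℂ := φ.comp (Ideal.Quotient.mkₐ ℂ _)
  change PowerSeries.coeff 1 (ψ F) = 0
  have hψ : ψ (equation (2 * m + 1)) = 0 := by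
    change φ (Ideal.Quotient.mk _ _) = 0
    rw [Ideal.Quotient.eq_zero_iff_mem.2 (Ideal.mem_span_singleton_self _), map_zero]
  obtain ⟨Q, r₀, r₁, rfl⟩ := exists_eq_mul_equation_add (N := 2 * m + 1) (by omega) F
  obtain ⟨S, hS⟩ := PowerSeries.X_dvd_iff.2 (constantCoeff_algHom_X ψ 0)
  obtain ⟨T, hT⟩ := PowerSeries.X_dvd_iff.2 (constantCoeff_algHom_X ψ 1)
  rw [equation, map_sub, map_pow, map_pow, sub_eq_zero, hS, hT] at hψ
  have hord := congrArg PowerSeries.order hψ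
  rw [PowerSeries.order_pow, PowerSeries.order_pow, PowerSeries.order_mul, PowerSeries.order_mul,
    PowerSeries.order_X] at hord
  have key : PowerSeries.constantCoeff S = 0 ∧ PowerSeries.constantCoeff T = 0 := by
    have h0 : ∀ f : PowerSeries ℂ, PowerSeries.constantCoeff f ≠ 0 → f.order = 0 := fun f hf =>
      (PowerSeries.order_eq_nat (n := 0)).2 ⟨by simpa using hf, by simp⟩
    constructor
    · by_contra hc
      rw [h0 S hc] at hord
      cases h : T.order using ENat.recTopCoe with
      | top =>
        rw [h] at hord
        exact absurd hord.symm (by simpa using ENat.natCast_ne_top (2 * m + 1))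
      | coe n =>
        rw [h, add_zero, nsmul_eq_mul, nsmul_eq_mul] at hord
        have h1 : 2 * (1 + n) = (2 * m + 1) * 1 := by exact_mod_cast hord
        omega
    · by_contra hc
      rw [h0 T hc] at hord
      cases h : S.order using ENat.recTopCoe with
      | top =>
        rw [h] at hord
        exact absurd hord (by simp)
      | coe n =>
        rw [h, add_zero, nsmul_eq_mul, nsmul_eq_mul] at hord
        have h1 : 2 * 1 = (2 * m + 1) * (1 + n) := by exact_mod_cast hord
        nlinarith
  have hr : r₀ = PowerSeries.C (PowerSeries.constantCoeff r₀) +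
      PowerSeries.X * PowerSeries.mk fun p => PowerSeries.coeff (p + 1) r₀ := by
    rw [add_comm]
    exact r₀.eq_X_mul_shift_add_const
  have hr' : ψ (inS r₀) = algebraMap ℂ _ (PowerSeries.constantCoeff r₀) +
      PowerSeries.X * S * ψ (inS (PowerSeries.mk fun p => PowerSeries.coeff (p + 1) r₀)) := by
    have h1 : inS PowerSeries.X = MvPowerSeries.X 0 :=
      PowerSeries.substAlgHom_X (PowerSeries.HasSubst.X 0)
    have h2 : (PowerSeries.C (PowerSeries.constantCoeff r₀) : PowerSeries ℂ) =
      algebraMap ℂ _ (PowerSeries.constantCoeff r₀) := rfl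
    conv_lhs => rw [hr, h2, map_add, map_mul, h1, map_add, map_mul, hS, AlgHom.commutes,
      AlgHom.commutes]
  have hshift : ∀ f : PowerSeries ℂ, PowerSeries.coeff 1 (PowerSeries.X * f) =
    PowerSeries.constantCoeff f := fun f => by
    rw [← zero_add 1, PowerSeries.coeff_succ_X_mul, PowerSeries.coeff_zero_eq_constantCoeff]
  rw [map_add ψ, map_add ψ, map_mul ψ, map_mul ψ, hr', hT, equation, map_sub, map_pow, map_pow, hS,
    hT, hψ, sub_self,
    mul_zero, zero_add, map_add, map_add, mul_assoc, mul_assoc, hshift, hshift, map_mul, map_mul,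
    key.1, key.2, PowerSeries.algebraMap_apply]
  simp

end NonsingularCurve.CuspRing

/-! ### Taylor expansion -/

section Taylor

variable {O : Type} [CommRing O] [IsDomain O] [Algebra ℂ O]

/-- A uniformizer `t` of a local domain with residue field `ℂ`, together with the evaluation
`f ↦ f(0)`: the data needed for Taylor expansions. -/
structure TaylorData (O : Type) [CommRing O] [IsDomain O] [Algebra ℂ O] where
  param : O
  param_ne_zero : param ≠ 0
  value : O →ₐ[ℂ] ℂ
  value_eq_zero_iff : ∀ f, value f = 0 ↔ param ∣ f
  isUnit_of_value_ne_zero : ∀ f, value f ≠ 0 → IsUnit f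

namespace TaylorData

variable (T : TaylorData O)

theorem exists_shift (f : O) : ∃ g : O, f = algebraMap ℂ O (T.value f) + T.param * g := by
  obtain ⟨g, hg⟩ := (T.value_eq_zero_iff (f - algebraMap ℂ O (T.value f))).1
    (by rw [map_sub, AlgHom.commutes]; simp)
  exact ⟨g, by rw [← hg]; ring⟩

/-- The quotient `(f - f(0)) / t`. -/
def shift (f : O) : O := (T.exists_shift f).choose

theorem eq_add_shift (f : O) : f = algebraMap ℂ O (T.value f) + T.param * T.shift f :=
  (T.exists_shift f).choose_spec

theorem value_param : T.value T.param = 0 := (T.value_eq_zero_iff _).2 dvd_rfl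

theorem shift_eq {f g : O} {c : ℂ} (h : f = algebraMap ℂ O c + T.param * g) : T.shift f = g := by
  have h1 : T.value f = c := by
    rw [h, map_add, map_mul, T.value_param, zero_mul, add_zero, AlgHom.commutes]
    rfl
  have h2 := T.eq_add_shift f
  rw [h1] at h2
  exact mul_left_cancel₀ T.param_ne_zero (add_left_cancel (h2.symm.trans h))

theorem shift_add (f g : O) : T.shift (f + g) = T.shift f + T.shift g := by
  apply T.shift_eq (c := T.value f + T.value g)
  conv_lhs => rw [T.eq_add_shift f, T.eq_add_shift g]
  rw [map_add]
  ring

/-- The quotient rule that makes Taylor expansion multiplicative. -/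
theorem shift_mul (f g : O) :
    T.shift (f * g) = f * T.shift g + algebraMap ℂ O (T.value g) * T.shift f := by
  apply T.shift_eq (c := T.value f * T.value g)
  have hf := T.eq_add_shift f
  have hg := T.eq_add_shift g
  rw [map_mul]
  linear_combination f * hg + algebraMap ℂ O (T.value g) * hf

/-- The Taylor coefficients. -/
def coeff (n : ℕ) (f : O) : ℂ := T.value (T.shift^[n] f)

theorem coeff_zero (f : O) : T.coeff 0 f = T.value f := rfl

theorem coeff_succ (n : ℕ) (f : O) : T.coeff (n + 1) f = T.coeff n (T.shift f) := rfl

theorem coeff_add (n : ℕ) (f g : O) : T.coeff n (f + g) = T.coeff n f + T.coeff n g := by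
  induction n generalizing f g with
  | zero => exact map_add _ _ _
  | succ n ih => rw [coeff_succ, shift_add, ih, coeff_succ, coeff_succ]

theorem shift_algebraMap (c : ℂ) : T.shift (algebraMap ℂ O c) = 0 :=
  T.shift_eq (c := c) (by rw [mul_zero, add_zero])

theorem coeff_succ_zero (n : ℕ) : T.coeff n (0 : O) = 0 := by
  induction n with
  | zero => exact map_zero _
  | succ n ih =>
    rw [coeff_succ, ← map_zero (algebraMap ℂ O), shift_algebraMap, ih]

theorem coeff_algebraMap_mul (n : ℕ) (c : ℂ) (f : O) :
    T.coeff n (algebraMap ℂ O c * f) = c * T.coeff n f := by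
  induction n generalizing f with
  | zero =>
    rw [coeff_zero, map_mul, AlgHom.commutes]
    rfl
  | succ n ih =>
    rw [coeff_succ, shift_mul, shift_algebraMap, mul_zero, add_zero, ih, coeff_succ]

/-- The power series of the Taylor coefficients. -/
def series (f : O) : PowerSeries ℂ := PowerSeries.mk fun n => T.coeff n f

theorem series_eq (f : O) :
    T.series f = PowerSeries.C (T.value f) + PowerSeries.X * T.series (T.shift f) := by
  ext n
  cases n with
  | zero => simp [series, coeff_zero]
  | succ n => simp [series, coeff_succ]

theorem coeff_mul (n : ℕ) (f g : O) :
    T.coeff n (f * g) = PowerSeries.coeff n (T.series f * T.series g) := by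
  induction n generalizing f g with
  | zero => simp [series, coeff_zero]
  | succ n ih =>
    have h : PowerSeries.coeff (n + 1) (T.series f * T.series g) =
        T.value g * T.coeff (n + 1) f + PowerSeries.coeff n
          (T.series f * T.series (T.shift g)) := by
      conv_lhs => rw [T.series_eq g, mul_add, map_add, mul_comm _ (PowerSeries.C _), mul_left_comm]
      rw [PowerSeries.coeff_C_mul, PowerSeries.coeff_succ_X_mul, series, PowerSeries.coeff_mk]
    rw [h, coeff_succ, shift_mul, coeff_add, ih, coeff_algebraMap_mul, coeff_succ, add_comm]

/-- Taylor expansion in powers of the parameter, as a homomorphism to `ℂ⟦X⟧`. -/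
def taylor : O →ₐ[ℂ] PowerSeries ℂ where
  toFun := T.series
  map_one' := by
    rw [← map_one (algebraMap ℂ O), series_eq, shift_algebraMap, AlgHom.commutes]
    ext n
    cases n <;> simp [series, coeff_succ_zero]
  map_mul' f g := by
    ext n
    rw [← coeff_mul, series, PowerSeries.coeff_mk]
  map_zero' := by
    ext n
    simp [series, coeff_succ_zero]
  map_add' f g := by
    ext n
    simp [series, coeff_add]
  commutes' c := by
    rw [series_eq, shift_algebraMap, AlgHom.commutes]
    ext n
    cases n <;> simp [series, coeff_succ_zero]

theorem taylor_eq (f : O) :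
    T.taylor f = PowerSeries.C (T.value f) + PowerSeries.X * T.taylor (T.shift f) :=
  T.series_eq f

theorem constantCoeff_taylor (f : O) : PowerSeries.constantCoeff (T.taylor f) = T.value f := by
  rw [taylor_eq]
  simp

theorem taylor_param : T.taylor T.param = PowerSeries.X := by
  have h : T.shift T.param = 1 := T.shift_eq (c := 0) (by simp)
  rw [taylor_eq, value_param, h, map_one]
  simp

theorem param_pow_dvd_iff (n : ℕ) (f : O) : T.param ^ n ∣ f ↔ PowerSeries.X ^ n ∣ T.taylor f := by
  constructor
  · rintro ⟨g, rfl⟩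
    rw [map_mul, map_pow, taylor_param]
    exact dvd_mul_right _ _
  · intro h
    induction n generalizing f with
    | zero => exact (pow_zero T.param).symm ▸ one_dvd f
    | succ n ih =>
      have h0 : T.value f = 0 := by
        rw [← constantCoeff_taylor, ← PowerSeries.X_dvd_iff]
        exact (dvd_pow_self _ (Nat.succ_ne_zero n)).trans h
      have hf := T.eq_add_shift f
      rw [h0, map_zero, zero_add] at hf
      rw [hf, map_mul, taylor_param, pow_succ', mul_dvd_mul_iff_left PowerSeries.X_ne_zero] at h
      rw [hf, pow_succ']
      exact mul_dvd_mul_left _ (ih _ h)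

/-- Every power series is approximated by Taylor series. -/
theorem exists_X_pow_dvd_taylor_sub (n : ℕ) (h : PowerSeries ℂ) :
    ∃ f : O, PowerSeries.X ^ n ∣ T.taylor f - h := by
  refine ⟨aeval T.param (PowerSeries.trunc n h), ?_⟩
  have h1 : T.taylor (aeval T.param (PowerSeries.trunc n h)) =
    (PowerSeries.trunc n h : PowerSeries ℂ) := by
    have h2 : aeval (PowerSeries.X : PowerSeries ℂ) =
      Polynomial.coeToPowerSeries.algHom (R := ℂ) ℂ :=
      Polynomial.algHom_ext (by
        rw [aeval_X, Polynomial.coeToPowerSeries.algHom_apply]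
        simp)
    rw [← aeval_algHom_apply, taylor_param, h2, Polynomial.coeToPowerSeries.algHom_apply]
    simp
  rw [h1, PowerSeries.X_pow_dvd_iff]
  intro m hm
  rw [map_sub, Polynomial.coeff_coe, PowerSeries.coeff_trunc, if_pos hm, sub_self]

end TaylorData

end Taylor

/-! ### Homomorphisms from a completion to power series -/

section Completion

variable {R : Type} [CommRing R] [IsLocalRing R] [Algebra ℂ R] {Φ : R →ₐ[ℂ] PowerSeries ℂ}
  (hΦ : ∀ r ∈ IsLocalRing.maximalIdeal R, PowerSeries.X ∣ Φ r)

include hΦ in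
theorem X_pow_dvd_of_mem_maximalIdeal_pow {n : ℕ} {r : R}
    (hr : r ∈ IsLocalRing.maximalIdeal R ^ n) :
    PowerSeries.X ^ n ∣ Φ r := by
  have h : (IsLocalRing.maximalIdeal R).map Φ ≤ Ideal.span {PowerSeries.X} := by
    rw [Ideal.map_le_iff_le_comap]
    exact fun r hr => Ideal.mem_span_singleton.2 (hΦ r hr)
  have h1 := Ideal.pow_right_mono h n
  rw [← Ideal.map_pow, Ideal.span_singleton_pow] at h1
  exact Ideal.mem_span_singleton.1 (h1 (Ideal.mem_map_of_mem Φ hr))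

/-- The homomorphisms `R^ → R / m ^ n → ℂ⟦X⟧ / X ^ n` induced by `R → ℂ⟦X⟧`. -/
def completionLiftAux (n : ℕ) : AdicCompletion (IsLocalRing.maximalIdeal R) R →ₐ[ℂ]
    PowerSeries ℂ ⧸ Ideal.span {(PowerSeries.X : PowerSeries ℂ)} ^ n :=
  (Ideal.quotientMapₐ (Ideal.span {PowerSeries.X} ^ n) Φ (I := IsLocalRing.maximalIdeal R ^ n)
    fun r hr => by
      rw [Ideal.mem_comap, Ideal.span_singleton_pow, Ideal.mem_span_singleton]
      exact X_pow_dvd_of_mem_maximalIdeal_pow hΦ hr).comp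
    ((AdicCompletion.evalₐ (IsLocalRing.maximalIdeal R) n).restrictScalars ℂ)

theorem factor_comp_completionLiftAux {m n : ℕ} (hmn : m ≤ n) :
    (Ideal.Quotient.factorₐ ℂ (Ideal.pow_le_pow_right hmn)).comp (completionLiftAux hΦ n) =
      completionLiftAux hΦ m := by
  ext x
  obtain ⟨a, rfl⟩ := AdicCompletion.mk_surjective _ _ x
  have h := AdicCompletion.Ideal.mk_eq_mk (IsLocalRing.maximalIdeal R) hmn a
  rw [Ideal.Quotient.eq] at h
  have h1 := X_pow_dvd_of_mem_maximalIdeal_pow hΦ h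
  simp only [completionLiftAux, AlgHom.comp_apply, AlgHom.restrictScalars_apply,
    AdicCompletion.evalₐ_mk]
  change Ideal.Quotient.mk _ _ = Ideal.Quotient.mk _ _
  rw [Ideal.Quotient.eq, Ideal.span_singleton_pow, Ideal.mem_span_singleton, ← map_sub]
  exact h1

/-- The extension of a local homomorphism `R → ℂ⟦X⟧` to the completion of `R`. -/
def completionLift : AdicCompletion (IsLocalRing.maximalIdeal R) R →ₐ[ℂ] PowerSeries ℂ :=
  IsAdicComplete.liftAlgHom (Ideal.span {(PowerSeries.X : PowerSeries ℂ)})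
    (completionLiftAux hΦ) (factor_comp_completionLiftAux hΦ)

theorem X_pow_dvd_completionLift_sub {n : ℕ} {x : AdicCompletion (IsLocalRing.maximalIdeal R) R}
    {r : R}
    (h : AdicCompletion.evalₐ (IsLocalRing.maximalIdeal R) n x = Ideal.Quotient.mk _ r) :
    PowerSeries.X ^ n ∣ completionLift hΦ x - Φ r := by
  rw [← Ideal.mem_span_singleton, ← Ideal.span_singleton_pow, ← Ideal.Quotient.eq, completionLift,
    IsAdicComplete.mk_liftAlgHom _ _ (factor_comp_completionLiftAux hΦ)]
  simp only [completionLiftAux, AlgHom.comp_apply, AlgHom.restrictScalars_apply, h]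
  rfl

theorem completionLift_of (r : R) :
    completionLift hΦ (AdicCompletion.of _ R r) = Φ r := by
  rw [← sub_eq_zero]
  ext n
  exact PowerSeries.X_pow_dvd_iff.1 (X_pow_dvd_completionLift_sub hΦ
    (AdicCompletion.evalₐ_of _ (n + 1) r)) n (Nat.lt_succ_self n)

/-- The extension to the completion is injective if the topology of `R` is induced from `ℂ⟦X⟧`. -/
theorem completionLift_injective
    (h : ∀ n, ∃ M, ∀ r, PowerSeries.X ^ M ∣ Φ r → r ∈ IsLocalRing.maximalIdeal R ^ n) :
    Function.Injective (completionLift hΦ) := by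
  rw [injective_iff_map_eq_zero]
  intro x hx
  apply AdicCompletion.ext_evalₐ
  intro n
  obtain ⟨M, hM⟩ := h n
  obtain ⟨a, rfl⟩ := AdicCompletion.mk_surjective _ _ x
  have h1 := X_pow_dvd_completionLift_sub hΦ (AdicCompletion.evalₐ_mk _ (max M n) a)
  rw [hx, zero_sub, dvd_neg] at h1
  rw [map_zero, AdicCompletion.evalₐ_mk, ← AdicCompletion.Ideal.mk_eq_mk _ (le_max_right M n),
    Ideal.Quotient.eq_zero_iff_mem]
  exact hM _ ((pow_dvd_pow _ (le_max_left _ _)).trans h1)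

/-- The image of the completion is the closure of the image of `R`. -/
theorem mem_range_completionLift
    (h : ∀ n, ∃ M, ∀ r, PowerSeries.X ^ M ∣ Φ r → r ∈ IsLocalRing.maximalIdeal R ^ n)
    (f : PowerSeries ℂ) :
    f ∈ (completionLift hΦ).range ↔ ∀ M, ∃ r, PowerSeries.X ^ M ∣ f - Φ r := by
  constructor
  · rintro ⟨x, rfl⟩ M
    obtain ⟨r, hr⟩ := Ideal.Quotient.mk_surjective
      (AdicCompletion.evalₐ (IsLocalRing.maximalIdeal R) M x)
    exact ⟨r, X_pow_dvd_completionLift_sub hΦ hr.symm⟩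
  · intro hf
    choose M hM using h
    choose r hr using hf
    -- The approximations are taken so close that they form a Cauchy sequence in `R`.
    let N : ℕ → ℕ := fun n => n + ∑ i ∈ Finset.range (n + 1), M i
    have hN : Monotone N := fun i j hij => add_le_add hij
      (Finset.sum_le_sum_of_subset (Finset.range_mono (by omega)))
    have hMN : ∀ n, M n ≤ N n := fun n => (Finset.single_le_sum (f := M) (fun _ _ => zero_le)
      (Finset.self_mem_range_succ n)).trans (Nat.le_add_left _ _)
    let a : AdicCompletion.AdicCauchySequence (IsLocalRing.maximalIdeal R) R :=
      AdicCompletion.AdicCauchySequence.mk _ _ (fun n => r (N n)) fun n => by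
        rw [SModEq.sub_mem, smul_eq_mul, Ideal.mul_top]
        refine hM n _ ((pow_dvd_pow _ (hMN n)).trans ?_)
        have h1 := dvd_sub ((pow_dvd_pow _ (hN n.le_succ)).trans (hr (N (n + 1)))) (hr (N n))
        rwa [sub_sub_sub_cancel_left, ← map_sub] at h1
    refine ⟨AdicCompletion.mk _ _ a, ?_⟩
    ext n
    have h1 := X_pow_dvd_completionLift_sub hΦ (AdicCompletion.evalₐ_mk _ (n + 1) a)
    have h2 := (pow_dvd_pow PowerSeries.X (Nat.le_add_right (n + 1) _)).trans (hr (N (n + 1)))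
    have h3 := dvd_sub h1 h2
    change _ ∣ _ - Φ (r (N (n + 1))) - (f - Φ (r (N (n + 1)))) at h3
    rw [sub_sub_sub_cancel_right] at h3
    have h4 := PowerSeries.X_pow_dvd_iff.1 h3 n (Nat.lt_succ_self n)
    rwa [map_sub, sub_eq_zero] at h4

end Completion

/-! ### Points of quadratic covers and their branches -/

section QuadraticGerm

variable {O : Type} [CommRing O] [IsDomain O] [Algebra ℂ O]

/-- A `ℂ`-valued point of the quadratic cover `a Y ^ 2 + b Y + c = 0` of the germ of a curve with
local ring `O`. The point is the homomorphism `pt` to `ℂ`; its kernel is the field `ideal`, so that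
the localization at a given ideal is the local ring `Local` definitionally. For the same reason the
equation `poly` is given along with its coefficients. -/
structure QuadraticGerm (O : Type) [CommRing O] [IsDomain O] [Algebra ℂ O]
    extends TaylorData O where
  poly : O[X]
  a : O
  b : O
  c : O
  poly_eq : poly = C a * X ^ 2 + C b * X + C c
  primitive : ¬ (value a = 0 ∧ value b = 0 ∧ value c = 0)
  pt : AdjoinRoot poly →ₐ[ℂ] ℂ
  pt_of : ∀ f : O, pt (AdjoinRoot.of _ f) = value f
  ideal : Ideal (AdjoinRoot poly)
  isPrime : ideal.IsPrime
  mem_ideal_iff : ∀ z, z ∈ ideal ↔ pt z = 0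

namespace QuadraticGerm

variable (G : QuadraticGerm O)

/-- The coordinate ring `O[Y] / (a Y ^ 2 + b Y + c)`. -/
abbrev Chart : Type := AdjoinRoot G.poly

instance : G.ideal.IsPrime := G.isPrime

/-- The local ring of the cover at the point. -/
abbrev Local : Type := Localization.AtPrime G.ideal

/-- The discriminant. -/
def disc : O := G.b ^ 2 - 4 * G.a * G.c

/-- The fibre coordinate. -/
def Y : G.Chart := AdjoinRoot.root _

/-- The function `2 a Y + b`, a square root of the discriminant. -/
def sqrtDisc : G.Chart := 2 * AdjoinRoot.of _ G.a * G.Y + AdjoinRoot.of _ G.b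

theorem equation :
    AdjoinRoot.of _ G.a * G.Y ^ 2 + AdjoinRoot.of _ G.b * G.Y + AdjoinRoot.of _ G.c = 0 := by
  have h := AdjoinRoot.eval₂_root G.poly
  conv at h =>
    enter [1, 3]
    rw [G.poly_eq]
  simpa [Y] using h

theorem sqrtDisc_sq : G.sqrtDisc ^ 2 = AdjoinRoot.of _ G.disc := by
  have := G.equation
  rw [sqrtDisc, disc, map_sub, map_mul, map_mul, map_pow, map_ofNat]
  linear_combination 4 * AdjoinRoot.of _ G.a * this

theorem pt_equation :
    G.value G.a * G.pt G.Y ^ 2 + G.value G.b * G.pt G.Y + G.value G.c = 0 := by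
  have := congrArg G.pt G.equation
  simpa only [map_add, map_mul, map_pow, pt_of, map_zero] using this

theorem pt_sqrtDisc : G.pt G.sqrtDisc = 2 * G.value G.a * G.pt G.Y + G.value G.b := by
  rw [sqrtDisc, map_add, map_mul, map_mul, pt_of, pt_of, map_ofNat]

theorem pt_sqrtDisc_sq : G.pt G.sqrtDisc ^ 2 = G.value G.disc := by
  rw [← map_pow, sqrtDisc_sq, pt_of]

/-- A branch of the cover through the point, parametrised by `τ`: a homomorphism `θ` from `O` to
`ℂ⟦τ⟧` and a root `ρ` of the equation with the right constant term. -/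
structure Branch where
  θ : O →ₐ[ℂ] PowerSeries ℂ
  ρ : PowerSeries ℂ
  root : θ G.a * ρ ^ 2 + θ G.b * ρ + θ G.c = 0
  constantCoeff_θ : ∀ f, PowerSeries.constantCoeff (θ f) = G.value f
  constantCoeff_ρ : PowerSeries.constantCoeff ρ = G.pt G.Y

namespace Branch

variable {G} (B : G.Branch)

/-- The homomorphism from the coordinate ring to `ℂ⟦τ⟧` given by a branch. -/
def chartHom : G.Chart →+* PowerSeries ℂ :=
  AdjoinRoot.lift B.θ.toRingHom B.ρ (by
    rw [G.poly_eq]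
    simpa [eval₂_add, eval₂_mul] using B.root)

theorem chartHom_of (f : O) : B.chartHom (AdjoinRoot.of _ f) = B.θ f := AdjoinRoot.lift_of _

theorem chartHom_Y : B.chartHom G.Y = B.ρ := AdjoinRoot.lift_root _

theorem constantCoeff_chartHom (z : G.Chart) :
    PowerSeries.constantCoeff (B.chartHom z) = G.pt z := by
  have h : PowerSeries.constantCoeff.comp B.chartHom = G.pt.toRingHom := by
    apply AdjoinRoot.ringHom_ext
    · ext f
      exact (congrArg _ (B.chartHom_of f)).trans ((B.constantCoeff_θ f).trans (G.pt_of f).symm)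
    · exact (congrArg _ B.chartHom_Y).trans B.constantCoeff_ρ
  exact congrArg (fun φ => φ z) h

/-- The homomorphism from the local ring to `ℂ⟦τ⟧` given by a branch. -/
def hom : G.Local →ₐ[ℂ] PowerSeries ℂ where
  toRingHom := IsLocalization.lift (M := G.ideal.primeCompl) (g := B.chartHom) fun z => by
    rw [PowerSeries.isUnit_iff_constantCoeff, constantCoeff_chartHom, isUnit_iff_ne_zero]
    exact fun h => z.2 ((G.mem_ideal_iff z).2 h)
  commutes' c := by
    have h : algebraMap ℂ G.Local c =
      algebraMap G.Chart G.Local (AdjoinRoot.of _ (algebraMap ℂ O c)) := by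
      rw [IsScalarTower.algebraMap_apply ℂ G.Chart G.Local]
      rfl
    rw [h]
    exact (IsLocalization.lift_eq _ _).trans ((B.chartHom_of _).trans (B.θ.commutes c))

theorem hom_algebraMap (z : G.Chart) : B.hom (algebraMap G.Chart G.Local z) = B.chartHom z :=
  IsLocalization.lift_eq _ _

theorem X_dvd_hom (r : G.Local) (hr : r ∈ IsLocalRing.maximalIdeal G.Local) :
    PowerSeries.X ∣ B.hom r := by
  obtain ⟨z, s, rfl⟩ := IsLocalization.exists_mk'_eq G.ideal.primeCompl r
  rw [IsLocalization.AtPrime.mk'_mem_maximal_iff _ G.ideal, mem_ideal_iff] at hr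
  rw [IsLocalization.mk'_eq_mul_mk'_one, map_mul, hom_algebraMap]
  refine Dvd.dvd.mul_right ?_ _
  rw [PowerSeries.X_dvd_iff, constantCoeff_chartHom, hr]

/-- The homomorphism from the completed local ring to `ℂ⟦τ⟧` given by a branch. -/
def completedHom : AdicCompletion (IsLocalRing.maximalIdeal G.Local) G.Local →ₐ[ℂ] PowerSeries ℂ :=
  completionLift B.X_dvd_hom

end Branch

/-- If the discriminant has even order at the base point, there is a branch of the cover through the
point along which the base is parametrised by its local parameter. -/
theorem exists_branch_of_even {k : ℕ} {u : O} (hu : IsUnit u) (h : G.disc = G.param ^ (2 * k) * u) :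
    ∃ B : G.Branch, B.θ G.param = PowerSeries.X := by
  obtain ⟨v, hv, hv0⟩ : ∃ v : PowerSeries ℂ, v ^ 2 = G.taylor G.disc ∧
      PowerSeries.constantCoeff v = G.pt G.sqrtDisc := by
    have hu0 : PowerSeries.constantCoeff (G.taylor u) ≠ 0 := by
      rw [← isUnit_iff_ne_zero, ← PowerSeries.isUnit_iff_constantCoeff]
      exact hu.map _
    obtain ⟨c, hc⟩ := IsAlgClosed.exists_pow_nat_eq (PowerSeries.constantCoeff (G.taylor u)) two_pos
    obtain ⟨w, hw, -⟩ := PowerSeries.exists_sq_eq (G.taylor u) (c := c)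
      (by rintro rfl; exact hu0 (by rw [← hc]; simp)) hc
    have h1 : (PowerSeries.X ^ k * w) ^ 2 = G.taylor G.disc := by
      rw [h, mul_pow, hw, map_mul, map_pow, TaylorData.taylor_param, ← pow_mul, mul_comm k]
    -- The sign of the square root is chosen to match the value at the given point.
    have h2 : PowerSeries.constantCoeff (PowerSeries.X ^ k * w) ^ 2 = G.pt G.sqrtDisc ^ 2 := by
      rw [pt_sqrtDisc_sq, ← TaylorData.constantCoeff_taylor, ← h1, map_pow]
    rcases sq_eq_sq_iff_eq_or_eq_neg.1 h2 with h3 | h3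
    · exact ⟨_, h1, h3⟩
    · exact ⟨-(PowerSeries.X ^ k * w), by rw [neg_sq, h1], by rw [map_neg, h3, neg_neg]⟩
  have hv' : v ^ 2 = G.taylor G.b ^ 2 - 4 * G.taylor G.a * G.taylor G.c := by
    rw [hv, disc, map_sub, map_mul, map_mul, map_pow, map_ofNat]
  rw [pt_sqrtDisc] at hv0
  have hpt := G.pt_equation
  -- The root is `(v - b) / 2a`, or `-2c / (v + b)` if `a` vanishes at the base point.
  by_cases ha : G.value G.a = 0
  · have hb : G.value G.b ≠ 0 := by
      intro hb
      rw [ha, hb] at hpt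
      exact G.primitive ⟨ha, hb, by simpa using hpt⟩
    have hE : PowerSeries.constantCoeff (G.taylor G.b + v) = 2 * G.value G.b := by
      rw [map_add, TaylorData.constantCoeff_taylor, hv0, ha]
      ring
    obtain ⟨e, he⟩ := isUnit_iff_exists_inv.1 ((PowerSeries.isUnit_iff_constantCoeff
      (φ := G.taylor G.b + v)).2 (by rw [hE, isUnit_iff_ne_zero]; exact mul_ne_zero two_ne_zero hb))
    refine ⟨⟨G.taylor, -2 * G.taylor G.c * e, ?_, G.constantCoeff_taylor, ?_⟩, G.taylor_param⟩
    · linear_combination (G.taylor G.c * e ^ 2) * hv' +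
        (-G.taylor G.c - G.taylor G.c * e * (G.taylor G.b + v) +
          2 * G.taylor G.b * G.taylor G.c * e) * he
    · have h1 := congrArg PowerSeries.constantCoeff he
      rw [map_mul, hE, map_one] at h1
      rw [map_mul, map_mul, map_neg, map_ofNat, TaylorData.constantCoeff_taylor]
      rw [ha] at hpt
      apply mul_left_cancel₀ (mul_ne_zero two_ne_zero hb)
      linear_combination (-2 * G.value G.c) * h1 - 2 * hpt
  · obtain ⟨e, he⟩ := isUnit_iff_exists_inv.1 ((PowerSeries.isUnit_iff_constantCoeff
      (φ := 2 * G.taylor G.a)).2 (by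
        rw [map_mul, map_ofNat, TaylorData.constantCoeff_taylor, isUnit_iff_ne_zero]
        exact mul_ne_zero two_ne_zero ha))
    refine ⟨⟨G.taylor, (v - G.taylor G.b) * e, ?_, G.constantCoeff_taylor, ?_⟩, G.taylor_param⟩
    · have h4 : (2 * G.taylor G.a) ≠ 0 := fun h0 => by simp [h0] at he
      have h2 : (2 : PowerSeries ℂ) ≠ 0 := fun h0 => by simp [h0] at he
      apply mul_left_cancel₀ (mul_ne_zero h2 h4)
      linear_combination ((v - G.taylor G.b) ^ 2 * (2 * G.taylor G.a * e + 1) +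
        2 * G.taylor G.b * (v - G.taylor G.b)) * he + hv'
    · have h1 := congrArg PowerSeries.constantCoeff he
      rw [map_mul, map_mul, map_ofNat, TaylorData.constantCoeff_taylor, map_one] at h1
      rw [map_mul, map_sub, hv0, TaylorData.constantCoeff_taylor]
      linear_combination G.pt G.Y * h1

/-- A branch parametrised by the local parameter of the base is not ramified. -/
theorem algebraMap_param_notMem_of_branch {B : G.Branch} (hB : B.θ G.param = PowerSeries.X) :
    algebraMap G.Chart G.Local (AdjoinRoot.of _ G.param) ∉
      IsLocalRing.maximalIdeal G.Local ^ 2 := by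
  intro h
  have h1 := X_pow_dvd_of_mem_maximalIdeal_pow B.X_dvd_hom h
  rw [B.hom_algebraMap, B.chartHom_of, hB] at h1
  have h2 := PowerSeries.X_pow_dvd_iff.1 h1 1 one_lt_two
  simp at h2

/-- A branch parametrised by the local parameter of the base excludes a cusp, as on a cusp no
function restricts to a uniformizer of a branch. -/
theorem isEmpty_algEquiv_cuspRing_of_branch {B : G.Branch} (hB : B.θ G.param = PowerSeries.X)
    {m : ℕ}
    (hm : 1 ≤ m) : IsEmpty (AdicCompletion (IsLocalRing.maximalIdeal G.Local) G.Local ≃ₐ[ℂ]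
      NonsingularCurve.CuspRing m) := by
  refine ⟨fun e => ?_⟩
  have h := NonsingularCurve.CuspRing.coeff_one_algHom_eq_zero hm
    (B.completedHom.comp e.symm.toAlgHom)
    (e (AdicCompletion.of _ _ (algebraMap G.Chart G.Local (AdjoinRoot.of _ G.param))))
  have h1 : (B.completedHom.comp e.symm.toAlgHom)
      (e (AdicCompletion.of _ _ (algebraMap G.Chart G.Local (AdjoinRoot.of _ G.param)))) =
      PowerSeries.X := by
    change B.completedHom (e.symm (e _)) = _
    rw [AlgEquiv.symm_apply_apply, Branch.completedHom, completionLift_of, B.hom_algebraMap,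
      B.chartHom_of, hB]
  rw [h1] at h
  simp at h

end QuadraticGerm

end QuadraticGerm

/-! ### Quadratic covers with discriminant of odd order -/

namespace QuadraticGerm

variable {O : Type} [CommRing O] [IsDomain O] [Algebra ℂ O] (G : QuadraticGerm O)

/-- If `a` is a unit, the square root of the discriminant generates the coordinate ring. -/
theorem exists_eq_of_add_of_mul_sqrtDisc (ha : G.value G.a ≠ 0) (z : G.Chart) :
    ∃ f g : O, z = AdjoinRoot.of _ f + AdjoinRoot.of _ g * G.sqrtDisc := by
  obtain ⟨e, he⟩ := isUnit_iff_exists_inv.1 (G.isUnit_of_value_ne_zero (2 * G.a) (by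
    rw [map_mul, map_ofNat]
    exact mul_ne_zero two_ne_zero ha))
  have hY : G.Y = AdjoinRoot.of _ (-e * G.b) + AdjoinRoot.of _ e * G.sqrtDisc := by
    have h := congrArg (AdjoinRoot.of G.poly) he
    rw [map_mul, map_mul, map_ofNat, map_one] at h
    rw [sqrtDisc, map_mul, map_neg]
    linear_combination (-G.Y) * h
  have hmul : ∀ z w : G.Chart, (∃ f g : O, z = AdjoinRoot.of _ f + AdjoinRoot.of _ g * G.sqrtDisc) →
      (∃ f g : O, w = AdjoinRoot.of _ f + AdjoinRoot.of _ g * G.sqrtDisc) →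
      ∃ f g : O, z * w = AdjoinRoot.of _ f + AdjoinRoot.of _ g * G.sqrtDisc := by
    rintro _ _ ⟨f, g, rfl⟩ ⟨f', g', rfl⟩
    refine ⟨f * f' + g * g' * G.disc, f * g' + f' * g, ?_⟩
    simp only [map_add, map_mul, ← sqrtDisc_sq]
    ring
  induction z using AdjoinRoot.induction_on with
  | ih p =>
    induction p using Polynomial.induction_on' with
    | add p q hp hq =>
      obtain ⟨f, g, h⟩ := hp
      obtain ⟨f', g', h'⟩ := hq
      exact ⟨f + f', g + g', by rw [map_add, h, h', map_add, map_add]; ring⟩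
    | monomial n c =>
      rw [← Polynomial.C_mul_X_pow_eq_monomial, map_mul, map_pow]
      refine hmul _ _ ⟨c, 0, by simp⟩ ?_
      induction n with
      | zero => exact ⟨1, 0, by simp⟩
      | succ n ih =>
        rw [pow_succ]
        exact hmul _ _ ih ⟨_, _, hY⟩

variable {G} in
theorem pt_sqrtDisc_eq_zero {N : ℕ} (hN : N ≠ 0) {u : O} (h : G.disc = G.param ^ N * u) :
    G.pt G.sqrtDisc = 0 := by
  rw [← sq_eq_zero_iff, pt_sqrtDisc_sq, h, map_mul, map_pow, TaylorData.value_param, zero_pow hN,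
    zero_mul]

section Odd

variable {G} {N : ℕ} {u : O} (ha : G.value G.a ≠ 0) (hN : Odd N) (hu : IsUnit u)
  (h : G.disc = G.param ^ N * u)

include ha hN h

/-- The coordinate ring is already local, so it is its own localization at the point. -/
theorem isUnit_of_notMem_ideal {z : G.Chart} (hz : z ∉ G.ideal) : IsUnit z := by
  obtain ⟨f, g, rfl⟩ := G.exists_eq_of_add_of_mul_sqrtDisc ha z
  rw [mem_ideal_iff, map_add, map_mul, pt_sqrtDisc_eq_zero hN.pos.ne' h, mul_zero, add_zero,
    pt_of] at hz
  have h1 : IsUnit (f ^ 2 - g ^ 2 * G.disc) := by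
    apply G.isUnit_of_value_ne_zero
    rw [map_sub, map_mul, ← pt_sqrtDisc_sq, pt_sqrtDisc_eq_zero hN.pos.ne' h]
    simpa using hz
  refine isUnit_of_mul_isUnit_left (y := AdjoinRoot.of _ f - AdjoinRoot.of _ g * G.sqrtDisc) ?_
  convert! h1.map (AdjoinRoot.of G.poly)
  rw [map_sub, map_mul, map_pow, map_pow, ← sqrtDisc_sq]
  ring

theorem exists_local_eq (r : G.Local) : ∃ f g : O,
    r = algebraMap G.Chart G.Local (AdjoinRoot.of _ f + AdjoinRoot.of _ g * G.sqrtDisc) := by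
  obtain ⟨z, s, rfl⟩ := IsLocalization.exists_mk'_eq G.ideal.primeCompl r
  obtain ⟨t, ht⟩ := isUnit_iff_exists_inv.1 (isUnit_of_notMem_ideal ha hN h s.2)
  obtain ⟨f, g, hfg⟩ := G.exists_eq_of_add_of_mul_sqrtDisc ha (z * t)
  refine ⟨f, g, ?_⟩
  rw [← hfg, IsLocalization.mk'_eq_iff_eq_mul, ← map_mul, mul_assoc, mul_comm t, ht, mul_one]

include hu in
/-- If the discriminant has odd order `N` and the leading coefficient is a unit, the only branch at
the point is parametrised by a square root `τ` of the local parameter. -/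
theorem exists_branch_of_odd : ∃ (B : G.Branch) (w : PowerSeries ℂ),
    (∀ f, B.θ f = PowerSeries.expand 2 two_ne_zero (G.taylor f)) ∧ IsUnit w ∧
    B.chartHom G.sqrtDisc = PowerSeries.X ^ N * PowerSeries.expand 2 two_ne_zero w := by
  have hu0 : PowerSeries.constantCoeff (G.taylor u) ≠ 0 := by
    rw [← isUnit_iff_ne_zero, ← PowerSeries.isUnit_iff_constantCoeff]
    exact hu.map _
  obtain ⟨c, hc⟩ := IsAlgClosed.exists_pow_nat_eq (PowerSeries.constantCoeff (G.taylor u)) two_pos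
  have hc0 : c ≠ 0 := by
    rintro rfl
    exact hu0 (by rw [← hc]; simp)
  obtain ⟨w, hw, hwc⟩ := PowerSeries.exists_sq_eq (G.taylor u) hc0 hc
  let θ : O →ₐ[ℂ] PowerSeries ℂ := (PowerSeries.expand 2 two_ne_zero).comp G.taylor
  have hθ : ∀ f, PowerSeries.constantCoeff (θ f) = G.value f := fun f =>
    (PowerSeries.constantCoeff_expand 2 two_ne_zero _).trans (G.constantCoeff_taylor f)
  set v : PowerSeries ℂ := PowerSeries.X ^ N * PowerSeries.expand 2 two_ne_zero w with hvdef
  have hv : v ^ 2 = θ G.b ^ 2 - 4 * θ G.a * θ G.c := by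
    have h1 : θ G.disc = θ G.b ^ 2 - 4 * θ G.a * θ G.c := by
      rw [disc, map_sub, map_mul, map_mul, map_pow, map_ofNat]
    rw [← h1, h, map_mul, map_pow]
    change _ = (PowerSeries.expand 2 two_ne_zero (G.taylor G.param)) ^ N *
      PowerSeries.expand 2 two_ne_zero (G.taylor u)
    rw [TaylorData.taylor_param, PowerSeries.expand_X, ← hw, map_pow, hvdef, mul_pow, ← pow_mul,
      ← pow_mul, mul_comm 2]
  have hv0 : PowerSeries.constantCoeff v = 0 := by
    rw [hvdef, map_mul, map_pow, PowerSeries.constantCoeff_X, zero_pow hN.pos.ne', zero_mul]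
  obtain ⟨e, he⟩ := isUnit_iff_exists_inv.1 ((PowerSeries.isUnit_iff_constantCoeff
    (φ := 2 * θ G.a)).2 (by
      rw [map_mul, map_ofNat, hθ, isUnit_iff_ne_zero]
      exact mul_ne_zero two_ne_zero ha))
  have h2 : (2 : PowerSeries ℂ) ≠ 0 := fun h0 => by simp [h0] at he
  have h4 : (2 * θ G.a) ≠ 0 := fun h0 => by simp [h0] at he
  let B : G.Branch := ⟨θ, (v - θ G.b) * e, by
    apply mul_left_cancel₀ (mul_ne_zero h2 h4)
    linear_combination ((v - θ G.b) ^ 2 * (2 * θ G.a * e + 1) + 2 * θ G.b * (v - θ G.b)) * he + hv,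
    hθ, by
    have h1 := congrArg PowerSeries.constantCoeff he
    have h5 := pt_sqrtDisc_eq_zero hN.pos.ne' h
    rw [pt_sqrtDisc] at h5
    rw [map_mul, map_mul, map_ofNat, hθ, map_one] at h1
    rw [map_mul, map_sub, hv0, hθ]
    linear_combination G.pt G.Y * h1 - PowerSeries.constantCoeff e * h5⟩
  refine ⟨B, w, fun f => rfl, ?_, ?_⟩
  · rw [PowerSeries.isUnit_iff_constantCoeff, hwc]
    exact hc0.isUnit
  · rw [sqrtDisc, map_add, map_mul, map_mul, map_ofNat, B.chartHom_of, B.chartHom_of, B.chartHom_Y]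
    change 2 * θ G.a * ((v - θ G.b) * e) + θ G.b = v
    linear_combination (v - θ G.b) * he

variable {B : G.Branch} {w : PowerSeries ℂ}
  (hθ : ∀ f, B.θ f = PowerSeries.expand 2 two_ne_zero (G.taylor f)) (hw : IsUnit w)
  (hB : B.chartHom G.sqrtDisc = PowerSeries.X ^ N * PowerSeries.expand 2 two_ne_zero w)

omit ha hN h in
include hθ hB in
theorem hom_of_add (f g : O) :
    B.hom (algebraMap G.Chart G.Local (AdjoinRoot.of _ f + AdjoinRoot.of _ g * G.sqrtDisc)) =
      PowerSeries.expand 2 two_ne_zero (G.taylor f) +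
        PowerSeries.X ^ N * PowerSeries.expand 2 two_ne_zero (w * G.taylor g) := by
  rw [B.hom_algebraMap, map_add, map_mul, B.chartHom_of, B.chartHom_of, hB, hθ, hθ, map_mul]
  ring

omit ha hN h in
theorem algebraMap_of_param_mem :
    algebraMap G.Chart G.Local (AdjoinRoot.of _ G.param) ∈ IsLocalRing.maximalIdeal G.Local := by
  rw [IsLocalization.AtPrime.to_map_mem_maximal_iff _ G.ideal, mem_ideal_iff, pt_of,
    TaylorData.value_param]

include hθ hw hB in
/-- The topology of the local ring is induced from `ℂ⟦τ⟧`. -/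
theorem mem_maximalIdeal_pow_of_dvd_hom {n : ℕ} {r : G.Local}
    (hr : PowerSeries.X ^ (2 * n + N) ∣ B.hom r) : r ∈ IsLocalRing.maximalIdeal G.Local ^ n := by
  obtain ⟨f, g, rfl⟩ := exists_local_eq ha hN h r
  rw [hom_of_add hθ hB] at hr
  obtain ⟨h1, h2⟩ := NonsingularCurve.CuspRing.X_pow_dvd_of_dvd_expand_add hN hr le_rfl
  rw [hw.dvd_mul_left] at h2
  rw [← TaylorData.param_pow_dvd_iff] at h1 h2
  have key : ∀ f, G.param ^ n ∣ f →
      algebraMap G.Chart G.Local (AdjoinRoot.of _ f) ∈ IsLocalRing.maximalIdeal G.Local ^ n := by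
    rintro _ ⟨f, rfl⟩
    rw [map_mul, map_mul, map_pow, map_pow]
    exact Ideal.mul_mem_right _ _ (Ideal.pow_mem_pow algebraMap_of_param_mem n)
  rw [map_add, map_mul]
  exact Ideal.add_mem _ (key f h1) (Ideal.mul_mem_right _ _ (key g h2))

include hθ hw hB in
theorem hom_injective [IsNoetherianRing O] : Function.Injective B.hom := by
  rw [injective_iff_map_eq_zero]
  intro r hr
  obtain ⟨f, g, rfl⟩ := exists_local_eq ha hN h r
  rw [hom_of_add hθ hB] at hr
  obtain ⟨h1, h2⟩ := NonsingularCurve.CuspRing.eq_zero_of_expand_add_eq_zero hN hr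
  rw [hw.mul_right_eq_zero] at h2
  have key : ∀ f, G.taylor f = 0 → f = 0 := by
    intro f hf
    by_contra hf0
    have hunit : ¬ IsUnit G.param := fun hu => by
      have := hu.map G.value
      rw [TaylorData.value_param] at this
      exact not_isUnit_zero this
    obtain ⟨n, hn⟩ := FiniteMultiplicity.of_not_isUnit hunit hf0
    exact hn ((TaylorData.param_pow_dvd_iff _ _ _).2 (hf ▸ dvd_zero _))
  rw [key f h1, key g h2]
  simp

include hθ hw hB in
theorem completedHom_injective : Function.Injective B.completedHom :=
  completionLift_injective _ fun n => ⟨2 * n + N, fun _ hr =>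
    mem_maximalIdeal_pow_of_dvd_hom ha hN h hθ hw hB hr⟩

include hθ hw hB in
/-- The image of the completed local ring consists of the power series without odd terms of degree
less than `N`. -/
theorem mem_range_completedHom (f : PowerSeries ℂ) :
    f ∈ B.completedHom.range ↔ ∃ r₀ r₁ : PowerSeries ℂ, f = PowerSeries.expand 2 two_ne_zero r₀ +
      PowerSeries.X ^ N * PowerSeries.expand 2 two_ne_zero r₁ := by
  rw [Branch.completedHom, mem_range_completionLift _ fun n => ⟨2 * n + N, fun _ hr =>
    mem_maximalIdeal_pow_of_dvd_hom ha hN h hθ hw hB hr⟩]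
  constructor
  · intro hf
    have hodd : ∀ j, Odd j → j < N → PowerSeries.coeff j f = 0 := by
      intro j hj hjN
      obtain ⟨r, hr⟩ := hf N
      obtain ⟨f', g, rfl⟩ := exists_local_eq ha hN h r
      rw [hom_of_add hθ hB, PowerSeries.X_pow_dvd_iff] at hr
      have h1 := hr j hjN
      rw [map_sub, map_add, NonsingularCurve.CuspRing.coeff_expand_odd _ hj,
        PowerSeries.coeff_X_pow_mul', if_neg hjN.not_ge, add_zero, sub_zero] at h1
      exact h1
    refine ⟨PowerSeries.mk fun i => PowerSeries.coeff (2 * i) f,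
      PowerSeries.mk fun i => PowerSeries.coeff (2 * i + N) f, ?_⟩
    ext j
    rw [map_add]
    rcases Nat.even_or_odd j with hj | hj
    · rw [NonsingularCurve.CuspRing.coeff_X_pow_mul_expand_even hN _ hj]
      obtain ⟨i, rfl⟩ := even_iff_two_dvd.1 hj
      rw [NonsingularCurve.CuspRing.coeff_expand_even, PowerSeries.coeff_mk, add_zero]
    · rw [NonsingularCurve.CuspRing.coeff_expand_odd _ hj, zero_add]
      rcases lt_or_ge j N with hjN | hjN
      · rw [hodd j hj hjN, PowerSeries.coeff_X_pow_mul', if_neg hjN.not_ge]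
      · obtain ⟨i, hi⟩ := even_iff_two_dvd.1 (Nat.Odd.sub_odd hj hN)
        obtain rfl : j = 2 * i + N := by omega
        rw [PowerSeries.coeff_X_pow_mul, NonsingularCurve.CuspRing.coeff_expand_even,
          PowerSeries.coeff_mk]
  · rintro ⟨r₀, r₁, rfl⟩ M
    obtain ⟨e, he⟩ := isUnit_iff_exists_inv.1 hw
    obtain ⟨f, q, hf⟩ := G.exists_X_pow_dvd_taylor_sub M r₀
    obtain ⟨g, q', hg⟩ := G.exists_X_pow_dvd_taylor_sub M (e * r₁)
    refine ⟨algebraMap G.Chart G.Local (AdjoinRoot.of _ f + AdjoinRoot.of _ g * G.sqrtDisc), ?_⟩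
    rw [hom_of_add hθ hB]
    have hf' : G.taylor f = r₀ + PowerSeries.X ^ M * q := by rw [← hf]; ring
    have hg' : w * G.taylor g = r₁ + PowerSeries.X ^ M * (w * q') := by
      linear_combination w * hg + r₁ * he
    rw [hf', hg', map_add, map_add, map_mul, map_mul, map_pow, PowerSeries.expand_X]
    refine ⟨-(PowerSeries.X ^ M * PowerSeries.expand 2 two_ne_zero q +
      PowerSeries.X ^ N * (PowerSeries.X ^ M * PowerSeries.expand 2 two_ne_zero (w * q'))), ?_⟩
    ring

end Odd

/-- If the discriminant has odd order `2m + 1` and the leading coefficient is a unit, the completed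
local ring of the cover is that of the cusp `t ^ 2 = s ^ (2m + 1)`: both are the ring of power
series in `τ` without odd terms of degree less than `2m + 1`. -/
theorem nonempty_algEquiv_cuspRing {m : ℕ} {u : O} (ha : G.value G.a ≠ 0) (hu : IsUnit u)
    (h : G.disc = G.param ^ (2 * m + 1) * u) :
    Nonempty (AdicCompletion (IsLocalRing.maximalIdeal G.Local) G.Local ≃ₐ[ℂ]
      NonsingularCurve.CuspRing m) := by
  have hN : Odd (2 * m + 1) := ⟨m, rfl⟩
  obtain ⟨B, w, hθ, hw, hB⟩ := exists_branch_of_odd ha hN hu h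
  have hrange : B.completedHom.range = (NonsingularCurve.CuspRing.toPowerSeries m).range := by
    ext f
    rw [mem_range_completedHom ha hN h hθ hw hB, NonsingularCurve.CuspRing.mem_range_toPowerSeries]
  exact ⟨(AlgEquiv.ofInjective _ (completedHom_injective ha hN h hθ hw hB)).trans
    ((Subalgebra.equivOfEq _ _ hrange).trans (AlgEquiv.ofInjective _
      (NonsingularCurve.CuspRing.toPowerSeries_injective m)).symm)⟩

/-- If the discriminant is a uniformizer, its square root is a uniformizer of the cover. -/
theorem isRegularLocalRing_of_disc [IsNoetherianRing O] {u : O} (ha : G.value G.a ≠ 0)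
    (hu : IsUnit u)
    (h : G.disc = G.param * u) : IsRegularLocalRing G.Local ∧
      algebraMap G.Chart G.Local (AdjoinRoot.of _ G.param) ∈
        IsLocalRing.maximalIdeal G.Local ^ 2 := by
  have h' : G.disc = G.param ^ 1 * u := by rw [pow_one, h]
  obtain ⟨B, w, hθ, hw, hB⟩ := exists_branch_of_odd ha odd_one hu h'
  have hinj := hom_injective ha odd_one h' hθ hw hB
  have : IsDomain G.Local := hinj.isDomain B.hom.toRingHom
  set S := algebraMap G.Chart G.Local G.sqrtDisc with hS
  obtain ⟨e, he⟩ := isUnit_iff_exists_inv.1 hu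
  have hparam : G.param = G.disc * e := by rw [h, mul_assoc, he, mul_one]
  have hparam' : algebraMap G.Chart G.Local (AdjoinRoot.of _ G.param) =
      S ^ 2 * algebraMap G.Chart G.Local (AdjoinRoot.of _ e) := by
    rw [hparam, map_mul, ← sqrtDisc_sq, map_mul, map_pow]
  have hSm : S ∈ IsLocalRing.maximalIdeal G.Local := by
    rw [hS, IsLocalization.AtPrime.to_map_mem_maximal_iff _ G.ideal, mem_ideal_iff,
      pt_sqrtDisc_eq_zero one_ne_zero h']
  have hmax : IsLocalRing.maximalIdeal G.Local = Ideal.span {S} := by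
    apply le_antisymm
    · intro r hr
      obtain ⟨f, g, rfl⟩ := exists_local_eq ha odd_one h' r
      rw [IsLocalization.AtPrime.to_map_mem_maximal_iff _ G.ideal, mem_ideal_iff, map_add, map_mul,
        pt_sqrtDisc_eq_zero one_ne_zero h', mul_zero, add_zero, pt_of, G.value_eq_zero_iff] at hr
      obtain ⟨f, rfl⟩ := hr
      rw [map_add, map_mul, map_mul, map_mul, hparam', ← hS, Ideal.mem_span_singleton]
      exact ⟨S * algebraMap G.Chart G.Local (AdjoinRoot.of _ e) *
          algebraMap G.Chart G.Local (AdjoinRoot.of _ f) +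
        algebraMap G.Chart G.Local (AdjoinRoot.of _ g), by ring⟩
    · rw [Ideal.span_singleton_le_iff_mem]
      exact hSm
  have : IsNoetherianRing G.Local :=
    IsLocalization.isNoetherianRing G.ideal.primeCompl _ inferInstance
  have : IsPrincipalIdealRing G.Local :=
    ((tfae_of_isNoetherianRing_of_isLocalRing_of_isDomain G.Local).out 0 4).2
      (show (IsLocalRing.maximalIdeal G.Local).IsPrincipal from ⟨S, hmax⟩)
  refine ⟨inferInstance, ?_⟩
  rw [hparam']
  exact Ideal.mul_mem_right _ _ (Ideal.pow_mem_pow hSm 2)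

end QuadraticGerm

/-! ### Points of the spectral curve -/

/-- At a point where the discriminant vanishes, the leading coefficient is a unit. -/
theorem QuadraticGerm.value_a_ne_zero {O : Type} [CommRing O] [IsDomain O] [Algebra ℂ O]
    (G : QuadraticGerm O) (h : G.pt G.sqrtDisc = 0) : G.value G.a ≠ 0 := by
  intro ha
  rw [pt_sqrtDisc, ha, mul_zero, zero_mul, zero_add] at h
  have h1 := G.pt_equation
  rw [ha, h, zero_mul, zero_mul, zero_add, zero_add] at h1
  exact G.primitive ⟨ha, h, h1⟩

namespace NonsingularCurve

variable (C : NonsingularCurve)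

instance : CharZero C.K := charZero_of_injective_algebraMap (algebraMap ℂ C.K).injective

theorem algebraMap_kappa_bijective (x : C.Pt) : Function.Bijective (algebraMap ℂ (C.kappa x)) := by
  refine ⟨(algebraMap ℂ (C.kappa x)).injective, fun z => ?_⟩
  obtain ⟨f, rfl⟩ := IsLocalRing.residue_surjective z
  obtain ⟨c, hc⟩ := C.exists_sub_const_mem x f
  rw [← IsLocalRing.residue_eq_zero_iff, map_sub, sub_eq_zero] at hc
  exact ⟨c, hc.symm⟩

/-- The identification of the residue field with `ℂ`. -/
def kappaEquiv (x : C.Pt) : C.kappa x ≃ₐ[ℂ] ℂ :=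
  (AlgEquiv.ofBijective (Algebra.ofId ℂ (C.kappa x)) (C.algebraMap_kappa_bijective x)).symm

/-- The value of a function at a point. -/
def value (x : C.Pt) : C.O x →ₐ[ℂ] ℂ :=
  (C.kappaEquiv x).toAlgHom.comp (IsScalarTower.toAlgHom ℂ (C.O x) (C.kappa x))

theorem value_eq (x : C.Pt) (f : C.O x) :
    C.value x f = C.kappaEquiv x (IsLocalRing.residue (C.O x) f) := rfl

theorem value_eq_zero_iff (x : C.Pt) (f : C.O x) :
    C.value x f = 0 ↔ f ∈ IsLocalRing.maximalIdeal (C.O x) := by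
  rw [value_eq, EmbeddingLike.map_eq_zero_iff, IsLocalRing.residue_eq_zero_iff]

/-- The local parameter and the evaluation of functions at a point. -/
def taylorData (x : C.Pt) : TaylorData (C.O x) where
  param := C.param x
  param_ne_zero := (C.irreducible_param x).ne_zero
  value := C.value x
  value_eq_zero_iff f := by
    rw [value_eq_zero_iff, maximalIdeal_eq_span_param, Ideal.mem_span_singleton]
  isUnit_of_value_ne_zero f hf := by
    rwa [Ne, value_eq_zero_iff, IsLocalRing.mem_maximalIdeal, mem_nonunits_iff, not_not] at hf

variable {C} (a₁ : C.Mero1) (a₂ : C.Mero2) (x : C.Pt)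

theorem fibreEq_isPrimitive : (fibreEq a₁ a₂ x).IsPrimitive :=
  (exists_primitive x (charPoly (C.dt x) a₁ a₂) (charPoly_ne_zero _ _ _)).choose_spec.1

theorem exists_map_fibreEq : ∃ c : C.K, c ≠ 0 ∧
    (fibreEq a₁ a₂ x).map (algebraMap (C.O x) C.K) = Polynomial.C c * charPoly (C.dt x) a₁ a₂ :=
  (exists_primitive x (charPoly (C.dt x) a₁ a₂) (charPoly_ne_zero _ _ _)).choose_spec.2

theorem natDegree_fibreEq_le : (fibreEq a₁ a₂ x).natDegree ≤ 2 := by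
  obtain ⟨c, hc, h⟩ := exists_map_fibreEq a₁ a₂ x
  rw [← Polynomial.natDegree_map_eq_of_injective (IsFractionRing.injective (C.O x) C.K), h,
    charPoly]
  compute_degree

theorem fibreEq_eq : fibreEq a₁ a₂ x = Polynomial.C ((fibreEq a₁ a₂ x).coeff 2) * X ^ 2 +
    Polynomial.C ((fibreEq a₁ a₂ x).coeff 1) * X + Polynomial.C ((fibreEq a₁ a₂ x).coeff 0) := by
  refine (Polynomial.as_sum_range_C_mul_X_pow' (fibreEq a₁ a₂ x)
    (Nat.lt_succ_of_le (natDegree_fibreEq_le a₁ a₂ x))).trans ?_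
  simp [Finset.sum_range_succ]
  ring

theorem reflect_fibreEq_eq : (fibreEq a₁ a₂ x).reflect 2 =
    Polynomial.C ((fibreEq a₁ a₂ x).coeff 0) * X ^ 2 +
    Polynomial.C ((fibreEq a₁ a₂ x).coeff 1) * X + Polynomial.C ((fibreEq a₁ a₂ x).coeff 2) := by
  conv_lhs => rw [fibreEq_eq]
  rw [reflect_add, reflect_add, reflect_C_mul_X_pow, ← pow_one (X : (C.O x)[X]),
    reflect_C_mul_X_pow, reflect_C]
  simp
  ring

/-- The discriminant of the local equation. -/
def fibreDisc : C.O x :=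
  (fibreEq a₁ a₂ x).coeff 1 ^ 2 - 4 * (fibreEq a₁ a₂ x).coeff 2 * (fibreEq a₁ a₂ x).coeff 0

/-- The discriminant of the local equation is the discriminant of the spectral curve, up to a
square. -/
theorem exists_fibreDisc_eq : ∃ c : C.K, c ≠ 0 ∧
    algebraMap (C.O x) C.K (fibreDisc a₁ a₂ x) = c ^ 2 * coeff2 (C.dt x) (discr a₁ a₂) := by
  obtain ⟨c, hc, h⟩ := exists_map_fibreEq a₁ a₂ x
  have hcoeff : ∀ n, algebraMap (C.O x) C.K ((fibreEq a₁ a₂ x).coeff n) =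
      c * (charPoly (C.dt x) a₁ a₂).coeff n := fun n => by
    rw [← Polynomial.coeff_map, h, Polynomial.coeff_C_mul]
  refine ⟨2 * c, mul_ne_zero two_ne_zero hc, ?_⟩
  rw [fibreDisc, map_sub, map_mul, map_mul, map_pow, hcoeff, hcoeff, hcoeff, map_ofNat,
    coeff2_discr (C.dt_ne_zero x)]
  simp [charPoly, coeff_X, coeff_C]
  ring

variable {a₁ a₂} in
theorem exists_fibreDisc_eq_param_pow_mul (h : discr a₁ a₂ ≠ 0) : ∃ (N : ℕ) (u : C.O x), IsUnit u ∧
    fibreDisc a₁ a₂ x = C.param x ^ N * u ∧ (Odd N ↔ Odd (discrDiv a₁ a₂ x)) := by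
  obtain ⟨c, hc, hd⟩ := exists_fibreDisc_eq a₁ a₂ x
  have hβ : coeff2 (C.dt x) (discr a₁ a₂) ≠ 0 := (coeff2_eq_zero_iff (C.dt_ne_zero x) _).not.2 h
  have hd0 : fibreDisc a₁ a₂ x ≠ 0 := by
    rintro h0
    rw [h0, map_zero] at hd
    exact mul_ne_zero (pow_ne_zero 2 hc) hβ hd.symm
  obtain ⟨N, u, hu⟩ := IsDiscreteValuationRing.eq_unit_mul_pow_irreducible hd0
    (C.irreducible_param x)
  refine ⟨N, u, u.isUnit, by rw [hu, mul_comm], ?_⟩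
  have h1 := congrArg (C.place x).ord hd
  have hu0 : algebraMap (C.O x) C.K (u : C.O x) ≠ 0 := fun h0 => by
    have := C.place_val_eq_one_of_isUnit x u.isUnit
    simp [h0] at this
  have ht0 : algebraMap (C.O x) C.K (C.param x) ≠ 0 :=
    (map_ne_zero_iff _ (IsFractionRing.injective (C.O x) C.K)).2 (C.irreducible_param x).ne_zero
  have huord : (C.place x).ord (algebraMap (C.O x) C.K (u : C.O x)) = 0 := by
    rw [Place.ord_eq_of_val_eq _ (n := 0)
      (by rw [C.place_val_eq_one_of_isUnit x u.isUnit, WithZero.exp_zero]), neg_zero]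
  rw [hu, map_mul, map_pow, Place.ord_mul _ hu0 (pow_ne_zero _ ht0),
    Place.ord_mul _ (pow_ne_zero _ hc) hβ,
    Place.ord_pow, Place.ord_pow, place_ord_param, huord] at h1
  change _ = _ + discrDiv a₁ a₂ x at h1
  rw [← Int.odd_coe_nat, show (N : ℤ) = 2 * (C.place x).ord c + discrDiv a₁ a₂ x by
    push_cast at h1; linarith,
    Int.odd_add']
  simp

theorem not_forall_value_coeff_eq_zero : ¬ (C.value x ((fibreEq a₁ a₂ x).coeff 2) = 0 ∧
    C.value x ((fibreEq a₁ a₂ x).coeff 1) = 0 ∧ C.value x ((fibreEq a₁ a₂ x).coeff 0) = 0) := by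
  rintro ⟨h2, h1, h0⟩
  simp only [value_eq_zero_iff, maximalIdeal_eq_span_param, Ideal.mem_span_singleton] at h0 h1 h2
  refine (C.irreducible_param x).not_isUnit (fibreEq_isPrimitive a₁ a₂ x _ ?_)
  rw [Polynomial.C_dvd_iff_dvd_coeff]
  intro n
  rcases lt_or_ge 2 n with hn | hn
  · rw [Polynomial.coeff_eq_zero_of_natDegree_lt ((natDegree_fibreEq_le a₁ a₂ x).trans_lt hn)]
    exact dvd_zero _
  · interval_cases n <;> assumption

variable {a₁ a₂} {x}

namespace SpectralPoint

/-- Both charts have a quadratic equation with the same discriminant. -/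
theorem exists_localEq_eq (P : SpectralPoint a₁ a₂) : ∃ a b c : C.O P.base,
    localEq a₁ a₂ P.base P.fibre = Polynomial.C a * X ^ 2 + Polynomial.C b * X + Polynomial.C c ∧
    b ^ 2 - 4 * a * c = fibreDisc a₁ a₂ P.base ∧
    ¬ (C.value P.base a = 0 ∧ C.value P.base b = 0 ∧ C.value P.base c = 0) := by
  obtain ⟨x, y, hv⟩ := P
  have h := not_forall_value_coeff_eq_zero a₁ a₂ x
  cases y with
  | infty =>
    refine ⟨_, _, _, reflect_fibreEq_eq a₁ a₂ x, ?_, ?_⟩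
    · rw [fibreDisc]
      ring
    · tauto
  | coe y => exact ⟨_, _, _, fibreEq_eq a₁ a₂ x, rfl, h⟩

/-- The point as a point of a quadratic cover of the germ of `C`. -/
def germ (P : SpectralPoint a₁ a₂) : QuadraticGerm (C.O P.base) where
  toTaylorData := C.taylorData P.base
  poly := localEq a₁ a₂ P.base P.fibre
  a := P.exists_localEq_eq.choose
  b := P.exists_localEq_eq.choose_spec.choose
  c := P.exists_localEq_eq.choose_spec.choose_spec.choose
  poly_eq := P.exists_localEq_eq.choose_spec.choose_spec.choose_spec.1
  primitive := P.exists_localEq_eq.choose_spec.choose_spec.choose_spec.2.2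
  pt := { (C.kappaEquiv P.base).toAlgHom.toRingHom.comp P.eval with
    commutes' := fun c => by
      change C.kappaEquiv P.base (P.eval (AdjoinRoot.of _ (algebraMap ℂ (C.O P.base) c))) = _
      rw [eval, AdjoinRoot.lift_of]
      exact (C.value P.base).commutes c }
  pt_of f := by
    change C.kappaEquiv P.base (P.eval (AdjoinRoot.of _ f)) = _
    rw [eval, AdjoinRoot.lift_of]
    rfl
  ideal := P.ideal
  isPrime := inferInstance
  mem_ideal_iff z := by
    change P.eval z = 0 ↔ C.kappaEquiv P.base (P.eval z) = 0
    exact (map_eq_zero_iff _ (C.kappaEquiv P.base).injective).symm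

theorem germ_disc (P : SpectralPoint a₁ a₂) : P.germ.disc = fibreDisc a₁ a₂ P.base :=
  P.exists_localEq_eq.choose_spec.choose_spec.choose_spec.2.1

theorem algebraMap_param (P : SpectralPoint a₁ a₂) :
    algebraMap (C.O P.base) P.LocalRing (C.param P.base) =
      algebraMap P.germ.Chart P.germ.Local (AdjoinRoot.of _ P.germ.param) :=
  IsScalarTower.algebraMap_apply (C.O P.base) P.Chart P.LocalRing _

/-- A point is a cusp exactly if the discriminant has odd order at its base point. If the order is
even, there is a branch parametrised by the base; if it is odd, the local rings are known. -/
theorem isCusp_iff (h : discr a₁ a₂ ≠ 0) (P : SpectralPoint a₁ a₂) :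
    P.IsCusp ↔ Odd (discrDiv a₁ a₂ P.base) := by
  obtain ⟨N, u, hu, hd, hodd⟩ := exists_fibreDisc_eq_param_pow_mul P.base h
  rw [← germ_disc] at hd
  rw [← hodd]
  rcases Nat.even_or_odd N with hN | hN
  · refine iff_of_false ?_ (Nat.not_odd_iff_even.2 hN)
    obtain ⟨k, rfl⟩ := even_iff_two_dvd.1 hN
    obtain ⟨B, hB⟩ := P.germ.exists_branch_of_even hu hd
    rintro (⟨m, hm, ⟨e⟩⟩ | ⟨-, h2⟩)
    · exact (P.germ.isEmpty_algEquiv_cuspRing_of_branch hB hm).false e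
    · rw [algebraMap_param] at h2
      exact P.germ.algebraMap_param_notMem_of_branch hB h2
  · refine iff_of_true ?_ hN
    have ha := P.germ.value_a_ne_zero (QuadraticGerm.pt_sqrtDisc_eq_zero hN.pos.ne' hd)
    obtain ⟨m, rfl⟩ := hN
    rcases Nat.eq_zero_or_pos m with rfl | hm
    · right
      rw [mul_zero, zero_add, pow_one] at hd
      have := P.germ.isRegularLocalRing_of_disc ha hu hd
      rw [← algebraMap_param] at this
      exact this
    · exact Or.inl ⟨m, hm, P.germ.nonempty_algEquiv_cuspRing ha hu hd⟩

end SpectralPoint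

end NonsingularCurve

/-! ### Cusps and the genus of the spectral curve -/

namespace NonsingularCurve

variable {C : NonsingularCurve} {a₁ : C.Mero1} {a₂ : C.Mero2}

section Fibre

variable (h : discr a₁ a₂ ≠ 0) {x : C.Pt} (hx : Odd (discrDiv a₁ a₂ x))

include h hx

/-- At a point of odd order the discriminant of the local equation vanishes. -/
theorem residue_fibreDisc_eq_zero : IsLocalRing.residue (C.O x) ((fibreEq a₁ a₂ x).coeff 1) ^ 2 -
    4 * IsLocalRing.residue (C.O x) ((fibreEq a₁ a₂ x).coeff 2) *
      IsLocalRing.residue (C.O x) ((fibreEq a₁ a₂ x).coeff 0) = 0 := by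
  obtain ⟨N, u, hu, hd, hodd⟩ := exists_fibreDisc_eq_param_pow_mul x h
  have h1 : IsLocalRing.residue (C.O x) (fibreDisc a₁ a₂ x) = 0 := by
    rw [hd, map_mul, map_pow, (IsLocalRing.residue_eq_zero_iff _).2 (C.param_mem x),
      zero_pow (hodd.2 hx).pos.ne', zero_mul]
  rw [← h1, fibreDisc, map_sub, map_mul, map_mul, map_pow, map_ofNat]

/-- Over a point of odd order the local equation has a double root on the projective line, so there
is exactly one point of the spectral curve. -/
theorem existsUnique_vanishes : ∃! y : OnePoint (C.kappa x),
    (localEq a₁ a₂ x y).eval₂ (IsLocalRing.residue (C.O x)) (coord x y) = 0 := by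
  have hD := residue_fibreDisc_eq_zero h hx
  have hprim := not_forall_value_coeff_eq_zero a₁ a₂ x
  simp only [value_eq_zero_iff, ← IsLocalRing.residue_eq_zero_iff] at hprim
  have : CharZero (C.kappa x) :=
    charZero_of_injective_algebraMap (algebraMap ℂ (C.kappa x)).injective
  have hcoe : ∀ y : C.kappa x, (localEq a₁ a₂ x (y : OnePoint (C.kappa x))).eval₂
      (IsLocalRing.residue (C.O x)) (coord x (y : OnePoint (C.kappa x))) =
      IsLocalRing.residue (C.O x) ((fibreEq a₁ a₂ x).coeff 2) * y ^ 2 +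
      IsLocalRing.residue (C.O x) ((fibreEq a₁ a₂ x).coeff 1) * y +
      IsLocalRing.residue (C.O x) ((fibreEq a₁ a₂ x).coeff 0) := fun y => by
    change (fibreEq a₁ a₂ x).eval₂ _ y = _
    conv_lhs => rw [fibreEq_eq]
    simp [eval₂_add, eval₂_mul]
  have hinf : (localEq a₁ a₂ x OnePoint.infty).eval₂
      (IsLocalRing.residue (C.O x)) (coord x OnePoint.infty) =
      IsLocalRing.residue (C.O x) ((fibreEq a₁ a₂ x).coeff 2) := by
    change ((fibreEq a₁ a₂ x).reflect 2).eval₂ _ 0 = _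
    rw [reflect_fibreEq_eq]
    simp [eval₂_add, eval₂_mul]
  generalize IsLocalRing.residue (C.O x) ((fibreEq a₁ a₂ x).coeff 2) = a at *
  generalize IsLocalRing.residue (C.O x) ((fibreEq a₁ a₂ x).coeff 1) = b at *
  generalize IsLocalRing.residue (C.O x) ((fibreEq a₁ a₂ x).coeff 0) = c at *
  have hroot : ∀ y : C.kappa x, a * y ^ 2 + b * y + c = 0 → 2 * a * y + b = 0 := fun y hy => by
    rw [← sq_eq_zero_iff]
    linear_combination 4 * a * hy + hD
  by_cases ha : a = 0
  · refine ⟨OnePoint.infty, hinf.trans ha, fun y hy => ?_⟩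
    cases y with
    | infty => rfl
    | coe y =>
      rw [hcoe] at hy
      have hb := hroot y hy
      rw [ha, mul_zero, zero_mul, zero_add] at hb
      rw [ha, hb] at hy
      exact absurd ⟨ha, hb, by simpa using hy⟩ hprim
  · refine ⟨((-b / (2 * a) : C.kappa x) : OnePoint (C.kappa x)), ?_, fun y hy => ?_⟩
    · beta_reduce
      rw [hcoe]
      field_simp
      linear_combination -hD
    · cases y with
      | infty => exact absurd (hinf.symm.trans hy) ha
      | coe y =>
        rw [hcoe] at hy
        have := hroot y hy
        congr 1
        field_simp
        linear_combination this

end Fibre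

/-- The cusps of the spectral curve correspond to the points of odd order of the discriminant. -/
theorem bijOn_base (h : discr a₁ a₂ ≠ 0) : Set.BijOn SpectralPoint.base
    {P : SpectralPoint a₁ a₂ | P.IsCusp} {x : C.Pt | Odd (discrDiv a₁ a₂ x)} := by
  refine ⟨fun P hP => (P.isCusp_iff h).1 hP, ?_, fun x hx => ?_⟩
  · rintro ⟨x, y, hy⟩ hP ⟨x', y', hy'⟩ - hxx
    obtain rfl : x = x' := hxx
    obtain rfl := (existsUnique_vanishes h ((SpectralPoint.isCusp_iff h _).1 hP)).unique hy hy'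
    rfl
  · obtain ⟨y, hy, -⟩ := existsUnique_vanishes h hx
    exact ⟨⟨x, y, hy⟩, (SpectralPoint.isCusp_iff h _).2 hx, rfl⟩

theorem delta_eq_ncard (h : {x : C.Pt | discrDiv a₁ a₂ x ≠ 0}.Finite) :
    delta a₁ a₂ = {x : C.Pt | Odd (discrDiv a₁ a₂ x)}.ncard := by
  have hpos : {x : C.Pt | 0 < discrDiv a₁ a₂ x ∧ Odd (discrDiv a₁ a₂ x)}.Finite :=
    h.subset fun x hx => hx.1.ne'
  have hneg : {x : C.Pt | 0 < -discrDiv a₁ a₂ x ∧ Odd (-discrDiv a₁ a₂ x)}.Finite :=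
    h.subset fun x hx => (neg_pos.1 hx.1).ne
  have hdisj : Disjoint {x : C.Pt | 0 < discrDiv a₁ a₂ x ∧ Odd (discrDiv a₁ a₂ x)}
      {x : C.Pt | 0 < -discrDiv a₁ a₂ x ∧ Odd (-discrDiv a₁ a₂ x)} :=
    Set.disjoint_left.2 fun x h1 h2 => lt_asymm h1.1 (neg_pos.1 h2.1)
  refine (Set.ncard_union_eq hdisj hpos hneg).symm.trans (congrArg Set.ncard ?_)
  ext x
  simp only [Set.mem_union, Set.mem_ofPred_eq, odd_neg]
  constructor
  · tauto
  · intro hx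
    have h0 : discrDiv a₁ a₂ x ≠ 0 := fun h0 => by simp [h0] at hx
    exact h0.lt_or_gt.symm.imp (⟨·, hx⟩) (⟨neg_pos.2 ·, hx⟩)

/-- An irreducible spectral curve has no rational point over the function field, so its discriminant
is not a square. -/
theorem coeff2_discr_ne_sq (hirr : IsIrreducibleSpectral a₁ a₂) (r : C.K) :
    coeff2 C.frame (discr a₁ a₂) ≠ r ^ 2 := by
  intro hr
  rw [coeff2_discr frame_ne_zero] at hr
  have hroot : (charPoly C.frame a₁ a₂).IsRoot (r - coeff1 C.frame a₁ / 2) := by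
    rw [IsRoot.def, charPoly]
    simp only [eval_add, eval_mul, eval_pow, eval_X, eval_C]
    linear_combination -hr
  have h1 := Polynomial.degree_eq_one_of_irreducible_of_root hirr hroot
  rw [charPoly, ← one_mul (X ^ 2 : C.K[X]), ← Polynomial.C_1,
    Polynomial.degree_quadratic one_ne_zero] at h1
  exact absurd h1 (by decide)

theorem discr_ne_zero (hirr : IsIrreducibleSpectral a₁ a₂) : discr a₁ a₂ ≠ 0 := by
  exact (coeff2_eq_zero_iff frame_ne_zero _).not.1 (by simpa using coeff2_discr_ne_sq hirr 0)

theorem eval₂_charPoly {R : Type*} [CommRing R] (j : C.K →+* R) (r : R) (ω a₁ : C.Mero1)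
    (a₂ : C.Mero2) : (charPoly ω a₁ a₂).eval₂ j r =
      r ^ 2 + j (coeff1 ω a₁) * r + j (coeff2 ω a₂) := by
  rw [charPoly, eval₂_add, eval₂_add, eval₂_mul, eval₂_pow, eval₂_X, eval₂_C, eval₂_C]

theorem monic_charPoly (ω a₁ : C.Mero1) (a₂ : C.Mero2) : (charPoly ω a₁ a₂).Monic := by
  rw [charPoly]
  monicity!

theorem natDegree_charPoly (ω a₁ : C.Mero1) (a₂ : C.Mero2) : (charPoly ω a₁ a₂).natDegree = 2 := by
  rw [charPoly]
  compute_degree!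

/-- The genus formula in terms of the places of the function field of `C`: the function field of the
spectral curve is obtained by adjoining a square root of the discriminant. -/
theorem exists_genus_eq (hirr : IsIrreducibleSpectral a₁ a₂) : ∃ g p : ℕ,
    C.genus = g ∧ geometricGenus a₁ a₂ hirr = p ∧
    (2 * p : ℤ) = 4 * g - 2 + {x : C.Pt | Odd (discrDiv a₁ a₂ x)}.ncard := by
  have : Fact (Irreducible (charPoly C.frame a₁ a₂)) := ⟨hirr⟩
  set α₁ := coeff1 C.frame a₁ with hα₁
  set α₂ := coeff2 C.frame a₂ with hα₂
  set β := coeff2 C.frame (discr a₁ a₂) with hβdef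
  have hβ : β = α₁ ^ 2 / 4 - α₂ := coeff2_discr frame_ne_zero a₁ a₂
  let ι : C.K →+* SpectralField a₁ a₂ := algebraMap C.K (SpectralField a₁ a₂)
  let z : SpectralField a₁ a₂ := AdjoinRoot.root _
  have hz : z ^ 2 + ι α₁ * z + ι α₂ = 0 := by
    have := AdjoinRoot.eval₂_root (charPoly C.frame a₁ a₂)
    rwa [eval₂_charPoly] at this
  -- completing the square
  set y : SpectralField a₁ a₂ := z + ι (α₁ / 2) with hy
  have hα : ι α₁ = 2 * ι (α₁ / 2) := by
    rw [← map_ofNat ι 2, ← map_mul, mul_div_cancel₀ _ two_ne_zero]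
  have hy2 : y ^ 2 = ι β := by
    have h4 : ι (α₁ ^ 2 / 4) = ι (α₁ / 2) ^ 2 := by
      rw [← map_pow]
      congr 1
      ring
    rw [hβ, map_sub, h4, hy]
    rw [hα] at hz
    linear_combination hz
  have hfd : FiniteDimensional C.K (SpectralField a₁ a₂) :=
    (monic_charPoly C.frame a₁ a₂).finite_adjoinRoot
  have h2 : Module.finrank C.K (SpectralField a₁ a₂) = 2 := by
    rw [(AdjoinRoot.powerBasis hirr.ne_zero).finrank, AdjoinRoot.powerBasis_dim, natDegree_charPoly]
  have hyK : y ∉ (algebraMap C.K (SpectralField a₁ a₂)).range := by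
    rintro ⟨r, hr⟩
    refine coeff2_discr_ne_sq hirr r (ι.injective ?_)
    rw [map_pow, ← hy2]
    exact congrArg (· ^ 2) hr.symm
  have hgen : ∀ f : SpectralField a₁ a₂, ∃ a b : C.K, f = ι a + ι b * y := by
    intro f
    obtain ⟨p, rfl⟩ := AdjoinRoot.mk_surjective f
    have hdeg : (p %ₘ charPoly C.frame a₁ a₂).natDegree ≤ 1 := by
      have := Polynomial.natDegree_modByMonic_lt p (monic_charPoly C.frame a₁ a₂)
        (fun h => by simpa [h] using natDegree_charPoly C.frame a₁ a₂)
      rw [natDegree_charPoly] at this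
      omega
    obtain ⟨b, a, hab⟩ := Polynomial.exists_eq_X_add_C_of_natDegree_le_one hdeg
    refine ⟨a - b * (α₁ / 2), b, ?_⟩
    have h1 : AdjoinRoot.mk (charPoly C.frame a₁ a₂) p =
        AdjoinRoot.mk (charPoly C.frame a₁ a₂) (p %ₘ charPoly C.frame a₁ a₂) :=
      AdjoinRoot.mk_eq_mk.2 ⟨p /ₘ charPoly C.frame a₁ a₂, by
        linear_combination -Polynomial.modByMonic_add_div p (charPoly C.frame a₁ a₂)⟩
    rw [h1, hab, map_add, map_mul, AdjoinRoot.mk_X, AdjoinRoot.mk_C, AdjoinRoot.mk_C, hy, map_sub,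
      map_mul]
    change ι b * z + ι a = _
    ring
  -- the conjugation exchanges the two roots
  let σ : SpectralField a₁ a₂ →ₐ[C.K] SpectralField a₁ a₂ :=
    AdjoinRoot.liftAlgHom (charPoly C.frame a₁ a₂) (Algebra.ofId _ _) (-ι α₁ - z) (by
      refine (eval₂_charPoly _ _ _ _ _).trans ?_
      change (-ι α₁ - z) ^ 2 + ι α₁ * (-ι α₁ - z) + ι α₂ = 0
      linear_combination hz)
  have hσ : σ y = -y := by
    have hσz : σ z = -ι α₁ - z := AdjoinRoot.liftAlgHom_root _ _ _ _
    rw [hy, map_add, hσz]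
    change _ + σ (algebraMap C.K _ (α₁ / 2)) = _
    rw [AlgHom.commutes, hα]
    change _ + ι (α₁ / 2) = _
    ring
  have hβ0 : β ≠ 0 := by simpa using coeff2_discr_ne_sq hirr 0
  have : IsCurveField (SpectralField a₁ a₂) := IsCurveField.of_finiteDimensional (F := C.K)
  obtain ⟨g, p, hg, hp, hgp⟩ := Place.genus_quadratic hy2 hyK hgen σ hσ hβ0 h2
  refine ⟨g, p, (Place.genus_eq_of_bijective C.place
    ⟨C.place_injective, C.place_surjective⟩).trans hg, hp, ?_⟩
  rw [hgp]
  congr 2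
  symm
  refine Set.ncard_congr (fun x _ => C.place x) ?_ ?_ ?_
  · intro x hx
    exact (odd_ord2_iff frame_ne_zero (discr_ne_zero hirr) x).1 hx
  · intro x x' _ _ hxx
    exact C.place_injective hxx
  · intro P hP
    obtain ⟨x, rfl⟩ := C.place_surjective P
    exact ⟨x, (odd_ord2_iff frame_ne_zero (discr_ne_zero hirr) x).2 hP, rfl⟩

end NonsingularCurve

theorem mainTheorem4 (C : NonsingularCurve) (a₁ : C.Mero1) (a₂ : C.Mero2)
    (hirr : NonsingularCurve.IsIrreducibleSpectral a₁ a₂) :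
    {x : C.Pt | NonsingularCurve.discrDiv a₁ a₂ x ≠ 0}.Finite ∧
    {P : NonsingularCurve.SpectralPoint a₁ a₂ | P.IsCusp}.Finite ∧
    NonsingularCurve.delta a₁ a₂ =
      {P : NonsingularCurve.SpectralPoint a₁ a₂ | P.IsCusp}.ncard ∧
    ∃ g p : ℕ, C.genus = g ∧ NonsingularCurve.geometricGenus a₁ a₂ hirr = p ∧
      (p : ℚ) = 2 * g - 1 +
        ({P : NonsingularCurve.SpectralPoint a₁ a₂ | P.IsCusp}.ncard : ℚ) / 2 := by
  have h0 := NonsingularCurve.discr_ne_zero hirr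
  have hfin : {x : C.Pt | NonsingularCurve.discrDiv a₁ a₂ x ≠ 0}.Finite :=
    NonsingularCurve.finite_setOf_ord2_ne_zero h0
  have hbij := NonsingularCurve.bijOn_base h0
  have hodd : {x : C.Pt | Odd (NonsingularCurve.discrDiv a₁ a₂ x)}.Finite :=
    hfin.subset fun x (hx : Odd _) h => by simp [h] at hx
  have hcard : {P : NonsingularCurve.SpectralPoint a₁ a₂ | P.IsCusp}.ncard =
      {x : C.Pt | Odd (NonsingularCurve.discrDiv a₁ a₂ x)}.ncard := by
    rw [← hbij.image_eq, hbij.injOn.ncard_image]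
  obtain ⟨g, p, hg, hp, hgp⟩ := NonsingularCurve.exists_genus_eq hirr
  refine ⟨hfin, hbij.finite_iff_finite.2 hodd, ?_, g, p, hg, hp, ?_⟩
  · rw [hcard, NonsingularCurve.delta_eq_ncard hfin]
  · rw [hcard]
    have : (2 * p : ℚ) = 4 * g - 2 +
        ({x : C.Pt | Odd (NonsingularCurve.discrDiv a₁ a₂ x)}.ncard : ℚ) := by exact_mod_cast hgp
    linarith

end
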